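/- Let $G$ be a finite simple graph with $n$ vertices and $m$ edges, and let $H$ be a subgraph of $G$. A connected component of $H$ is called bad if it is not a path on exactly $5$ vertices. Let $G_1$ be the spanning subgraph of $G$ whose edges are the edges $\{v_1,v_2\}$ of $G$ such that $v_1$ and $v_2$ lie in two different connected components of $H$, at least one of which is bad. A path-cycle cover of $G_1$ is a set $F$ of edges of $G_1$ such that every vertex is incident to at most two edges of $F$. The set $F$ saturates a bad component $K$ of $H$ if some edge of $F$ is incident to a vertex of $K$, and the weight of $F$ is the number of bad components of $H$ that it saturates. Then, given $G$ and $H$ (by the edge lists of $G$ and $H$ and the indicator of the vertex set of $H$), a path-cycle cover of $G_1$ of maximum weight can be computed in $O(nm\log n)$ time. More precisely, there is one program for the word RAM that, on every such input, outputs a maximum-weight path-cycle cover of $G_1$ after at most $C\,(nm\log n+1)$ steps using words of at most $c(\lfloor\log_2 n\rfloor+1)$ bits, where the constants $c$ and $C$ do not depend on the input (for $n = 0$ read $nm\log n$ and $\lfloor\log_2 n\rfloor$ as $0$). -/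

import Mathlib

/-! ### Paths, bad components, the graph `G₁`, and path-cycle covers -/

namespace PathCover

universe u

/-- A graph is a path if it is a single vertex, or if it is connected, exactly two of its vertices
have degree `1` and all the others have degree `2`. -/
def IsPathShaped {W : Type u} (J : SimpleGraph W) : Prop :=
  Nat.card W = 1 ∨
    (J.Connected ∧ {v : W | (J.neighborSet v).ncard = 1}.ncard = 2 ∧
      ∀ v : W, (J.neighborSet v).ncard = 1 ∨ (J.neighborSet v).ncard = 2)

/-- A `k`-path is a path with exactly `k` vertices. -/
def IsKPath {W : Type u} (k : ℕ) (J : SimpleGraph W) : Prop :=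
  IsPathShaped J ∧ Nat.card W = k

variable {V : Type u} {G : SimpleGraph V}

/-- The connected components of a subgraph `H` of `G`. -/
abbrev Component (H : G.Subgraph) : Type u := H.coe.ConnectedComponent

/-- The set of vertices of a component of `H`, as a set of vertices of `G`. -/
def Component.vertices {H : G.Subgraph} (K : Component H) : Set V :=
  Subtype.val '' K.supp

/-- A bad component of `H` is a connected component that is not a `5`-path. -/
def IsBad {H : G.Subgraph} (K : Component H) : Prop :=
  ¬ IsKPath 5 K.toSimpleGraph

/-- The spanning subgraph `G₁` of `G`: its edges are the edges of `G` whose endpoints lie in two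
different components of `H`, at least one of which is bad. -/
def crossGraph (H : G.Subgraph) : SimpleGraph V where
  Adj v₁ v₂ := G.Adj v₁ v₂ ∧ ∃ K₁ K₂ : Component H,
    v₁ ∈ K₁.vertices ∧ v₂ ∈ K₂.vertices ∧ K₁ ≠ K₂ ∧ (IsBad K₁ ∨ IsBad K₂)
  symm := ⟨fun _ _ h => ⟨h.1.symm, by
    obtain ⟨_, K₁, K₂, h₁, h₂, h₃, h₄⟩ := h
    exact ⟨K₂, K₁, h₂, h₁, h₃.symm, h₄.symm⟩⟩⟩
  loopless := ⟨fun _ h => h.1.ne rfl⟩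

/-- A path-cycle cover of a graph is a set `F` of its edges such that every vertex is incident to
at most two edges of `F`. -/
def IsPathCycleCover (J : SimpleGraph V) (F : Set (Sym2 V)) : Prop :=
  F ⊆ J.edgeSet ∧ ∀ v : V, {e ∈ F | v ∈ e}.encard ≤ 2

/-- `F` saturates the component `K` of `H` if some edge of `F` is incident to a vertex of `K`. -/
def Saturates {H : G.Subgraph} (F : Set (Sym2 V)) (K : Component H) : Prop :=
  ∃ e ∈ F, ∃ v ∈ e, v ∈ K.vertices

/-- The weight of `F` is the number of bad components of `H` that it saturates. -/
noncomputable def weight (H : G.Subgraph) (F : Set (Sym2 V)) : ℕ :=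
  {K : Component H | IsBad K ∧ Saturates F K}.ncard

/-- `F` is a path-cycle cover of `G₁` of maximum weight. -/
def IsMaxWeightCover (H : G.Subgraph) (F : Set (Sym2 V)) : Prop :=
  IsPathCycleCover (crossGraph H) F ∧
    ∀ F' : Set (Sym2 V), IsPathCycleCover (crossGraph H) F' → weight H F' ≤ weight H F

/-! ### The word RAM -/

/-- Instructions. `r`, `a`, `b` are register numbers and `l` is a line of the program. -/
inductive Instr : Type
  /-- `r := k` -/
  | const (r k : ℕ)
  /-- `r := a + b` -/
  | add (r a b : ℕ)
  /-- `r := a - b`, or `0` if `a < b` -/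
  | sub (r a b : ℕ)
  /-- `r := a * b` -/
  | mul (r a b : ℕ)
  /-- `r := ⌊a / b⌋` -/
  | div (r a b : ℕ)
  /-- `r := memory[a]` -/
  | load (r a : ℕ)
  /-- `memory[a] := b` -/
  | store (a b : ℕ)
  /-- go to line `l` -/
  | jump (l : ℕ)
  /-- go to line `l` if `a ≤ b` -/
  | jumpLE (a b l : ℕ)
  /-- stop -/
  | halt

/-- A program is a finite list of instructions; its lines are numbered from `0`. -/
abbrev Program : Type := List Instr

/-- A configuration: program counter, registers and memory. -/
structure Config : Type where
  pc : ℕ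
  reg : ℕ → ℕ
  mem : ℕ → ℕ

/-- The machine has stopped: it is at a `halt` instruction or has left the program. -/
def Halted (P : Program) (s : Config) : Prop :=
  P[s.pc]? = none ∨ P[s.pc]? = some Instr.halt

/-- Write `x` into register `r` and go to the next line. -/
def Config.write (s : Config) (r x : ℕ) : Config :=
  ⟨s.pc + 1, Function.update s.reg r x, s.mem⟩

/-- The effect of one instruction. -/
def Instr.apply (s : Config) : Instr → Config
  | .const r k => s.write r k
  | .add r a b => s.write r (s.reg a + s.reg b)
  | .sub r a b => s.write r (s.reg a - s.reg b)
  | .mul r a b => s.write r (s.reg a * s.reg b)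
  | .div r a b => s.write r (s.reg a / s.reg b)
  | .load r a => s.write r (s.mem (s.reg a))
  | .store a b => ⟨s.pc + 1, s.reg, Function.update s.mem (s.reg a) (s.reg b)⟩
  | .jump l => ⟨l, s.reg, s.mem⟩
  | .jumpLE a b l => ⟨if s.reg a ≤ s.reg b then l else s.pc + 1, s.reg, s.mem⟩
  | .halt => s

/-- One step of the machine, at unit cost. A machine that has stopped stays where it is. -/
def step (P : Program) (s : Config) : Config :=
  match P[s.pc]? with
  | none => s
  | some i => i.apply s

/-- The initial configuration on a list of words: the input is in `memory[0], memory[1], …`, and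
all other memory cells and all registers are `0`. -/
def initial (input : List ℕ) : Config :=
  ⟨0, fun _ => 0, fun i => input.getD i 0⟩

/-- All registers and memory cells hold words of at most `w` bits. -/
def Config.FitsIn (s : Config) (w : ℕ) : Prop :=
  (∀ i, s.reg i < 2 ^ w) ∧ ∀ i, s.mem i < 2 ^ w

/-- On the given input, the word RAM with word length `w` stops after at most `t` steps of the
program `P` in the configuration `s`, without ever exceeding the word length. -/
def RunsTo (P : Program) (w : ℕ) (input : List ℕ) (t : ℕ) (s : Config) : Prop :=
  (∀ i ≤ t, ((step P)^[i] (initial input)).FitsIn w) ∧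
    (step P)^[t] (initial input) = s ∧ Halted P s

/-! ### Encoding of inputs and outputs -/

/-- The list `l` enumerates the set `E` of edges, every edge once, in any order and with its
endpoints in any order. -/
def IsEdgeList {n : ℕ} (E : Set (Sym2 (Fin n))) (l : List (Fin n × Fin n)) : Prop :=
  (l.map fun p => s(p.1, p.2)).Nodup ∧ ∀ e, e ∈ E ↔ e ∈ l.map fun p => s(p.1, p.2)

/-- The words that stand for a list of edges: the two endpoints of each edge in turn. -/
def edgeWords {n : ℕ} (l : List (Fin n × Fin n)) : List ℕ :=
  l.flatMap fun p => [p.1.val, p.2.val]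

open Classical in
/-- The input words for a graph on the vertices `0, …, n - 1` with edge list `eG` and its subgraph
with vertex set `U` and edge list `eH`: the number of vertices, the number of edges of the graph,
the number of edges of the subgraph, the edges of the graph, the indicator of `U`, and the edges of
the subgraph. -/
noncomputable def inputWords {n : ℕ} (eG : List (Fin n × Fin n)) (U : Set (Fin n))
    (eH : List (Fin n × Fin n)) : List ℕ :=
  [n, eG.length, eH.length] ++ edgeWords eG ++
    (List.ofFn fun v : Fin n => if v ∈ U then 1 else 0) ++ edgeWords eH

/-- The memory of `s` starts with the length of `l` followed by the edges of `l`. -/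
def Outputs {n : ℕ} (s : Config) (l : List (Fin n × Fin n)) : Prop :=
  ∀ (i : ℕ) (hi : i < (l.length :: edgeWords l).length), s.mem i = (l.length :: edgeWords l)[i]

end PathCover

/-! ### A structured language for the word RAM -/

namespace CoverRAM

open PathCover

/-! The problem reduces to a bipartite matching. Give every vertex two slots `2 * y` and `2 * y +
1`, and let a bad component compete for both slots of `y` whenever an edge of the cross graph joins
one of its vertices to `y`. In any path-cycle cover, each saturated bad component has an edge of the
cover leaving it; charge the component to the outer end of that edge. A vertex is charged at most
twice, because at most two edges of the cover meet it, so the saturated components can be matched to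
slots. Hence no cover weighs more than a maximum matching (`card_satLabels_le`).

Conversely, a matching chooses for each assigned component `k` an edge from a vertex `x k` of `k` to
a vertex `y k` in another component, its parent. At each vertex at most one chosen edge starts and
at most two end, so the degree may be three. Pruning repairs this: a component with two kept
children, or with one kept child and a kept parent, gives up its own edge and remains saturated by a
child. If its parent thereby loses its last edge, the parent's own edge is restored. The number of
kept components with kept parents decreases each time (`links_pruneAt_lt`), and every assigned
component stays saturated (`covers_pruneAt`). When nothing is superfluous, all degrees are at most
two (`EdgeChoice.isPathCycleCover`), so the bound is attained.

The matching is found by an auction. A bidder has a label that is a lower bound for the prices of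
all its slots. It takes a slot whose price does not exceed its label, raises that price to its label
plus one, and ejects the previous owner. It raises its label when its list is exhausted, and gives
up at label `N = min n E + 1`, where `E` is the number of entries, that is, of pairs formed by a
choice of edge and a slot. There are fewer than `N` assigned bidders, so some level `g` between `1`
and `N` is not one more than the label of any of them. All slots wanted by bidders of label at least
`g` are then owned by such bidders, which is a König-type certificate of optimality
(`Auction.Inv.certificate`). A potential that increases in every step and is bounded by `O(E N + n
N)` gives the running time (`Auction.Inv.next`, `Auction.Inv.work_le`).

The algorithm is written in a small structured language whose compilation to the word RAM preserves
step counts (`Run.simulate`). Since words grow by at most one unit per step, polynomial time already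
yields words of `O(log n)` bits. The total time is in fact `O(nm + 1)`; the logarithm in the
statement is only slack. -/

/-- The variables of structured programs. -/
inductive Var
  | zero | one | n | m | pU | pH | lim | j | p | a | b | ca | cb | u | w | E | N | K | l | c | e
  | o | q
  deriving DecidableEq

/-- The arrays of structured programs. -/
inductive Arr
  | comp | deg | inU | sz | c1 | c2 | bad | src | dst | slot | head | next | cur | lab | price | own
  | mate | keep | cnt | par
  deriving DecidableEq

/-- The register that holds a variable. -/
def Var.reg (x : Var) : ℕ := x.ctorIdx + 6

theorem Var.reg_injective : Function.Injective Var.reg := by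
  intro x y h
  have h' : x.ctorIdx = y.ctorIdx := by simpa [Var.reg] using h
  revert h'
  cases x <;> cases y <;> first | (intro; rfl) | (intro h; simp [Var.ctorIdx] at h)

theorem Arr.ctorIdx_lt (A : Arr) : A.ctorIdx < 20 := by
  cases A <;> decide

theorem Arr.ctorIdx_injective : Function.Injective Arr.ctorIdx := by
  intro x y h'
  revert h'
  cases x <;> cases y <;> first | (intro; rfl) | (intro h; simp [Arr.ctorIdx] at h)

/-- A state of a structured program: variables, arrays, and the input area. -/
structure St where
  v : Var → ℕ
  a : Arr → ℕ → ℕ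
  inp : ℕ → ℕ

def St.setV (s : St) (x : Var) (k : ℕ) : St := ⟨fun y => if y = x then k else s.v y, s.a, s.inp⟩

def St.setA (s : St) (A : Arr) (i k : ℕ) : St :=
  ⟨s.v, fun A' => if A' = A then Function.update (s.a A) i k else s.a A', s.inp⟩

def St.setI (s : St) (i k : ℕ) : St := ⟨s.v, s.a, Function.update s.inp i k⟩

@[simp] theorem St.setV_v (s : St) (x y : Var) (k : ℕ) :
    (s.setV x k).v y = if y = x then k else s.v y := rfl
@[simp] theorem St.setV_a (s : St) (x : Var) (k : ℕ) : (s.setV x k).a = s.a := rfl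
@[simp] theorem St.setV_inp (s : St) (x : Var) (k : ℕ) : (s.setV x k).inp = s.inp := rfl
@[simp] theorem St.setA_v (s : St) (A : Arr) (i k : ℕ) : (s.setA A i k).v = s.v := rfl
@[simp] theorem St.setA_a (s : St) (A A' : Arr) (i k : ℕ) :
    (s.setA A i k).a A' = if A' = A then Function.update (s.a A) i k else s.a A' := rfl
@[simp] theorem St.setA_inp (s : St) (A : Arr) (i k : ℕ) : (s.setA A i k).inp = s.inp := rfl
@[simp] theorem St.setI_v (s : St) (i k : ℕ) : (s.setI i k).v = s.v := rfl
@[simp] theorem St.setI_a (s : St) (i k : ℕ) : (s.setI i k).a = s.a := rfl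
@[simp] theorem St.setI_inp (s : St) (i k : ℕ) :
    (s.setI i k).inp = Function.update s.inp i k := rfl

/-- Elementary operations. -/
inductive Op
  /-- `x := k` -/
  | set (x : Var) (k : ℕ)
  /-- `x := y` -/
  | mov (x y : Var)
  /-- `x := y + z` -/
  | plus (x y z : Var)
  /-- `x := x + 1` -/
  | inc (x : Var)
  /-- `x := x - 1` -/
  | dec (x : Var)
  /-- `x := A[y]` -/
  | ld (x : Var) (A : Arr) (y : Var)
  /-- `A[x] := y` -/
  | st (A : Arr) (x y : Var)
  /-- `x := input[y]` -/
  | rd (x y : Var)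
  /-- `input[x] := y` -/
  | wr (x y : Var)

/-- Conditions of branches and loops. -/
inductive Cond
  | le (x y : Var)
  | lt (x y : Var)
  | eq (x y : Var)

/-- Structured programs. -/
inductive Cmd
  | op (o : Op)
  | skip
  | seq (c d : Cmd)
  | ite (b : Cond) (c d : Cmd)
  | loop (b : Cond) (c : Cmd)

def Op.eval (s : St) : Op → St
  | .set x k => s.setV x k
  | .mov x y => s.setV x (s.v y)
  | .plus x y z => s.setV x (s.v y + s.v z)
  | .inc x => s.setV x (s.v x + 1)
  | .dec x => s.setV x (s.v x - 1)
  | .ld x A y => s.setV x (s.a A (s.v y))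
  | .st A x y => s.setA A (s.v x) (s.v y)
  | .rd x y => s.setV x (s.inp (s.v y))
  | .wr x y => s.setI (s.v x) (s.v y)

/-- The side conditions of an operation: constants are small, sums do not exceed the bound `L`, and
the input area consists of the addresses below `B`. -/
def Op.Ok (B L : ℕ) (s : St) : Op → Prop
  | .set _ k => k ≤ 5
  | .plus _ y z => s.v y + s.v z ≤ L
  | .rd _ y => s.v y < B
  | .wr x _ => s.v x < B
  | _ => True

def Cond.Holds (s : St) : Cond → Prop
  | .le x y => s.v x ≤ s.v y
  | .lt x y => s.v x < s.v y
  | .eq x y => s.v x = s.v y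

/-- Put the address of `A[y]` into register `4`. -/
def addrCode (A : Arr) (y : Var) : List Instr :=
  [.mul 4 y.reg 2, .const 5 A.ctorIdx, .add 4 4 5, .add 4 4 3]

def Op.code : Op → List Instr
  | .set x k => [.const x.reg k]
  | .mov x y => [.add x.reg y.reg 0]
  | .plus x y z => [.add x.reg y.reg z.reg]
  | .inc x => [.add x.reg x.reg 1]
  | .dec x => [.sub x.reg x.reg 1]
  | .ld x A y => addrCode A y ++ [.load x.reg 4]
  | .st A x y => addrCode A x ++ [.store 4 y.reg]
  | .rd x y => [.load x.reg y.reg]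
  | .wr x y => [.store x.reg y.reg]

/-- Put `0` into register `4` if the condition holds and a positive number otherwise. -/
def Cond.code : Cond → List Instr
  | .le x y => [.sub 4 x.reg y.reg]
  | .lt x y => [.add 4 x.reg 1, .sub 4 4 y.reg]
  | .eq x y => [.sub 4 x.reg y.reg, .sub 5 y.reg x.reg, .add 4 4 5]

def Op.cost (o : Op) : ℕ := o.code.length
def Cond.cost (b : Cond) : ℕ := b.code.length

def Cmd.size : Cmd → ℕ
  | .op o => o.cost
  | .skip => 0
  | .seq c d => c.size + d.size
  | .ite b c d => b.cost + 1 + d.size + 1 + c.size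
  | .loop b c => b.cost + 2 + c.size + 1

/-- The machine code of a structured program, placed at line `p`. -/
def Cmd.compile : Cmd → ℕ → List Instr
  | .op o, _ => o.code
  | .skip, _ => []
  | .seq c d, p => c.compile p ++ d.compile (p + c.size)
  | .ite b c d, p =>
      b.code ++ (.jumpLE 4 0 (p + b.cost + 1 + d.size + 1) :: (d.compile (p + b.cost + 1) ++
        (.jump (p + b.cost + 1 + d.size + 1 + c.size) :: c.compile (p + b.cost + 1 + d.size + 1))))
  | .loop b c, p =>
      b.code ++ (.jumpLE 4 0 (p + b.cost + 2) :: .jump (p + b.cost + 2 + c.size + 1) ::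
        (c.compile (p + b.cost + 2) ++ [.jump p]))

theorem Cmd.length_compile (c : Cmd) (p : ℕ) : (c.compile p).length = c.size := by
  induction c generalizing p with
  | op o => rfl
  | skip => rfl
  | seq c d hc hd => simp [Cmd.compile, Cmd.size, hc, hd]
  | ite b c d hc hd =>
    simp only [Cmd.compile, Cmd.size, Cond.cost, List.length_append, List.length_cons, hc, hd]
    omega
  | loop b c hc =>
    simp only [Cmd.compile, Cmd.size, Cond.cost, List.length_append, List.length_cons, hc,
      List.length_nil]
    omega

/-- Big-step semantics with the exact number of machine steps. -/
inductive Run (B L : ℕ) : Cmd → St → ℕ → St → Prop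
  | op {o : Op} {s : St} (h : o.Ok B L s) : Run B L (.op o) s o.cost (o.eval s)
  | skip {s : St} : Run B L .skip s 0 s
  | seq {c d : Cmd} {s s₁ s₂ : St} {t₁ t₂ : ℕ} (h₁ : Run B L c s t₁ s₁) (h₂ : Run B L d s₁ t₂ s₂) :
      Run B L (.seq c d) s (t₁ + t₂) s₂
  | ite_true {b : Cond} {c d : Cmd} {s s₁ : St} {t : ℕ} (hb : b.Holds s) (h : Run B L c s t s₁) :
      Run B L (.ite b c d) s (b.cost + 1 + t) s₁
  | ite_false {b : Cond} {c d : Cmd} {s s₁ : St} {t : ℕ} (hb : ¬ b.Holds s)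
      (h : Run B L d s t s₁) : Run B L (.ite b c d) s (b.cost + 1 + t + 1) s₁
  | loop_true {b : Cond} {c : Cmd} {s s₁ s₂ : St} {t₁ t₂ : ℕ} (hb : b.Holds s)
      (h₁ : Run B L c s t₁ s₁) (h₂ : Run B L (.loop b c) s₁ t₂ s₂) :
      Run B L (.loop b c) s (b.cost + 1 + t₁ + 1 + t₂) s₂
  | loop_false {b : Cond} {c : Cmd} {s : St} (hb : ¬ b.Holds s) :
      Run B L (.loop b c) s (b.cost + 2) s

/-! ### Correctness of the translation -/

/-- The program `P` contains the instructions `l` from line `p` on. -/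
def CodeAt (P : Program) : ℕ → List Instr → Prop
  | _, [] => True
  | p, i :: l => P[p]? = some i ∧ CodeAt P (p + 1) l

theorem codeAt_append {P : Program} {p : ℕ} {l₁ l₂ : List Instr} :
    CodeAt P p (l₁ ++ l₂) ↔ CodeAt P p l₁ ∧ CodeAt P (p + l₁.length) l₂ := by
  induction l₁ generalizing p with
  | nil => simp [CodeAt]
  | cons i l ih =>
    simp only [List.cons_append, CodeAt, ih, and_assoc, List.length_cons]
    rw [show p + 1 + l.length = p + (l.length + 1) by omega]

theorem codeAt_self (l₀ l : List Instr) : CodeAt (l₀ ++ l) l₀.length l := by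
  induction l generalizing l₀ with
  | nil => trivial
  | cons i l ih =>
    refine ⟨by simp, ?_⟩
    have := ih (l₀ ++ [i])
    simpa using this

/-- `k` steps lead from `σ` to `τ` without exceeding the word length `w`. -/
def Steps (P : Program) (w k : ℕ) (σ τ : Config) : Prop :=
  (step P)^[k] σ = τ ∧ ∀ i ≤ k, ((step P)^[i] σ).FitsIn w

theorem Steps.refl {P : Program} {w : ℕ} {σ : Config} (h : σ.FitsIn w) : Steps P w 0 σ σ :=
  ⟨rfl, fun i hi => by
    obtain rfl : i = 0 := by omega
    exact h⟩

theorem Steps.trans {P : Program} {w k l : ℕ} {σ τ υ : Config} (h₁ : Steps P w k σ τ)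
    (h₂ : Steps P w l τ υ) : Steps P w (k + l) σ υ := by
  constructor
  · rw [add_comm, Function.iterate_add_apply, h₁.1, h₂.1]
  · intro i hi
    rcases le_total i k with h | h
    · exact h₁.2 i h
    · obtain ⟨j, rfl⟩ := Nat.exists_eq_add_of_le h
      rw [add_comm, Function.iterate_add_apply, h₁.1]
      exact h₂.2 j (by omega)

theorem Steps.single {P : Program} {w : ℕ} {σ : Config} {i : Instr} (hi : P[σ.pc]? = some i)
    (h₁ : σ.FitsIn w) (h₂ : (i.apply σ).FitsIn w) : Steps P w 1 σ (i.apply σ) := by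
  have hs : step P σ = i.apply σ := by simp [step, hi]
  refine ⟨by simpa using hs, fun j hj => ?_⟩
  interval_cases j
  · exact h₁
  · simpa [hs] using h₂

/-- The configuration `σ` represents the state `s`; except for two scratch registers, all words
are at most `X`. -/
structure Rel (B w X : ℕ) (s : St) (σ : Config) : Prop where
  zero : σ.reg 0 = 0
  one : σ.reg 1 = 1
  stride : σ.reg 2 = 20
  base : σ.reg 3 = B
  var : ∀ x : Var, σ.reg x.reg = s.v x
  inp : ∀ i < B, σ.mem i = s.inp i
  arr : ∀ (A : Arr) (i : ℕ), σ.mem (B + 20 * i + A.ctorIdx) = s.a A i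
  reg_le : ∀ r, r ≠ 4 → r ≠ 5 → σ.reg r ≤ X
  mem_le : ∀ i, σ.mem i ≤ X
  tmp_lt : ∀ r, r = 4 ∨ r = 5 → σ.reg r < 2 ^ w

variable {P : Program} {B L w X : ℕ} {s : St} {σ : Config}

theorem Rel.fits (h : Rel B w X s σ) (hX : X < 2 ^ w) : σ.FitsIn w := by
  refine ⟨fun r => ?_, fun i => (h.mem_le i).trans_lt hX⟩
  by_cases hr : r = 4 ∨ r = 5
  · exact h.tmp_lt r hr
  · push Not at hr
    exact (h.reg_le r hr.1 hr.2).trans_lt hX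

theorem Rel.v_le (h : Rel B w X s σ) (x : Var) : s.v x ≤ X := by
  rw [← h.var x]
  exact h.reg_le _ (by simp only [Var.reg]; omega) (by simp only [Var.reg]; omega)

theorem Rel.of_pc (h : Rel B w X s σ) (p : ℕ) : Rel B w X s ⟨p, σ.reg, σ.mem⟩ :=
  ⟨h.zero, h.one, h.stride, h.base, h.var, h.inp, h.arr, h.reg_le, h.mem_le, h.tmp_lt⟩

theorem Rel.mono (h : Rel B w X s σ) {X' : ℕ} (hX : X ≤ X') : Rel B w X' s σ :=
  ⟨h.zero, h.one, h.stride, h.base, h.var, h.inp, h.arr,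
    fun r h₁ h₂ => (h.reg_le r h₁ h₂).trans hX, fun i => (h.mem_le i).trans hX, h.tmp_lt⟩

/-! ### Register and memory updates that preserve the representation of a state. -/

theorem write_reg (σ : Config) (r k r' : ℕ) :
    (σ.write r k).reg r' = if r' = r then k else σ.reg r' :=
  Function.update_apply ..

theorem write_reg_self (σ : Config) (r k : ℕ) : (σ.write r k).reg r = k :=
  Function.update_self ..

theorem write_reg_of_ne {σ : Config} {r k r' : ℕ} (h : r' ≠ r) :
    (σ.write r k).reg r' = σ.reg r' :=
  Function.update_of_ne h ..

theorem Rel.write_tmp (h : Rel B w X s σ) {r k : ℕ} (hr : r = 4 ∨ r = 5) (hk : k < 2 ^ w) :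
    Rel B w X s (σ.write r k) where
  zero := by rw [write_reg_of_ne (by omega)]; exact h.zero
  one := by rw [write_reg_of_ne (by omega)]; exact h.one
  stride := by rw [write_reg_of_ne (by omega)]; exact h.stride
  base := by rw [write_reg_of_ne (by omega)]; exact h.base
  var x := by
    rw [write_reg_of_ne (by simp only [Var.reg]; omega)]; exact h.var x
  inp := h.inp
  arr := h.arr
  reg_le r' h₁ h₂ := by
    rw [write_reg_of_ne (by omega)]; exact h.reg_le r' h₁ h₂
  mem_le := h.mem_le
  tmp_lt r' hr' := by
    rw [write_reg]
    split_ifs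
    · exact hk
    · exact h.tmp_lt r' hr'

theorem Rel.write_var (h : Rel B w X s σ) (x : Var) {k : ℕ} (hk : k ≤ X) :
    Rel B w X (s.setV x k) (σ.write x.reg k) where
  zero := by rw [write_reg_of_ne (by simp only [Var.reg]; omega)]; exact h.zero
  one := by rw [write_reg_of_ne (by simp only [Var.reg]; omega)]; exact h.one
  stride := by
    rw [write_reg_of_ne (by simp only [Var.reg]; omega)]; exact h.stride
  base := by rw [write_reg_of_ne (by simp only [Var.reg]; omega)]; exact h.base
  var y := by
    rw [write_reg, St.setV_v, h.var y]
    simp only [Var.reg_injective.eq_iff]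
  inp := h.inp
  arr := h.arr
  reg_le r' h₁ h₂ := by
    rw [write_reg]
    split_ifs
    · exact hk
    · exact h.reg_le r' h₁ h₂
  mem_le := h.mem_le
  tmp_lt r' hr' := by
    rw [write_reg_of_ne (by simp only [Var.reg]; omega)]; exact h.tmp_lt r' hr'

theorem Rel.store_arr (h : Rel B w X s σ) (A : Arr) (i : ℕ) {k : ℕ} (hk : k ≤ X) (p : ℕ) :
    Rel B w X (s.setA A i k) ⟨p, σ.reg, Function.update σ.mem (B + 20 * i + A.ctorIdx) k⟩ where
  zero := h.zero
  one := h.one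
  stride := h.stride
  base := h.base
  var := h.var
  inp j hj := by
    simp only [St.setA_inp]
    rw [Function.update_of_ne (by omega)]; exact h.inp j hj
  arr A' j := by
    have h₁ := A.ctorIdx_lt
    have h₂ := A'.ctorIdx_lt
    simp only [St.setA_a]
    by_cases hA : A' = A
    · subst hA
      rw [if_pos rfl, Function.update_apply, Function.update_apply]
      by_cases hj : j = i
      · simp [hj]
      · rw [if_neg (by omega), if_neg hj]; exact h.arr _ _
    · rw [if_neg hA, Function.update_of_ne]
      · exact h.arr _ _
      · intro heq
        exact hA (Arr.ctorIdx_injective (by omega))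
  reg_le := h.reg_le
  mem_le j := by
    simp only [Function.update_apply]
    split_ifs
    · exact hk
    · exact h.mem_le j
  tmp_lt := h.tmp_lt

theorem Rel.store_inp (h : Rel B w X s σ) {i : ℕ} (hi : i < B) {k : ℕ} (hk : k ≤ X) (p : ℕ) :
    Rel B w X (s.setI i k) ⟨p, σ.reg, Function.update σ.mem i k⟩ where
  zero := h.zero
  one := h.one
  stride := h.stride
  base := h.base
  var := h.var
  inp j hj := by
    simp only [St.setI_inp, Function.update_apply]
    split_ifs
    · rfl
    · exact h.inp j hj
  arr A' j := by
    simp only [St.setI_a]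
    rw [Function.update_of_ne (by omega)]
    exact h.arr _ _
  reg_le := h.reg_le
  mem_le j := by
    simp only [Function.update_apply]
    split_ifs
    · exact hk
    · exact h.mem_le j
  tmp_lt := h.tmp_lt

/-- The twenty arrays are interleaved with stride 20 behind the input, so no array needs a length
fixed in advance, and cells behind the input are initially zero. An address is at most `21 * X +
20`, which is why the scratch registers need more room than the bound `X` on all other words. -/
theorem steps_addr (h : Rel B w X s σ) (A : Arr) (y : Var) (hX : 21 * X + 20 < 2 ^ w)
    (hc : CodeAt P σ.pc (addrCode A y)) :
    ∃ τ, Steps P w 4 σ τ ∧ τ.pc = σ.pc + 4 ∧ Rel B w X s τ ∧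
      τ.reg 4 = B + 20 * s.v y + A.ctorIdx := by
  obtain ⟨c₁, c₂, c₃, c₄, -⟩ := hc
  have hy := h.v_le y
  have hA := A.ctorIdx_lt
  have hB : B ≤ X := by
    rw [← h.base]
    exact h.reg_le 3 (by omega) (by omega)
  have hw : X < 2 ^ w := by omega
  have r₁ := h.write_tmp (r := 4) (k := σ.reg y.reg * σ.reg 2) (.inl rfl) (by
    rw [h.var, h.stride]; omega)
  have r₂ := r₁.write_tmp (r := 5) (k := A.ctorIdx) (.inr rfl) (by omega)
  have e₂ : ((σ.write 4 (σ.reg y.reg * σ.reg 2)).write 5 A.ctorIdx).reg 4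
      + ((σ.write 4 (σ.reg y.reg * σ.reg 2)).write 5 A.ctorIdx).reg 5
      = 20 * s.v y + A.ctorIdx := by
    simp [Config.write, h.var, h.stride, mul_comm]
  have r₃ := r₂.write_tmp (r := 4) (.inl rfl) (e₂.trans_lt (by omega))
  set σ₃ := ((σ.write 4 (σ.reg y.reg * σ.reg 2)).write 5 A.ctorIdx).write 4 _ with hσ₃
  have e₃ : σ₃.reg 4 + σ₃.reg 3 = B + 20 * s.v y + A.ctorIdx := by
    rw [r₃.base, hσ₃, write_reg_self, e₂]; omega
  have r₄ := r₃.write_tmp (r := 4) (k := σ₃.reg 4 + σ₃.reg 3) (.inl rfl) (by rw [e₃]; omega)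
  refine ⟨_, (Steps.single (i := .mul 4 y.reg 2) c₁ (h.fits hw) (r₁.fits hw)).trans
    ((Steps.single (i := .const 5 A.ctorIdx) c₂ (r₁.fits hw) (r₂.fits hw)).trans
    ((Steps.single (i := .add 4 4 5) c₃ (r₂.fits hw) (r₃.fits hw)).trans
    (Steps.single (i := .add 4 4 3) c₄ (r₃.fits hw) (r₄.fits hw)))), rfl, r₄, ?_⟩
  exact (write_reg_self σ₃ 4 _).trans e₃

/-- Only `inc` can push a word past `X`, and only by one: constants are at most 5, sums are capped
by `L`, and products occur only in address computations, which stay in the scratch registers. -/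
theorem steps_op (h : Rel B w X s σ) (o : Op) (ho : o.Ok B L s) (hL : L ≤ X) (h5 : 5 ≤ X)
    (hX : 21 * (X + 1) + 20 < 2 ^ w) (hc : CodeAt P σ.pc o.code) :
    ∃ τ, Steps P w o.cost σ τ ∧ τ.pc = σ.pc + o.cost ∧ Rel B w (X + 1) (o.eval s) τ := by
  have h' := h.mono (Nat.le_succ X)
  have hw : X + 1 < 2 ^ w := by omega
  cases o with
  | set x k =>
    have r := h'.write_var x (k := k) (by simp only [Op.Ok] at ho; omega)
    exact ⟨_, Steps.single hc.1 (h'.fits hw) (r.fits hw), rfl, r⟩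
  | mov x y =>
    have r := h'.write_var x (k := s.v y) (h'.v_le y)
    have e : Instr.apply σ (.add x.reg y.reg 0) = σ.write x.reg (s.v y) := by
      simp [Instr.apply, h.zero, h.var]
    exact ⟨_, Steps.single hc.1 (h'.fits hw) (e ▸ r.fits hw), rfl, e ▸ r⟩
  | plus x y z =>
    have r := h'.write_var x (k := s.v y + s.v z) (by simp only [Op.Ok] at ho; omega)
    have e : Instr.apply σ (.add x.reg y.reg z.reg) = σ.write x.reg (s.v y + s.v z) := by
      simp [Instr.apply, h.var]
    exact ⟨_, Steps.single hc.1 (h'.fits hw) (e ▸ r.fits hw), rfl, e ▸ r⟩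
  | inc x =>
    have r := h'.write_var x (k := s.v x + 1) (by have := h.v_le x; omega)
    have e : Instr.apply σ (.add x.reg x.reg 1) = σ.write x.reg (s.v x + 1) := by
      simp [Instr.apply, h.var, h.one]
    exact ⟨_, Steps.single hc.1 (h'.fits hw) (e ▸ r.fits hw), rfl, e ▸ r⟩
  | dec x =>
    have r := h'.write_var x (k := s.v x - 1) (by have := h.v_le x; omega)
    have e : Instr.apply σ (.sub x.reg x.reg 1) = σ.write x.reg (s.v x - 1) := by
      simp [Instr.apply, h.var, h.one]
    exact ⟨_, Steps.single hc.1 (h'.fits hw) (e ▸ r.fits hw), rfl, e ▸ r⟩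
  | rd x y =>
    have hk : s.inp (s.v y) ≤ X + 1 := by rw [← h.inp _ ho]; exact h'.mem_le _
    have r := h'.write_var x hk
    have e : Instr.apply σ (.load x.reg y.reg) = σ.write x.reg (s.inp (s.v y)) := by
      simp [Instr.apply, h.var, h.inp _ ho]
    exact ⟨_, Steps.single hc.1 (h'.fits hw) (e ▸ r.fits hw), rfl, e ▸ r⟩
  | wr x y =>
    have r := h'.store_inp ho (h'.v_le y) (σ.pc + 1)
    have e : Instr.apply σ (.store x.reg y.reg)
        = ⟨σ.pc + 1, σ.reg, Function.update σ.mem (s.v x) (s.v y)⟩ := by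
      simp [Instr.apply, h.var]
    exact ⟨_, Steps.single hc.1 (h'.fits hw) (e ▸ r.fits hw), rfl, e ▸ r⟩
  | ld x A y =>
    obtain ⟨hc₁, hc₂⟩ := codeAt_append.1 hc
    obtain ⟨τ, hs, hp, hr, ha⟩ := steps_addr h' A y (by omega) hc₁
    have hk : s.a A (s.v y) ≤ X + 1 := by rw [← h.arr]; exact h'.mem_le _
    have r := hr.write_var x hk
    have e : Instr.apply τ (.load x.reg 4) = τ.write x.reg (s.a A (s.v y)) := by
      simp only [Instr.apply, ha, hr.arr]
    refine ⟨_, hs.trans (Steps.single (i := .load x.reg 4) ?_ (hr.fits hw) (e ▸ r.fits hw)), ?_,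
      e ▸ r⟩
    · rw [hp]; exact hc₂.1
    · show τ.pc + 1 = _
      rw [hp]; rfl
  | st A x y =>
    obtain ⟨hc₁, hc₂⟩ := codeAt_append.1 hc
    obtain ⟨τ, hs, hp, hr, ha⟩ := steps_addr h' A x (by omega) hc₁
    have r := hr.store_arr A (s.v x) (hr.v_le y) (τ.pc + 1)
    have e : Instr.apply τ (.store 4 y.reg) =
        ⟨τ.pc + 1, τ.reg, Function.update τ.mem (B + 20 * s.v x + A.ctorIdx) (s.v y)⟩ := by
      simp only [Instr.apply, ha, hr.var]
    refine ⟨_, hs.trans (Steps.single (i := .store 4 y.reg) ?_ (hr.fits hw) (e ▸ r.fits hw)), ?_,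
      e ▸ r⟩
    · rw [hp]; exact hc₂.1
    · show τ.pc + 1 = _
      rw [hp]; rfl

/-- Truncated subtraction vanishes exactly when `≤` holds. Equality is tested by adding the two
opposite differences, at most one of which is nonzero. -/
theorem steps_cond (h : Rel B w X s σ) (b : Cond) (hX : 2 * X + 1 < 2 ^ w)
    (hc : CodeAt P σ.pc b.code) :
    ∃ τ, Steps P w b.cost σ τ ∧ τ.pc = σ.pc + b.cost ∧ Rel B w X s τ ∧
      (τ.reg 4 = 0 ↔ b.Holds s) := by
  have hw : X < 2 ^ w := by omega
  cases b with
  | le x y =>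
    have r := h.write_tmp (r := 4) (k := σ.reg x.reg - σ.reg y.reg) (.inl rfl) (by
      have := h.v_le x
      rw [h.var, h.var]; omega)
    refine ⟨_, Steps.single (i := .sub 4 x.reg y.reg) hc.1 (h.fits hw) (r.fits hw), rfl, r, ?_⟩
    simp [Instr.apply, Config.write, h.var, Cond.Holds, Nat.sub_eq_zero_iff_le]
  | lt x y =>
    have hx := h.v_le x
    have r₁ := h.write_tmp (r := 4) (k := σ.reg x.reg + σ.reg 1) (.inl rfl) (by
      rw [h.var, h.one]; omega)
    have e₁ : (σ.write 4 (σ.reg x.reg + σ.reg 1)).reg 4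
        - (σ.write 4 (σ.reg x.reg + σ.reg 1)).reg y.reg = s.v x + 1 - s.v y := by
      rw [r₁.var]; simp [Config.write, h.var, h.one]
    have r₂ := r₁.write_tmp (r := 4) (.inl rfl) (e₁.trans_lt (by omega))
    refine ⟨_, (Steps.single (i := .add 4 x.reg 1) hc.1 (h.fits hw) (r₁.fits hw)).trans
      (Steps.single (i := .sub 4 4 y.reg) hc.2.1 (r₁.fits hw) (r₂.fits hw)), rfl, r₂, ?_⟩
    show (Config.write _ 4 _).reg 4 = 0 ↔ _
    rw [write_reg_self]
    refine (Iff.of_eq (congrArg (· = 0) e₁)).trans ?_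
    simp only [Cond.Holds]
    omega
  | eq x y =>
    have hx := h.v_le x
    have hy := h.v_le y
    have r₁ := h.write_tmp (r := 4) (k := σ.reg x.reg - σ.reg y.reg) (.inl rfl) (by
      rw [h.var, h.var]; omega)
    have e₁ : (σ.write 4 (σ.reg x.reg - σ.reg y.reg)).reg y.reg
        - (σ.write 4 (σ.reg x.reg - σ.reg y.reg)).reg x.reg = s.v y - s.v x := by
      rw [r₁.var, r₁.var]
    have r₂ := r₁.write_tmp (r := 5) (.inr rfl) (e₁.trans_lt (by omega))
    set σ₂ := (σ.write 4 (σ.reg x.reg - σ.reg y.reg)).write 5 _ with hσ₂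
    have e₂ : σ₂.reg 4 + σ₂.reg 5 = (s.v x - s.v y) + (s.v y - s.v x) := by
      rw [hσ₂, ← e₁]
      simp [Config.write, h.var]
    have r₃ := r₂.write_tmp (r := 4) (.inl rfl) (e₂.trans_lt (by omega))
    refine ⟨_, (Steps.single (i := .sub 4 x.reg y.reg) hc.1 (h.fits hw) (r₁.fits hw)).trans
      ((Steps.single (i := .sub 5 y.reg x.reg) hc.2.1 (r₁.fits hw) (r₂.fits hw)).trans
      (Steps.single (i := .add 4 4 5) hc.2.2.1 (r₂.fits hw) (r₃.fits hw))), rfl, r₃, ?_⟩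
    show (Config.write _ 4 _).reg 4 = 0 ↔ _
    rw [write_reg_self]
    refine (Iff.of_eq (congrArg (· = 0) e₂)).trans ?_
    simp only [Cond.Holds]
    omega

theorem steps_jump (h : Rel B w X s σ) {l : ℕ} (hX : X < 2 ^ w) (hc : P[σ.pc]? = some (.jump l)) :
    Steps P w 1 σ ⟨l, σ.reg, σ.mem⟩ :=
  Steps.single hc (h.fits hX) ((h.of_pc l).fits hX)

theorem steps_branch (h : Rel B w X s σ) {l : ℕ} (hX : X < 2 ^ w)
    (hc : P[σ.pc]? = some (.jumpLE 4 0 l)) :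
    Steps P w 1 σ ⟨if σ.reg 4 = 0 then l else σ.pc + 1, σ.reg, σ.mem⟩ := by
  have e : Instr.apply σ (.jumpLE 4 0 l) =
      ⟨if σ.reg 4 = 0 then l else σ.pc + 1, σ.reg, σ.mem⟩ := by
    simp [Instr.apply, h.zero]
  exact e ▸ Steps.single hc (h.fits hX) (e ▸ (h.of_pc _).fits hX)

/-- The machine code of a structured program simulates it, and words grow by at most one unit per
step. -/
theorem Run.simulate {c : Cmd} {s s' : St} {t : ℕ} (hr : Run B L c s t s') :
    ∀ {X : ℕ} {σ : Config}, CodeAt P σ.pc (c.compile σ.pc) → Rel B w X s σ → L ≤ X → 5 ≤ X →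
      21 * (X + t + 1) + 20 < 2 ^ w →
      ∃ τ, Steps P w t σ τ ∧ τ.pc = σ.pc + c.size ∧ Rel B w (X + t) s' τ := by
  induction hr with
  | @op o s ho =>
    intro X σ hc h hL h5 hX
    -- Every operation costs at least one step, so the running time pays for the growth of the
    -- words.
    have h1 : 1 ≤ o.cost := by cases o <;> simp [Op.cost, Op.code]
    obtain ⟨τ, h₁, h₂, h₃⟩ := steps_op h o ho hL h5 (by omega) hc
    exact ⟨τ, h₁, h₂, h₃.mono (by omega)⟩
  | skip =>
    intro X σ hc h hL h5 hX
    exact ⟨σ, Steps.refl (h.fits (by omega)), rfl, h⟩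
  | seq _ _ ih₁ ih₂ =>
    intro X σ hc h hL h5 hX
    obtain ⟨hc₁, hc₂⟩ := codeAt_append.1 hc
    rw [Cmd.length_compile] at hc₂
    obtain ⟨τ, a₁, a₂, a₃⟩ := ih₁ hc₁ h hL h5 (by omega)
    rw [← a₂] at hc₂
    obtain ⟨υ, b₁, b₂, b₃⟩ := ih₂ hc₂ a₃ (by omega) (by omega) (by omega)
    exact ⟨υ, a₁.trans b₁, by rw [b₂, a₂, Cmd.size]; omega, b₃.mono (by omega)⟩
  | @ite_true b c d s s₁ t hb _ ih =>
    intro X σ hc h hL h5 hX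
    obtain ⟨hc₁, hc₂, hc₃⟩ := codeAt_append.1 hc
    obtain ⟨-, -, hc₄⟩ := codeAt_append.1 hc₃
    rw [Cmd.length_compile] at hc₄
    obtain ⟨τ, a₁, a₂, a₃, a₄⟩ := steps_cond h b (by omega) hc₁
    have hj := steps_branch a₃ (by omega) (by rw [a₂]; exact hc₂)
    rw [if_pos (a₄.2 hb)] at hj
    obtain ⟨υ, b₁, b₂, b₃⟩ := ih (X := X) (σ := ⟨_, τ.reg, τ.mem⟩) hc₄ (a₃.of_pc _) hL h5 (by omega)
    refine ⟨υ, (a₁.trans hj).trans b₁, ?_, b₃.mono (by omega)⟩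
    rw [b₂]; simp only [Cmd.size, Cond.cost]; omega
  | @ite_false b c d s s₁ t hb _ ih =>
    intro X σ hc h hL h5 hX
    obtain ⟨hc₁, hc₂, hc₃⟩ := codeAt_append.1 hc
    obtain ⟨hc₄, hc₅, -⟩ := codeAt_append.1 hc₃
    rw [Cmd.length_compile] at hc₅
    obtain ⟨τ, a₁, a₂, a₃, a₄⟩ := steps_cond h b (by omega) hc₁
    have hj := steps_branch a₃ (by omega) (by rw [a₂]; exact hc₂)
    rw [if_neg (fun h => hb (a₄.1 h)), a₂] at hj
    obtain ⟨υ, b₁, b₂, b₃⟩ := ih (X := X) (σ := ⟨_, τ.reg, τ.mem⟩) hc₄ (a₃.of_pc _) hL h5 (by omega)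
    have hk := steps_jump b₃ (by omega) (by rw [b₂]; exact hc₅)
    refine ⟨_, ((a₁.trans hj).trans b₁).trans hk, ?_, (b₃.of_pc _).mono (by omega)⟩
    simp only [Cmd.size]; omega
  | @loop_true b c s s₁ s₂ t₁ t₂ hb _ _ ih₁ ih₂ =>
    intro X σ hc h hL h5 hX
    have hc' := hc
    obtain ⟨hc₁, hc₂, hc₃, hc₄⟩ := codeAt_append.1 hc
    obtain ⟨hc₅, hc₆, -⟩ := codeAt_append.1 hc₄
    rw [Cmd.length_compile] at hc₆
    obtain ⟨τ, a₁, a₂, a₃, a₄⟩ := steps_cond h b (by omega) hc₁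
    have hj := steps_branch a₃ (by omega) (by rw [a₂]; exact hc₂)
    rw [if_pos (a₄.2 hb)] at hj
    obtain ⟨υ, b₁, b₂, b₃⟩ := ih₁ (X := X) (σ := ⟨_, τ.reg, τ.mem⟩) hc₅ (a₃.of_pc _) hL h5
      (by omega)
    have hk := steps_jump b₃ (by omega) (by rw [b₂]; exact hc₆)
    obtain ⟨φ, d₁, d₂, d₃⟩ := ih₂ (X := X + t₁) (σ := ⟨σ.pc, υ.reg, υ.mem⟩) hc' (b₃.of_pc _)
      (by omega) (by omega) (by omega)
    exact ⟨φ, (((a₁.trans hj).trans b₁).trans hk).trans d₁, d₂, d₃.mono (by omega)⟩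
  | @loop_false b c s hb =>
    intro X σ hc h hL h5 hX
    obtain ⟨hc₁, hc₂, hc₃, hc₄⟩ := codeAt_append.1 hc
    obtain ⟨τ, a₁, a₂, a₃, a₄⟩ := steps_cond h b (by omega) hc₁
    have hj := steps_branch a₃ (by omega) (by rw [a₂]; exact hc₂)
    rw [if_neg (fun h => hb (a₄.1 h)), a₂] at hj
    have hk := steps_jump (a₃.of_pc (σ.pc + b.cost + 1)) (by omega) hc₃
    refine ⟨_, (a₁.trans hj).trans hk, ?_, (a₃.of_pc _).mono (by omega)⟩
    simp only [Cmd.size]; omega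

end CoverRAM

/-! ### Reasoning about structured programs -/

namespace CoverRAM

open PathCover

infixr:60 " ;; " => Cmd.seq

namespace Cmd

abbrev set (x : Var) (k : ℕ) : Cmd := .op (.set x k)
abbrev mov (x y : Var) : Cmd := .op (.mov x y)
abbrev plus (x y z : Var) : Cmd := .op (.plus x y z)
abbrev inc (x : Var) : Cmd := .op (.inc x)
abbrev dec (x : Var) : Cmd := .op (.dec x)
abbrev ld (x : Var) (A : Arr) (y : Var) : Cmd := .op (.ld x A y)
abbrev st (A : Arr) (x y : Var) : Cmd := .op (.st A x y)
abbrev rd (x y : Var) : Cmd := .op (.rd x y)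
abbrev wr (x y : Var) : Cmd := .op (.wr x y)

end Cmd

/-! ### Syntactic frames: what a program leaves unchanged. -/

def Op.writesVar : Op → Var → Bool
  | .set x _, y | .mov x _, y | .plus x _ _, y | .inc x, y | .dec x, y | .ld x _ _, y
  | .rd x _, y => x = y
  | _, _ => false

def Op.writesArr : Op → Arr → Bool
  | .st A _ _, A' => A = A'
  | _, _ => false

def Op.writesInp : Op → Bool
  | .wr _ _ => true
  | _ => false

def Cmd.writesVar : Cmd → Var → Bool
  | .op o, y => o.writesVar y
  | .skip, _ => false
  | .seq c d, y | .ite _ c d, y => c.writesVar y || d.writesVar y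
  | .loop _ c, y => c.writesVar y

def Cmd.writesArr : Cmd → Arr → Bool
  | .op o, y => o.writesArr y
  | .skip, _ => false
  | .seq c d, y | .ite _ c d, y => c.writesArr y || d.writesArr y
  | .loop _ c, y => c.writesArr y

def Cmd.writesInp : Cmd → Bool
  | .op o => o.writesInp
  | .skip => false
  | .seq c d | .ite _ c d => c.writesInp || d.writesInp
  | .loop _ c => c.writesInp

/-- The states `s` and `s'` agree on everything that `c` does not write to. -/
structure Frame (c : Cmd) (s s' : St) : Prop where
  v : ∀ x, c.writesVar x = false → s'.v x = s.v x
  a : ∀ A, c.writesArr A = false → s'.a A = s.a A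
  inp : c.writesInp = false → s'.inp = s.inp

theorem Frame.refl (c : Cmd) (s : St) : Frame c s s := ⟨fun _ _ => rfl, fun _ _ => rfl, fun _ => rfl⟩

theorem Frame.trans {c : Cmd} {s s' s'' : St} (h : Frame c s s') (h' : Frame c s' s'') :
    Frame c s s'' :=
  ⟨fun x hx => (h'.v x hx).trans (h.v x hx), fun A hA => (h'.a A hA).trans (h.a A hA),
    fun hi => (h'.inp hi).trans (h.inp hi)⟩

theorem Frame.mono {c d : Cmd} {s s' : St} (h : Frame c s s')
    (hv : ∀ x, d.writesVar x = false → c.writesVar x = false)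
    (ha : ∀ x, d.writesArr x = false → c.writesArr x = false)
    (hi : d.writesInp = false → c.writesInp = false) : Frame d s s' :=
  ⟨fun x hx => h.v x (hv x hx), fun x hx => h.a x (ha x hx), fun hx => h.inp (hi hx)⟩

variable {B L : ℕ}

/-- Invariance of untouched variables and arrays becomes a decidable question about the program
text, so loop invariants mention only what the loop changes. -/
theorem Run.frame {c : Cmd} {s s' : St} {t : ℕ} (h : Run B L c s t s') : Frame c s s' := by
  induction h with
  | @op o s ho =>
    refine ⟨fun x hx => ?_, fun A hA => ?_, fun hi => ?_⟩
    · cases o <;> simp_all [Cmd.writesVar, Op.writesVar, Op.eval, eq_comm]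
    · cases o <;> simp_all [Cmd.writesArr, Op.writesArr, Op.eval, eq_comm]
    · cases o <;> simp_all [Cmd.writesInp, Op.writesInp, Op.eval, eq_comm]
  | skip => exact Frame.refl _ _
  | seq _ _ h₁ h₂ =>
    refine (h₁.mono ?_ ?_ ?_).trans (h₂.mono ?_ ?_ ?_) <;>
      simp_all [Cmd.writesVar, Cmd.writesArr, Cmd.writesInp]
  | ite_true _ _ h =>
    refine h.mono ?_ ?_ ?_ <;> simp_all [Cmd.writesVar, Cmd.writesArr, Cmd.writesInp]
  | ite_false _ _ h =>
    refine h.mono ?_ ?_ ?_ <;> simp_all [Cmd.writesVar, Cmd.writesArr, Cmd.writesInp]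
  | loop_true _ _ _ h₁ h₂ =>
    refine (h₁.mono ?_ ?_ ?_).trans h₂ <;> simp_all [Cmd.writesVar, Cmd.writesArr, Cmd.writesInp]
  | loop_false _ => exact Frame.refl _ _

/-- Started in `s`, the program `c` stops after at most `t` machine steps in a state satisfying
`Q`. -/
def Ev (B L : ℕ) (c : Cmd) (s : St) (t : ℕ) (Q : St → Prop) : Prop :=
  ∃ t' ≤ t, ∃ s', Run B L c s t' s' ∧ Q s'

theorem Ev.mono {c : Cmd} {s : St} {t t' : ℕ} {Q Q' : St → Prop} (h : Ev B L c s t Q) (ht : t ≤ t')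
    (hQ : ∀ s', Frame c s s' → Q s' → Q' s') : Ev B L c s t' Q' := by
  obtain ⟨k, hk, s', hr, hs⟩ := h
  exact ⟨k, hk.trans ht, s', hr, hQ _ hr.frame hs⟩

theorem Ev.seq {c d : Cmd} {s : St} {t₁ t₂ : ℕ} {Q R : St → Prop} (h₁ : Ev B L c s t₁ Q)
    (h₂ : ∀ s', Frame c s s' → Q s' → Ev B L d s' t₂ R) : Ev B L (c ;; d) s (t₁ + t₂) R := by
  obtain ⟨k, hk, s', hr, hs⟩ := h₁
  obtain ⟨l, hl, s'', hr', hs'⟩ := h₂ s' hr.frame hs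
  exact ⟨k + l, by omega, s'', .seq hr hr', hs'⟩

/-- Weakest preconditions of loop-free programs. -/
def Cmd.wp (B L : ℕ) : Cmd → St → (St → Prop) → Prop
  | .op o, s, Q => o.Ok B L s ∧ Q (o.eval s)
  | .skip, s, Q => Q s
  | .seq c d, s, Q => c.wp B L s fun s' => d.wp B L s' Q
  | .ite b c d, s, Q => (b.Holds s → c.wp B L s Q) ∧ (¬ b.Holds s → d.wp B L s Q)
  | .loop _ _, _, _ => False

/-- A bound for the running time of a loop-free program. -/
def Cmd.bound : Cmd → ℕ
  | .op o => o.cost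
  | .skip => 0
  | .seq c d => c.bound + d.bound
  | .ite b c d => b.cost + 2 + max c.bound d.bound
  | .loop _ _ => 0

theorem Ev.of_wp_bound {c : Cmd} {s : St} {Q : St → Prop} (h : c.wp B L s Q) :
    Ev B L c s c.bound Q := by
  induction c generalizing s Q with
  | op o => exact ⟨_, le_rfl, _, .op h.1, h.2⟩
  | skip => exact ⟨_, le_rfl, _, .skip, h⟩
  | seq c d hc hd => exact (hc h).seq fun s' _ hs' => hd hs'
  | ite b c d hc hd =>
    by_cases hb : b.Holds s
    · obtain ⟨k, hk, s', hr, hs⟩ := hc (h.1 hb)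
      exact ⟨_, by simp only [Cmd.bound]; omega, s', .ite_true hb hr, hs⟩
    · obtain ⟨k, hk, s', hr, hs⟩ := hd (h.2 hb)
      exact ⟨_, by simp only [Cmd.bound]; omega, s', .ite_false hb hr, hs⟩
  | loop => exact h.elim

theorem Ev.of_wp {c : Cmd} {s : St} {Q : St → Prop} {k : ℕ} (h : c.wp B L s Q) (hk : c.bound ≤ k) :
    Ev B L c s k Q :=
  (Ev.of_wp_bound h).mono hk fun _ _ => id

theorem Cond.cost_le (b : Cond) : b.cost ≤ 3 := by cases b <;> simp [Cond.cost, Cond.code]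

/-- The variant `μ` bounds the number of rounds. The summand 5 in each round covers the test, which
costs at most 3, and the two jumps around the body. The body may also use the frame between the
start of the loop and the current state. -/
theorem Ev.loop {b : Cond} {c : Cmd} {s : St} (I : St → Prop) (μ : St → ℕ) (k : ℕ) (h₀ : I s)
    (hb : ∀ s', Frame c s s' → I s' → b.Holds s' →
      Ev B L c s' k fun s'' => I s'' ∧ μ s'' < μ s') :
    Ev B L (.loop b c) s ((k + 5) * μ s + 5) fun s' => I s' ∧ ¬ b.Holds s' := by
  have key : ∀ (r : ℕ) (s' : St), Frame c s s' → I s' → μ s' ≤ r →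
      Ev B L (.loop b c) s' ((k + 5) * r + 5) fun s' => I s' ∧ ¬ b.Holds s' := by
    intro r
    induction r with
    | zero =>
      intro s' hf hI hr
      by_cases hs : b.Holds s'
      · obtain ⟨k, hk, s'', hr, hs⟩ := hb s' hf hI hs
        omega
      · exact ⟨_, by have := b.cost_le; omega, s', .loop_false hs, hI, hs⟩
    | succ r ih =>
      intro s' hf hI hr
      by_cases hs : b.Holds s'
      · obtain ⟨l, hl, s'', hr₁, hI', hμ⟩ := hb s' hf hI hs
        obtain ⟨l', hl', s''', hr₂, hQ⟩ := ih s'' (hf.trans hr₁.frame) hI' (by omega)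
        refine ⟨_, ?_, s''', .loop_true hs hr₁ hr₂, hQ⟩
        have := b.cost_le
        have e : (k + 5) * (r + 1) = (k + 5) * r + (k + 5) := by ring
        omega
      · exact ⟨_, by have := b.cost_le; omega, s', .loop_false hs, hI, hs⟩
  exact key _ s (Frame.refl _ _) h₀ le_rfl

/-! ### The program -/

namespace Cmd

/-- Every vertex gets its own number as label. -/
def initLabels : Cmd :=
  set .j 0 ;; loop (.lt .j .n) (st .comp .j .j ;; inc .j)

/-- Count the degrees of `.a` and `.b`, and load their labels. -/
def countEdge : Cmd :=
  rd .a .p ;; inc .p ;; rd .b .p ;; inc .p ;;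
  ld .u .deg .a ;; inc .u ;; st .deg .a .u ;;
  ld .u .deg .b ;; inc .u ;; st .deg .b .u ;;
  ld .ca .comp .a ;; ld .cb .comp .b ;; set .j 0

/-- Replace the label `.ca` by `.cb`. -/
def relabelStep : Cmd :=
  ld .u .comp .j ;; ite (.eq .u .ca) (st .comp .j .cb) skip ;; inc .j

/-- Compute the components and the degrees of the subgraph. -/
def components : Cmd :=
  initLabels ;; mov .p .pH ;;
  loop (.lt .p .lim) (countEdge ;; loop (.lt .j .n) relabelStep)

/-- Increase `A[.c]`. -/
def bump (A : Arr) : Cmd := ld .u A .c ;; inc .u ;; st A .c .u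

def statStep : Cmd :=
  rd .u .q ;; inc .q ;; st .inU .j .u ;;
  ite (.eq .u .zero) skip
    (ld .c .comp .j ;; bump .sz ;; ld .e .deg .j ;;
      set .w 1 ;; ite (.eq .e .w) (bump .c1) skip ;;
      set .w 2 ;; ite (.eq .e .w) (bump .c2) skip) ;;
  inc .j

/-- Count the vertices of each component, and those of degree `1` and `2`. -/
def statistics : Cmd :=
  set .j 0 ;; mov .q .pU ;; loop (.lt .j .n) statStep

/-- A connected graph is a 5-path exactly if it has five vertices, two of degree 1 and three of
degree 2. Unused labels are also marked bad, which is harmless because they receive no entries. -/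
def badStep : Cmd :=
  st .bad .j .one ;;
  ld .u .sz .j ;; set .w 5 ;; ite (.eq .u .w)
    (ld .u .c1 .j ;; set .w 2 ;; ite (.eq .u .w)
      (ld .u .c2 .j ;; set .w 3 ;; ite (.eq .u .w) (st .bad .j .zero) skip) skip) skip ;;
  inc .j

/-- Find the bad components. -/
def badness : Cmd :=
  set .j 0 ;; loop (.lt .j .n) badStep

/-- Add an entry with source `x`, target `y` and slot `.w` to the list of the component `k`. -/
def push (k x y : Var) : Cmd :=
  st .src .E x ;; st .dst .E y ;; st .slot .E .w ;; ld .u .head k ;; st .next .E .u ;; inc .E ;;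
  st .head k .E ;; st .cur k .E

/-- Add entries for both slots of `y` to the list of the component `k` of `x`, if it is bad. -/
def pushBoth (k x y : Var) : Cmd :=
  ld .u .bad k ;; ite (.eq .u .zero) skip
    (plus .w y y ;; push k x y ;; inc .w ;; push k x y)

def entryStep : Cmd :=
  rd .a .p ;; inc .p ;; rd .b .p ;; inc .p ;;
  ld .u .inU .a ;; ite (.eq .u .zero) skip
    (ld .u .inU .b ;; ite (.eq .u .zero) skip
      (ld .ca .comp .a ;; ld .cb .comp .b ;; ite (.eq .ca .cb) skip
        (pushBoth .ca .a .b ;; pushBoth .cb .b .a)))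

/-- List for each bad component the slots that it may occupy. -/
def entries : Cmd :=
  set .E 0 ;; set .p 3 ;; loop (.lt .p .pU) entryStep

/-- Continue with the next component. -/
def nextBidder : Cmd := inc .b ;; mov .K .b

/-- Zero means "none" in zero-initialised memory: `.cur`, `.head`, `.next` and `.mate` hold an entry
number plus one, and `.own` holds a bidder plus one. -/
def auctionStep : Cmd :=
  ld .c .cur .K ;; ld .l .lab .K ;; ite (.eq .c .zero)
    (inc .l ;; st .lab .K .l ;; ld .u .head .K ;; st .cur .K .u ;;
      ite (.le .N .l) nextBidder skip)
    (mov .e .c ;; dec .e ;; ld .w .slot .e ;; ld .u .price .w ;; ite (.le .u .l)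
      (inc .l ;; st .price .w .l ;; ld .o .own .w ;; mov .u .K ;; inc .u ;; st .own .w .u ;;
        st .mate .K .c ;; ite (.eq .o .zero) nextBidder
          (mov .K .o ;; dec .K ;; st .mate .K .zero))
      (ld .u .next .e ;; st .cur .K .u))

/-- The limit `min n E + 1` is larger than the number of bidders that can be assigned, which the
final optimality argument needs. The minimum also keeps the running time within `O(nm)`. -/
def initAuction : Cmd :=
  mov .N .n ;; ite (.le .E .n) (mov .N .E) skip ;; inc .N ;; set .b 0 ;; set .K 0

/-- Assign slots to the bad components by an auction. -/
def auction : Cmd := initAuction ;; loop (.lt .b .n) auctionStep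

def keepStep : Cmd :=
  ld .c .mate .j ;; ite (.eq .c .zero) skip
    (st .keep .j .one ;; dec .c ;; ld .w .dst .c ;; ld .c .comp .w ;; st .par .j .c ;; bump .cnt) ;;
  inc .j

/-- Keep the edges of all assigned components. -/
def initKeep : Cmd :=
  set .j 0 ;; loop (.lt .j .n) keepStep

/-- Drop the edge of the component `.j` and restore the edge of its parent, if necessary. -/
def drop : Cmd :=
  st .keep .j .zero ;; ld .c .par .j ;; ld .u .cnt .c ;; dec .u ;; st .cnt .c .u ;;
  ite (.eq .u .zero)
    (ld .u .keep .c ;; ite (.eq .u .zero)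
      (ld .u .mate .c ;; ite (.eq .u .zero) skip
        (st .keep .c .one ;; ld .c .par .c ;; bump .cnt)) skip) skip ;;
  set .j 0

/-- Two kept children make the own edge superfluous because of the degree bound. One kept child
together with a kept parent does so as well; this excludes that two components choose the same edge
from its opposite ends. A drop can create new superfluous elements anywhere, hence the scan
restarts. -/
def pruneStep : Cmd :=
  ld .u .keep .j ;; ite (.eq .u .zero) (inc .j)
    (ld .u .cnt .j ;; set .w 2 ;; ite (.le .w .u) drop
      (ite (.eq .u .zero) (inc .j)
        (ld .c .par .j ;; ld .u .keep .c ;; ite (.eq .u .zero) (inc .j) drop)))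

/-- Drop superfluous edges. -/
def prune : Cmd :=
  set .j 0 ;; loop (.lt .j .n) pruneStep

def outputStep : Cmd :=
  ld .u .keep .j ;; ite (.eq .u .zero) skip
    (ld .c .mate .j ;; dec .c ;; ld .u .src .c ;; wr .p .u ;; inc .p ;; ld .u .dst .c ;;
      wr .p .u ;; inc .p ;; inc .l) ;;
  inc .j

/-- Write the edges that are kept. -/
def output : Cmd :=
  (set .j 0 ;; set .p 1 ;; set .l 0) ;; loop (.lt .j .n) outputStep ;; wr .zero .l

/-- For `m = 0` the allowed time is constant, so not even the linear initialisation may run.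
Otherwise both `n` and `m` are at most `n * m`. -/
def main : Cmd :=
  ite (.eq .m .zero) (wr .zero .zero)
    (components ;; statistics ;; badness ;; entries ;; auction ;; initKeep ;; prune ;; output)

end Cmd

end CoverRAM

/-! ### Components and degrees of the subgraph -/

namespace CoverRAM

open PathCover

variable {B L n : ℕ} {eG eH : List (Fin n × Fin n)} {U : Set (Fin n)}

open Classical in
/-- The fixed variables have their values and the input area holds the input. -/
structure Params (eG : List (Fin n × Fin n)) (U : Set (Fin n)) (eH : List (Fin n × Fin n)) (s : St) :
    Prop where
  zero : s.v .zero = 0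
  one : s.v .one = 1
  hn : s.v .n = n
  hm : s.v .m = eG.length
  pU : s.v .pU = 3 + 2 * eG.length
  pH : s.v .pH = 3 + 2 * eG.length + n
  lim : s.v .lim = 3 + 2 * eG.length + n + 2 * eH.length
  fstG : ∀ i (h : i < eG.length), s.inp (3 + 2 * i) = eG[i].1
  sndG : ∀ i (h : i < eG.length), s.inp (3 + 2 * i + 1) = eG[i].2
  mem : ∀ v : Fin n, s.inp (3 + 2 * eG.length + v) = if v ∈ U then 1 else 0
  fstH : ∀ i (h : i < eH.length), s.inp (3 + 2 * eG.length + n + 2 * i) = eH[i].1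
  sndH : ∀ i (h : i < eH.length), s.inp (3 + 2 * eG.length + n + 2 * i + 1) = eH[i].2

theorem Params.frame {s s' : St} {c : Cmd} (h : Params eG U eH s) (hf : Frame c s s')
    (hc : (c.writesInp || [Var.zero, .one, .n, .m, .pU, .pH, .lim].any c.writesVar) = false) :
    Params eG U eH s' := by
  simp only [List.any_cons, List.any_nil, Bool.or_false, Bool.or_eq_false_iff] at hc
  obtain ⟨h₁, h₂, h₃, h₄, h₅, h₆, h₇, h₈⟩ := hc
  constructor
  · rw [hf.v _ h₂, h.zero]
  · rw [hf.v _ h₃, h.one]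
  · rw [hf.v _ h₄, h.hn]
  · rw [hf.v _ h₅, h.hm]
  · rw [hf.v _ h₆, h.pU]
  · rw [hf.v _ h₇, h.pH]
  · rw [hf.v _ h₈, h.lim]
  · rw [hf.inp h₁]; exact h.fstG
  · rw [hf.inp h₁]; exact h.sndG
  · rw [hf.inp h₁]; exact h.mem
  · rw [hf.inp h₁]; exact h.fstH
  · rw [hf.inp h₁]; exact h.sndH

theorem ev_initLabels {s : St} (hn : s.v .n = n) :
    Ev B L .initLabels s (20 * n + 10) fun s' => ∀ i < n, s'.a .comp i = i := by
  refine (Ev.seq (t₁ := 1) (t₂ := (10 + 5) * n + 5) (Q := fun s' => s'.v .j = 0)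
    (Ev.of_wp (by simp [Cmd.wp, Op.Ok, Op.eval]) (by decide)) fun s₁ hf hj => ?_).mono (by omega)
    fun _ _ h => h
  have hn₁ : s₁.v .n = n := by rw [hf.v .n (by decide), hn]
  refine (Ev.loop (fun s' => s'.v .j ≤ n ∧ ∀ i < s'.v .j, s'.a .comp i = i)
    (fun s' => n - s'.v .j) 10 (by simp [hj]) ?_).mono (by simp [hj]) ?_
  · intro s' hf' hI hb
    have hn' : s'.v .n = n := by rw [hf'.v .n (by decide), hn₁]
    simp only [Cond.Holds, hn'] at hb
    refine Ev.of_wp ?_ (by decide)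
    simp only [Cmd.wp, Op.Ok, Op.eval, true_and, St.setV_v, St.setA_v, St.setA_a, St.setV_a,
      if_true]
    refine ⟨⟨hb, fun i hi => ?_⟩, by omega⟩
    rw [Function.update_apply]
    split_ifs with h
    · exact h.symm
    · exact hI.2 i (by omega)
  · rintro s' hf' ⟨⟨h₁, h₂⟩, h₃⟩ i hi
    have hn' : s'.v .n = n := by rw [hf'.v .n (by decide), hn₁]
    simp only [Cond.Holds, hn'] at h₃
    exact h₂ i (by omega)

theorem ev_relabel {s : St} (hn : s.v .n = n) (hj : s.v .j = 0) :
    Ev B L (.loop (.lt .j .n) .relabelStep) s (30 * n + 5) fun s' =>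
      ∀ i < n, s'.a .comp i = if s.a .comp i = s.v .ca then s.v .cb else s.a .comp i := by
  refine (Ev.loop (fun s' => s'.v .j ≤ n ∧ ∀ i, s'.a .comp i =
      if i < s'.v .j ∧ s.a .comp i = s.v .ca then s.v .cb else s.a .comp i)
    (fun s' => n - s'.v .j) 25 (by simp [hj]) ?_).mono (by simp [hj]) ?_
  · intro s' hf' hI hb
    have hn' : s'.v .n = n := by rw [hf'.v .n (by decide), hn]
    have ha : s'.v .ca = s.v .ca := hf'.v _ (by decide)
    have hb' : s'.v .cb = s.v .cb := hf'.v _ (by decide)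
    simp only [Cond.Holds, hn'] at hb
    have e := hI.2 (s'.v .j)
    simp only [lt_irrefl, false_and, if_false] at e
    refine Ev.of_wp ?_ (by decide)
    simp only [Cmd.relabelStep, Cmd.wp, Op.Ok, Op.eval, Cond.Holds, true_and, St.setV_v, St.setA_v,
      St.setA_a, St.setV_a, if_true, reduceCtorEq, if_false, ha, hb', e]
    constructor
    · intro h
      refine ⟨⟨hb, fun i => ?_⟩, by omega⟩
      rw [Function.update_apply]
      split_ifs with h₁ h₂ h₂
      · rfl
      · exact absurd ⟨by omega, h₁ ▸ h⟩ h₂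
      · rw [hI.2, if_pos ⟨by omega, h₂.2⟩]
      · rw [hI.2, if_neg (fun h₃ => h₂ ⟨by omega, h₃.2⟩)]
    · intro h
      refine ⟨⟨hb, fun i => ?_⟩, by omega⟩
      rw [hI.2]
      refine if_congr ⟨fun h₁ => ⟨by omega, h₁.2⟩, fun h₁ => ⟨?_, h₁.2⟩⟩ rfl rfl
      rcases (Nat.lt_succ_iff_lt_or_eq.1 h₁.1) with h₂ | h₂
      · exact h₂
      · exact absurd (h₂ ▸ h₁.2) h
  · rintro s' hf' ⟨⟨h₁, h₂⟩, h₃⟩ i hi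
    have hn' : s'.v .n = n := by rw [hf'.v .n (by decide), hn]
    simp only [Cond.Holds, hn'] at h₃
    rw [h₂]
    exact if_congr ⟨And.right, fun h => ⟨by omega, h⟩⟩ rfl rfl

/-- The labels and degrees after the edges in `l` have been processed. -/
structure Labelled (l : List (Fin n × Fin n)) (s : St) : Prop where
  lt : ∀ v : Fin n, s.a .comp v < n
  sound : ∀ u v : Fin n, s.a .comp u = s.a .comp v → Relation.EqvGen (fun a b => (a, b) ∈ l) u v
  complete : ∀ e ∈ l, s.a .comp e.1 = s.a .comp e.2
  deg : ∀ v : Fin n, s.a .deg v = l.countP (·.1 = v) + l.countP (·.2 = v)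

/-- One full relabelling scan per edge of the subgraph is affordable, since the subgraph has at most
`m` edges. Equal labels always come from chains of processed edges, and relabelling an entire class
keeps the endpoints of earlier edges equal. -/
theorem ev_components {s : St} (hp : Params eG U eH s) (hdeg : ∀ i, s.a .deg i = 0)
    (hB : B = 3 + 2 * eG.length + n + 2 * eH.length) :
    Ev B L .components s (20 * n + 50 + (30 * n + 100) * eH.length) (Labelled eH) := by
  refine (Ev.seq (ev_initLabels (n := n) hp.hn) fun s₁ hf hc => Ev.seq (t₁ := 1)
    (Q := fun s' => s'.v .p = s'.v .pH ∧ s'.a = s₁.a) (t₂ := (30 * n + 100) * eH.length + 5)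
    (Ev.of_wp (by simp [Cmd.wp, Op.Ok, Op.eval]) (by decide)) fun s₂ hf₂ hs₂ => ?_).mono (by
      omega) fun _ _ h => h
  have hp₂ : Params eG U eH s₂ := (hp.frame hf (by decide)).frame hf₂ (by decide)
  refine (Ev.loop (fun s' => ∃ i ≤ eH.length, s'.v .p = s'.v .pH + 2 * i ∧
    Labelled (eH.take i) s') (fun s' => eH.length - (s'.v .p - s'.v .pH) / 2) (30 * n + 95)
      ⟨0, by omega, by omega, ?_⟩ ?_).mono (by simp [hs₂.1]) ?_
  · have e : ∀ i < n, s₂.a .comp i = i := by rw [hs₂.2]; exact hc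
    constructor
    · intro v
      rw [e v v.2]
      exact v.2
    · intro u v h
      rw [e v v.2, e u u.2] at h
      rw [Fin.ext h]
      exact .refl _
    · simp
    · intro v
      rw [hs₂.2, hf.a .deg (by decide), hdeg]
      simp
  · rintro s' hf' ⟨i, hi, hpi, hl⟩ hb
    have hp' := hp₂.frame hf' (by decide)
    simp only [Cond.Holds, hpi, hp'.pH, hp'.lim] at hb
    have hi' : i < eH.length := by omega
    have e₁ : s'.inp (s'.v .p) = eH[i].1 := by rw [hpi, hp'.pH]; exact hp'.fstH i hi'
    have e₂ : s'.inp (s'.v .p + 1) = eH[i].2 := by rw [hpi, hp'.pH]; exact hp'.sndH i hi'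
    have hlt : s'.v .p + 1 < B := by rw [hpi, hp'.pH]; omega
    refine (Ev.seq (t₁ := 90) (t₂ := 30 * n + 5) (Q := fun s'' => s''.v .j = 0 ∧
      s''.v .p = s'.v .p + 2 ∧ s''.a .comp = s'.a .comp ∧
      s''.v .ca = s'.a .comp eH[i].1 ∧ s''.v .cb = s'.a .comp eH[i].2 ∧
      ∀ v : Fin n, s''.a .deg v = s'.a .deg v + ((if eH[i].1 = v then 1 else 0) +
        if eH[i].2 = v then 1 else 0))
      (Ev.of_wp ?_ (by decide)) ?_).mono (by omega) fun _ _ h => h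
    · simp only [Cmd.countEdge, Cmd.wp, Op.Ok, Op.eval, true_and, St.setV_v, St.setA_v,
        St.setA_a, St.setV_a, St.setV_inp, if_true, reduceCtorEq, if_false, e₁, e₂, hlt,
        Nat.lt_of_succ_lt hlt, Nat.zero_le]
      intro v
      simp only [Function.update_apply, Fin.val_inj]
      by_cases h₁ : eH[i].1 = v <;> by_cases h₂ : eH[i].2 = v <;>
        simp [h₁, h₂, eq_comm (a := v)]
    · rintro s₃ hf₃ ⟨hj, hp₃, hc₃, hca, hcb, hd⟩
      have hp₃' := hp'.frame hf₃ (by decide)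
      refine (ev_relabel (n := n) hp₃'.hn hj).mono le_rfl ?_
      intro s₄ hf₄ hc₄
      have hp₄ : s₄.v .p = s'.v .p + 2 := by rw [hf₄.v .p (by decide), hp₃]
      have hpH₄ : s₄.v .pH = s'.v .pH := by rw [hf₄.v _ (by decide), hf₃.v _ (by decide)]
      have hd₄ : s₄.a .deg = s₃.a .deg := hf₄.a _ (by decide)
      rw [hca, hcb, hc₃] at hc₄
      refine ⟨⟨i + 1, hi', by rw [hp₄, hpH₄, hpi]; ring, ?_⟩, by rw [hp₄, hpH₄, hpi]; omega⟩
      have htake : eH.take (i + 1) = eH.take i ++ [eH[i]] := by simp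
      have hmono : ∀ u v, Relation.EqvGen (fun a b => (a, b) ∈ eH.take i) u v →
          Relation.EqvGen (fun a b => (a, b) ∈ eH.take (i + 1)) u v := fun u v h =>
        h.mono fun a b hab => by rw [htake]; exact List.mem_append_left _ hab
      have hedge : Relation.EqvGen (fun a b => (a, b) ∈ eH.take (i + 1)) eH[i].1 eH[i].2 :=
        .rel _ _ (by rw [htake]; exact List.mem_append_right _ (List.mem_singleton_self _))
      constructor
      · intro v
        rw [hc₄ v v.2]
        split_ifs
        · exact hl.lt _
        · exact hl.lt _
      · intro u v h
        rw [hc₄ v v.2, hc₄ u u.2] at h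
        split_ifs at h with h₁ h₂ h₂
        · exact (hmono _ _ (hl.sound _ _ h₁)).trans _ _ _ (hmono _ _ (hl.sound _ _ h₂.symm))
        -- Here `u` had the replaced label and `v` already carries the new one: the chain runs from
        -- `u` to the first endpoint, across the new edge, and on to `v`.
        · exact ((hmono _ _ (hl.sound _ _ h₁)).trans _ _ _ hedge).trans _ _ _
            (hmono _ _ (hl.sound _ _ h))
        · exact ((hmono _ _ (hl.sound _ _ h)).trans _ _ _ (hedge.symm _ _)).trans _ _ _
            (hmono _ _ (hl.sound _ _ h₂.symm))
        · exact hmono _ _ (hl.sound _ _ h)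
      · intro e he
        rw [htake, List.mem_append, List.mem_singleton] at he
        rw [hc₄ _ e.1.2, hc₄ _ e.2.2]
        rcases he with he | rfl
        · rw [hl.complete e he]
        · rw [if_pos rfl]
          split_ifs <;> rfl
      · intro v
        rw [hd₄, hd, hl.deg, htake]
        simp only [List.countP_append, List.countP_cons, List.countP_nil, decide_eq_true_eq]
        omega
  · rintro s' hf' ⟨⟨i, hi, hpi, hl⟩, h₃⟩
    have hp' := hp₂.frame hf' (by decide)
    simp only [Cond.Holds, hpi, hp'.pH, hp'.lim] at h₃
    obtain rfl : i = eH.length := by omega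
    simpa using hl

end CoverRAM

/-! ### Bad components -/

namespace CoverRAM

open PathCover

variable {B L n : ℕ} {eG eH : List (Fin n × Fin n)} {U : Set (Fin n)}

/-- The number of vertices of `U` (given by its indicator `f`) with label `c` that satisfy `p`. -/
def labelCount (f comp : ℕ → ℕ) (p : ℕ → Prop) [DecidablePred p] (c k : ℕ) : ℕ :=
  Nat.count (fun v => f v ≠ 0 ∧ comp v = c ∧ p v) k

/-- The statistics of the first `k` vertices. -/
structure Stats (f : ℕ → ℕ) (k : ℕ) (s : St) : Prop where
  inU : ∀ v < k, s.a .inU v = f v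
  sz : ∀ c, s.a .sz c = labelCount f (s.a .comp) (fun _ => True) c k
  c1 : ∀ c, s.a .c1 c = labelCount f (s.a .comp) (fun v => s.a .deg v = 1) c k
  c2 : ∀ c, s.a .c2 c = labelCount f (s.a .comp) (fun v => s.a .deg v = 2) c k

theorem ev_statistics {s : St} (hp : Params eG U eH s) (hsz : ∀ i, s.a .sz i = 0)
    (hc1 : ∀ i, s.a .c1 i = 0) (hc2 : ∀ i, s.a .c2 i = 0)
    (hB : B = 3 + 2 * eG.length + n + 2 * eH.length) :
    Ev B L .statistics s (100 * n + 10)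
      (Stats (fun v => s.inp (3 + 2 * eG.length + v)) n) := by
  set f := fun v => s.inp (3 + 2 * eG.length + v) with hf
  refine (Ev.seq (t₁ := 1) (Q := fun s' => s'.v .j = 0 ∧ s'.a = s.a)
    (t₂ := 1 + (100 * n + 5)) (Ev.of_wp (by simp [Cmd.wp, Op.Ok, Op.eval]) (by decide))
    fun s₁ hf₁ hs₁ => Ev.seq (Q := fun s' => s'.v .j = 0 ∧ s'.v .q = s'.v .pU ∧ s'.a = s.a)
      (Ev.of_wp (by simp [Cmd.wp, Op.Ok, Op.eval, hs₁]) (by decide)) fun s₂ hf₂ hs₂ => ?_).mono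
    (by omega) fun _ _ h => h
  have hp₂ : Params eG U eH s₂ := (hp.frame hf₁ (by decide)).frame hf₂ (by decide)
  have hi₂ : s₂.inp = s.inp := by rw [hf₂.inp (by decide), hf₁.inp (by decide)]
  refine (Ev.loop (fun s' => s'.v .j ≤ n ∧ s'.v .q = s'.v .pU + s'.v .j ∧ Stats f (s'.v .j) s')
    (fun s' => n - s'.v .j) 95 ⟨by omega, by omega, ?_⟩ ?_).mono (by simp [hs₂.1]) ?_
  · constructor <;> intro c <;> simp [hs₂.1, hs₂.2.2, labelCount, hsz, hc1, hc2]
  · rintro s' hf' ⟨hj, hq, hst⟩ hb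
    have hp' := hp₂.frame hf' (by decide)
    simp only [Cond.Holds, hp'.hn] at hb
    have e : s'.inp (s'.v .q) = f (s'.v .j) := by
      rw [hq, hp'.pU, hf'.inp (by decide), hi₂]
    have hlt : s'.v .q < B := by rw [hq, hp'.pU]; omega
    refine Ev.of_wp ?_ (by decide)
    have hI : ∀ v < s'.v .j + 1,
        Function.update (s'.a .inU) (s'.v .j) (f (s'.v .j)) v = f v := by
      intro v hv
      rw [Function.update_apply]
      split_ifs with h
      · rw [h]
      · exact hst.inU v (by omega)
    simp only [Cmd.statStep, Cmd.bump, Cmd.wp, Op.Ok, Op.eval, Cond.Holds, true_and, St.setV_v,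
      St.setA_v, St.setA_a, St.setV_a, if_true, reduceCtorEq, if_false, e, hlt, Nat.reduceLeDiff, hp'.zero]
    have hμ : n - (s'.v .j + 1) < n - s'.v .j := by omega
    refine ⟨fun h => ⟨⟨hb, by omega, ?_⟩, hμ⟩, fun h => ⟨fun h1 => ⟨fun h2 => ?_,
      fun h2 => ⟨⟨hb, by omega, ?_⟩, hμ⟩⟩, fun h1 => ⟨fun h2 => ⟨⟨hb, by omega, ?_⟩, hμ⟩,
      fun h2 => ⟨⟨hb, by omega, ?_⟩, hμ⟩⟩⟩⟩
    · constructor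
      · simpa using hI
      all_goals
        intro c
        simp only [St.setV_a, St.setA_a, reduceCtorEq, if_false, labelCount, Nat.count_succ, h,
          ne_eq, not_true, false_and, add_zero]
      · exact hst.sz c
      · exact hst.c1 c
      · exact hst.c2 c
    -- This branch would need a degree that is both 1 and 2.
    · omega
    all_goals
      constructor
      · simpa using hI
      all_goals
        intro c
        have k₁ := hst.sz c
        have k₂ := hst.c1 c
        have k₃ := hst.c2 c
        simp only [labelCount, ne_eq, and_true] at k₁ k₂ k₃
        simp only [St.setV_a, St.setA_a, reduceCtorEq, if_false, if_true, labelCount,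
          Nat.count_succ, h, h1, h2, ne_eq, not_false_eq_true, true_and, and_true, and_false,
          Function.update_apply, add_zero, Nat.reduceEqDiff]
        first
        | assumption
        | (by_cases hc : c = s'.a .comp (s'.v .j)
           · subst hc
             simp only [if_true]
             omega
           · rw [if_neg hc, if_neg (fun h => hc h.symm), add_zero]
             assumption)
  · rintro s' hf' ⟨⟨h₁, -, h₂⟩, h₃⟩
    have hp' := hp₂.frame hf' (by decide)
    simp only [Cond.Holds, hp'.hn] at h₃
    rwa [show n = s'.v .j by omega]

theorem ev_badness {s : St} (hp : Params eG U eH s) :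
    Ev B L .badness s (100 * n + 10) fun s' => ∀ c < n,
      s'.a .bad c = if s.a .sz c = 5 ∧ s.a .c1 c = 2 ∧ s.a .c2 c = 3 then 0 else 1 := by
  refine (Ev.seq (t₁ := 1) (Q := fun s' => s'.v .j = 0 ∧ s'.a = s.a)
    (t₂ := (100 * n + 5)) (Ev.of_wp (by simp [Cmd.wp, Op.Ok, Op.eval]) (by decide))
    fun s₁ hf₁ hs₁ => ?_).mono (by omega) fun _ _ h => h
  have hp₁ : Params eG U eH s₁ := hp.frame hf₁ (by decide)
  refine (Ev.loop (fun s' => s'.v .j ≤ n ∧ ∀ c < s'.v .j,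
      s'.a .bad c = if s.a .sz c = 5 ∧ s.a .c1 c = 2 ∧ s.a .c2 c = 3 then 0 else 1)
    (fun s' => n - s'.v .j) 95 (by simp [hs₁.1]) ?_).mono (by simp [hs₁.1]) ?_
  · rintro s' hf' ⟨hj, hst⟩ hb
    have hp' := hp₁.frame hf' (by decide)
    simp only [Cond.Holds, hp'.hn] at hb
    have e₁ : s'.a .sz = s.a .sz := by rw [hf'.a _ (by decide), hs₁.2]
    have e₂ : s'.a .c1 = s.a .c1 := by rw [hf'.a _ (by decide), hs₁.2]
    have e₃ : s'.a .c2 = s.a .c2 := by rw [hf'.a _ (by decide), hs₁.2]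
    refine Ev.of_wp ?_ (by decide)
    have hμ : n - (s'.v .j + 1) < n - s'.v .j := by omega
    simp only [Cmd.badStep, Cmd.wp, Op.Ok, Op.eval, Cond.Holds, true_and, St.setV_v,
      St.setA_v, St.setA_a, St.setV_a, if_true, reduceCtorEq, if_false,
      Nat.reduceLeDiff, hp'.zero, hp'.one, e₁, e₂, e₃, hμ, and_true, le_refl]
    have key : ∀ k, (k = if s.a .sz (s'.v .j) = 5 ∧ s.a .c1 (s'.v .j) = 2 ∧ s.a .c2 (s'.v .j) = 3
        then 0 else 1) → ∀ c < s'.v .j + 1, Function.update (s'.a .bad) (s'.v .j) k c =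
          if s.a .sz c = 5 ∧ s.a .c1 c = 2 ∧ s.a .c2 c = 3 then 0 else 1 := by
      intro k hk c hc
      rw [Function.update_apply]
      split_ifs with h h'
      · rw [hk, if_pos (h ▸ h')]
      · rw [hk, if_neg (h ▸ ‹¬ _›)]
      · rw [hst c (by omega), if_pos ‹_›]
      · rw [hst c (by omega), if_neg ‹_›]
    refine ⟨fun h1 => ⟨fun h2 => ⟨fun h3 => ⟨hb, ?_⟩, fun h3 => ⟨hb, ?_⟩⟩, fun h2 => ⟨hb, ?_⟩⟩,
      fun h1 => ⟨hb, ?_⟩⟩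
    -- The mark 1 is written first and then overwritten by 0.
    · rw [Function.update_idem]
      exact key 0 (by simp [h1, h2, h3])
    all_goals exact key 1 (by simp [*])
  · rintro s' hf' ⟨⟨h₁, h₂⟩, h₃⟩ c hc
    have hp' := hp₁.frame hf' (by decide)
    simp only [Cond.Holds, hp'.hn] at h₃
    exact h₂ c (by omega)

end CoverRAM

/-! ### The entries of the auction -/

namespace CoverRAM

open PathCover

variable {B L n : ℕ} {eG eH : List (Fin n × Fin n)} {U : Set (Fin n)}

theorem Op.eval_frame (o : Op) (s : St) : Frame (.op o) s (o.eval s) := by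
  refine ⟨fun x hx => ?_, fun A hA => ?_, fun hi => ?_⟩
  · cases o <;> simp_all [Cmd.writesVar, Op.writesVar, Op.eval, eq_comm]
  · cases o <;> simp_all [Cmd.writesArr, Op.writesArr, Op.eval, eq_comm]
  · cases o <;> simp_all [Cmd.writesInp, Op.writesInp, Op.eval, eq_comm]

theorem Cmd.wp_mono {c : Cmd} {s : St} {Q R : St → Prop} (h : c.wp B L s Q)
    (hQ : ∀ s', Frame c s s' → Q s' → R s') : c.wp B L s R := by
  induction c generalizing s Q R with
  | op o => exact ⟨h.1, hQ _ (o.eval_frame s) h.2⟩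
  | skip => exact hQ _ (Frame.refl _ _) h
  | seq c d hc hd =>
    refine hc h fun s₁ f₁ h₁ => hd h₁ fun s₂ f₂ h₂ => hQ s₂ ((f₁.mono ?_ ?_ ?_).trans
      (f₂.mono ?_ ?_ ?_)) h₂ <;> simp_all [Cmd.writesVar, Cmd.writesArr, Cmd.writesInp]
  | ite b c d hc hd =>
    refine ⟨fun hb => hc (h.1 hb) fun s' f h' => hQ s' (f.mono ?_ ?_ ?_) h',
      fun hb => hd (h.2 hb) fun s' f h' => hQ s' (f.mono ?_ ?_ ?_) h'⟩ <;>
      simp_all [Cmd.writesVar, Cmd.writesArr, Cmd.writesInp]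
  | loop => exact h.elim

/-- `p` is `0` if no index below `k` has the key `K`, and otherwise one more than the last such
index. -/
structure IsLast (key : ℕ → ℕ) (K k p : ℕ) : Prop where
  le : p ≤ k
  key_eq : p = 0 ∨ key (p - 1) = K
  ne : ∀ e, p ≤ e → e < k → key e ≠ K

/-- Appending an entry alters keys only from the old end on, so all links between older entries stay
valid. -/
theorem IsLast.congr {key key' : ℕ → ℕ} {K k p : ℕ} (h : IsLast key K k p)
    (hk : ∀ e < k, key' e = key e) : IsLast key' K k p := by
  refine ⟨h.le, ?_, fun e he hek => by rw [hk e hek]; exact h.ne e he hek⟩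
  rcases h.key_eq with h₀ | h₁
  · exact .inl h₀
  · by_cases h₀ : p = 0
    · exact .inl h₀
    · exact .inr (by rw [hk _ (by have := h.le; omega), h₁])

/-- The key of an entry is the label of its source. -/
def St.key (s : St) (e : ℕ) : ℕ := s.a .comp (s.a .src e)

/-- The entries (sources, targets and slots) are exactly the elements of `T`, and they are stored
in linked lists according to their keys. -/
structure EntrySet (T : Set (ℕ × ℕ × ℕ)) (s : St) : Prop where
  sound : ∀ e < s.v .E, (s.a .src e, s.a .dst e, s.a .slot e) ∈ T
  complete : ∀ t ∈ T, ∃ e < s.v .E, (s.a .src e, s.a .dst e, s.a .slot e) = t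
  head : ∀ K, IsLast s.key K (s.v .E) (s.a .head K)
  cur : s.a .cur = s.a .head
  next : ∀ e < s.v .E, IsLast s.key (s.key e) e (s.a .next e)

theorem EntrySet.congr {T : Set (ℕ × ℕ × ℕ)} {s s' : St} (h : EntrySet T s)
    (ha : ∀ A ∈ [Arr.comp, .src, .dst, .slot, .head, .cur, .next], s'.a A = s.a A)
    (hE : s'.v .E = s.v .E) : EntrySet T s' := by
  simp only [List.forall_mem_cons, List.not_mem_nil, false_imp_iff, implies_true, and_true] at ha
  obtain ⟨h₁, h₂, h₃, h₄, h₅, h₆, h₇⟩ := ha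
  have hk : s'.key = s.key := by
    funext e
    simp only [St.key, h₁, h₂]
  constructor
  · rw [h₂, h₃, h₄, hE]; exact h.sound
  · rw [h₂, h₃, h₄, hE]; exact h.complete
  · rw [h₅, hE, hk]; exact h.head
  · rw [h₅, h₆]; exact h.cur
  · rw [h₇, hE, hk]; exact h.next

/-- The new entry is the last with its key, so it becomes the head of that list and the old head
becomes its successor. For all other keys the last entry is unchanged. Lists thus run through
entries in decreasing order. -/
theorem wp_push {s : St} {k x y : Var} {T : Set (ℕ × ℕ × ℕ)} {Q : St → Prop} (h : EntrySet T s)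
    (hk : s.v k = s.a .comp (s.v x)) (hku : k ≠ .u) (hkE : k ≠ .E)
    (hQ : ∀ s', Frame (.push k x y) s s' → s'.v .E = s.v .E + 1 →
      EntrySet (insert (s.v x, s.v y, s.v .w) T) s' → Q s') :
    (Cmd.push k x y).wp B L s Q := by
  refine Cmd.wp_mono (Q := fun s' => s'.v .E = s.v .E + 1 ∧
      EntrySet (insert (s.v x, s.v y, s.v .w) T) s') ?_ fun s' hf hs => hQ s' hf hs.1 hs.2
  simp only [Cmd.push, Cmd.wp, Op.Ok, Op.eval, true_and, St.setV_v, St.setA_v, St.setA_a,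
    if_true, reduceCtorEq, if_false, hku, hkE]
  set s' : St := St.setA _ Arr.cur _ _ with hs'
  have hE : s'.v .E = s.v .E + 1 := by simp [hs']
  have hcomp : s'.a .comp = s.a .comp := by simp [hs']
  have hsrc : s'.a .src = Function.update (s.a .src) (s.v .E) (s.v x) := by simp [hs']
  have hdst : s'.a .dst = Function.update (s.a .dst) (s.v .E) (s.v y) := by simp [hs']
  have hslot : s'.a .slot = Function.update (s.a .slot) (s.v .E) (s.v .w) := by simp [hs']
  have hhead : s'.a .head = Function.update (s.a .head) (s.v k) (s.v .E + 1) := by simp [hs']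
  have hcur : s'.a .cur = Function.update (s.a .cur) (s.v k) (s.v .E + 1) := by simp [hs']
  have hnext : s'.a .next = Function.update (s.a .next) (s.v .E) (s.a .head (s.v k)) := by
    simp [hs']
  clear_value s'
  have hkey : ∀ e < s.v .E, s'.key e = s.key e := by
    intro e he
    simp only [St.key, hcomp, hsrc, Function.update_of_ne he.ne]
  have hkeyE : s'.key (s.v .E) = s.v k := by
    simp only [St.key, hcomp, hsrc, Function.update_self, hk]
  refine ⟨?_, ?_, ?_, ?_, ?_⟩
  · intro e he
    rw [hE] at he
    rw [hsrc, hdst, hslot]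
    rcases Nat.lt_succ_iff_lt_or_eq.1 he with h₁ | rfl
    · simp only [Function.update_of_ne h₁.ne]
      exact .inr (h.sound e h₁)
    · simp only [Function.update_self]
      exact .inl rfl
  · rintro t (rfl | ht)
    · exact ⟨s.v .E, by omega, by simp only [hsrc, hdst, hslot, Function.update_self]⟩
    · obtain ⟨e, he, het⟩ := h.complete t ht
      refine ⟨e, by omega, ?_⟩
      rw [hsrc, hdst, hslot]
      simpa only [Function.update_of_ne he.ne] using het
  · intro K
    rw [hE, hhead, Function.update_apply]
    split_ifs with hK
    · subst hK
      exact ⟨le_rfl, .inr (by simpa using hkeyE), fun e h₁ h₂ => by omega⟩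
    · have h₁ := (h.head K).congr hkey
      refine ⟨h₁.le.trans (Nat.le_succ _), h₁.key_eq, fun e he₁ he₂ => ?_⟩
      rcases Nat.lt_succ_iff_lt_or_eq.1 he₂ with h₂ | rfl
      · exact h₁.ne e he₁ h₂
      · rw [hkeyE]
        exact fun h => hK h.symm
  · rw [hhead, hcur, h.cur]
  · intro e he
    rw [hE] at he
    rw [hnext]
    rcases Nat.lt_succ_iff_lt_or_eq.1 he with h₁ | rfl
    · rw [Function.update_of_ne h₁.ne, hkey e h₁]
      exact (h.next e h₁).congr fun e' he' => hkey e' (he'.trans h₁)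
    · rw [Function.update_self, hkeyE]
      exact (h.head _).congr hkey

theorem wp_pushBoth {s : St} {k x y : Var} {T : Set (ℕ × ℕ × ℕ)} {Q : St → Prop}
    (h : EntrySet T s) (hz : s.v .zero = 0) (hk : s.v k = s.a .comp (s.v x))
    (hv : ∀ z ∈ [k, x, y], z ≠ .u ∧ z ≠ .w ∧ z ≠ .E) (hL : 2 * s.v y ≤ L)
    (hQ : ∀ s', Frame (.pushBoth k x y) s s' → s'.v .E ≤ s.v .E + 2 →
      EntrySet (T ∪ {t | s.a .bad (s.v k) ≠ 0 ∧ ∃ d < 2, t = (s.v x, s.v y, 2 * s.v y + d)}) s' →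
      Q s') :
    (Cmd.pushBoth k x y).wp B L s Q := by
  simp only [List.forall_mem_cons, List.not_mem_nil, false_imp_iff, implies_true, and_true] at hv
  obtain ⟨⟨hk₁, hk₂, hk₃⟩, ⟨hx₁, hx₂, hx₃⟩, ⟨hy₁, hy₂, hy₃⟩⟩ := hv
  refine Cmd.wp_mono (Q := fun s' => s'.v .E ≤ s.v .E + 2 ∧
      EntrySet (T ∪ {t | s.a .bad (s.v k) ≠ 0 ∧ ∃ d < 2, t = (s.v x, s.v y, 2 * s.v y + d)}) s')
      ?_ fun s' hf hs => hQ s' hf hs.1 hs.2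
  refine ⟨trivial, fun hb => ?_, fun hb => ?_⟩
  · simp only [Cond.Holds, Op.eval, St.setV_v, if_true, reduceCtorEq, if_false, hz] at hb
    refine ⟨by simp [Op.eval], ?_⟩
    simp only [hb, ne_eq, not_true, false_and, Set.ofPred_false, Set.union_empty]
    exact h.congr (by simp [Op.eval]) (by simp [Op.eval])
  · simp only [Cond.Holds, Op.eval, St.setV_v, if_true, reduceCtorEq, if_false, hz] at hb
    refine ⟨by simp [Op.Ok, Op.eval, hy₁]; omega, ?_⟩
    refine wp_push (T := T) (h.congr (by simp [Op.eval]) (by simp [Op.eval]))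
      (by simp [Op.eval, hk₁, hk₂, hx₁, hx₂, hk]) hk₁ hk₃ fun s₁ f₁ e₁ h₁ => ⟨trivial, ?_⟩
    have hpv : ∀ z, z ≠ .u → z ≠ .w → z ≠ .E → s₁.v z = s.v z := by
      intro z z₁ z₂ z₃
      rw [f₁.v z]
      · simp [Op.eval, z₁, z₂]
      · simp [Cmd.push, Cmd.writesVar, Op.writesVar, z₁.symm, z₃.symm]
    have hw₁ : s₁.v .w = s.v y + s.v y := by
      rw [f₁.v .w (by simp [Cmd.push, Cmd.writesVar, Op.writesVar])]
      simp [Op.eval, hy₁]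
    have hcomp : s₁.a .comp = s.a .comp := by
      rw [f₁.a .comp (by simp [Cmd.push, Cmd.writesArr, Op.writesArr])]
      simp [Op.eval]
    refine wp_push (h₁.congr (by simp [Op.eval]) (by simp [Op.eval]))
      (by simp [Op.eval, hk₂, hx₂, hpv, hk₁, hk₃, hx₁, hx₃, hk, hcomp]) hk₁ hk₃
      fun s₂ f₂ e₂ h₂ => ⟨?_, ?_⟩
    · rw [e₂]
      simp only [Op.eval, St.setV_v, reduceCtorEq, if_false, e₁]
      omega
    · refine (congrArg (EntrySet · s₂) ?_).mp h₂
      ext t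
      simp only [Op.eval, St.setV_v, reduceCtorEq, if_false, if_true, hpv x hx₁ hx₂ hx₃,
        hpv y hy₁ hy₂ hy₃, hx₁, hx₂, hy₁, hy₂, Set.mem_insert_iff, Set.mem_union, Set.mem_ofPred_eq,
        ne_eq, hb, not_false_eq_true, true_and, hw₁, ← two_mul]
      constructor
      · rintro (rfl | rfl | ht)
        · exact .inr ⟨1, by omega, rfl⟩
        · exact .inr ⟨0, by omega, rfl⟩
        · exact .inl ht
      · rintro (ht | ⟨d, hd, rfl⟩)
        · exact .inr (.inr ht)
        · interval_cases d
          · exact .inr (.inl rfl)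
          · exact .inl rfl

/-- The entries that belong to the edges in `l`. -/
def entryTriples (l : List (Fin n × Fin n)) (inU comp bad : ℕ → ℕ) : Set (ℕ × ℕ × ℕ) :=
  {t | ∃ x y : Fin n, ((x, y) ∈ l ∨ (y, x) ∈ l) ∧ inU x ≠ 0 ∧ inU y ≠ 0 ∧ comp x ≠ comp y ∧
    bad (comp x) ≠ 0 ∧ ∃ d < 2, t = (x.val, y.val, 2 * y.val + d)}

theorem entryTriples_append (l : List (Fin n × Fin n)) (p : Fin n × Fin n)
    (inU comp bad : ℕ → ℕ) :
    entryTriples (l ++ [p]) inU comp bad = entryTriples l inU comp bad ∪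
      {t | inU p.1 ≠ 0 ∧ inU p.2 ≠ 0 ∧ comp p.1 ≠ comp p.2 ∧
        ((bad (comp p.1) ≠ 0 ∧ ∃ d < 2, t = (p.1.val, p.2.val, 2 * p.2.val + d)) ∨
        (bad (comp p.2) ≠ 0 ∧ ∃ d < 2, t = (p.2.val, p.1.val, 2 * p.1.val + d)))} := by
  ext t
  simp only [entryTriples, List.mem_append, List.mem_singleton, Set.mem_union, Set.mem_ofPred_eq]
  constructor
  · rintro ⟨x, y, (h | h) | (h | h), h₁, h₂, h₃, h₄, h₅⟩
    · exact .inl ⟨x, y, .inl h, h₁, h₂, h₃, h₄, h₅⟩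
    · subst h
      exact .inr ⟨h₁, h₂, h₃, .inl ⟨h₄, h₅⟩⟩
    · exact .inl ⟨x, y, .inr h, h₁, h₂, h₃, h₄, h₅⟩
    · subst h
      exact .inr ⟨h₂, h₁, h₃.symm, .inr ⟨h₄, h₅⟩⟩
  · rintro (⟨x, y, h, h₁⟩ | ⟨h₁, h₂, h₃, h | h⟩)
    · exact ⟨x, y, by tauto, h₁⟩
    · exact ⟨p.1, p.2, by simp, h₁, h₂, h₃, h.1, h.2⟩
    · exact ⟨p.2, p.1, by simp, h₂, h₁, h₃.symm, h.1, h.2⟩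

/-- An edge yields at most four entries: either end may belong to a bidder, and the opposite end
offers two slots. -/
theorem ev_entries {s : St} (hp : Params eG U eH s) (hhead : ∀ i, s.a .head i = 0)
    (hcur : ∀ i, s.a .cur i = 0)
    (hB : B = 3 + 2 * eG.length + n + 2 * eH.length) (hL : 2 * n ≤ L) :
    Ev B L .entries s (300 * eG.length + 10) fun s' => s'.v .E ≤ 4 * eG.length ∧
      EntrySet (entryTriples eG (s.a .inU) (s.a .comp) (s.a .bad)) s' := by
  refine (Ev.seq (t₁ := 1) (Q := fun s' => s'.v .E = 0 ∧ s'.a = s.a)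
    (t₂ := 1 + (300 * eG.length + 5)) (Ev.of_wp (by simp [Cmd.wp, Op.Ok, Op.eval]) (by decide))
    fun s₁ hf₁ hs₁ => Ev.seq (Q := fun s' => s'.v .E = 0 ∧ s'.v .p = 3 ∧ s'.a = s.a)
      (Ev.of_wp (by simp [Cmd.wp, Op.Ok, Op.eval, hs₁]) (by decide)) fun s₂ hf₂ hs₂ => ?_).mono
    (by omega) fun _ _ h => h
  have hp₂ : Params eG U eH s₂ := (hp.frame hf₁ (by decide)).frame hf₂ (by decide)
  refine (Ev.loop (fun s' => ∃ i ≤ eG.length, s'.v .p = 3 + 2 * i ∧ s'.v .E ≤ 4 * i ∧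
      EntrySet (entryTriples (eG.take i) (s.a .inU) (s.a .comp) (s.a .bad)) s')
    (fun s' => eG.length - (s'.v .p - 3) / 2) 295
      ⟨0, by omega, by omega, by omega, ?_⟩ ?_).mono (by simp [hs₂.2.1]) ?_
  · have he : entryTriples (eG.take 0) (s.a .inU) (s.a .comp) (s.a .bad) = ∅ := by
      simp [entryTriples]
    rw [he]
    constructor
    · intro e he
      omega
    · intro t ht
      exact ht.elim
    · intro K
      rw [hs₂.2.2, hs₂.1, hhead]
      exact ⟨le_rfl, .inl rfl, fun e h₁ h₂ => by omega⟩
    · funext i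
      rw [hs₂.2.2, hhead, hcur]
    · intro e he
      omega
  · rintro s' hf' ⟨i, hi, hpi, hE, hes⟩ hb
    have hp' := hp₂.frame hf' (by decide)
    simp only [Cond.Holds, hpi, hp'.pU] at hb
    have hi' : i < eG.length := by omega
    have e₁ : s'.inp (s'.v .p) = eG[i].1 := by rw [hpi]; exact hp'.fstG i hi'
    have e₂ : s'.inp (s'.v .p + 1) = eG[i].2 := by rw [hpi]; exact hp'.sndG i hi'
    have hlt : s'.v .p + 1 < B := by rw [hpi]; omega
    have hin : s'.a .inU = s.a .inU := by rw [hf'.a _ (by decide), hs₂.2.2]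
    have hco : s'.a .comp = s.a .comp := by rw [hf'.a _ (by decide), hs₂.2.2]
    have hba : s'.a .bad = s.a .bad := by rw [hf'.a _ (by decide), hs₂.2.2]
    have htake : eG.take (i + 1) = eG.take i ++ [eG[i]] := by simp
    have hfst := eG[i].1.2
    have hsnd := eG[i].2.2
    have fin : ∀ s'' : St, s''.v .p = s'.v .p + 2 → s''.v .E ≤ s'.v .E + 4 →
        EntrySet (entryTriples (eG.take (i + 1)) (s.a .inU) (s.a .comp) (s.a .bad)) s'' →
        (fun s'' : St => (∃ i ≤ eG.length, s''.v .p = 3 + 2 * i ∧ s''.v .E ≤ 4 * i ∧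
          EntrySet (entryTriples (eG.take i) (s.a .inU) (s.a .comp) (s.a .bad)) s'') ∧
          eG.length - (s''.v .p - 3) / 2 < eG.length - (s'.v .p - 3) / 2) s'' := by
      intro s'' h₁ h₂ h₃
      exact ⟨⟨i + 1, hi', by omega, by omega, h₃⟩, by omega⟩
    rw [htake, entryTriples_append] at fin
    refine Ev.of_wp ?_ (by decide)
    revert fin
    generalize (fun s'' : St => (∃ i ≤ eG.length, s''.v .p = 3 + 2 * i ∧ s''.v .E ≤ 4 * i ∧
      EntrySet (entryTriples (eG.take i) (s.a .inU) (s.a .comp) (s.a .bad)) s'') ∧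
      eG.length - (s''.v .p - 3) / 2 < eG.length - (s'.v .p - 3) / 2) = Q
    intro fin
    simp only [Cmd.entryStep, Cmd.wp, Op.Ok, Op.eval, Cond.Holds, true_and, St.setV_v, St.setV_a,
      St.setV_inp, if_true, reduceCtorEq, if_false, e₁, e₂, hlt, Nat.lt_of_succ_lt hlt, hp'.zero,
      hin, hco]
    refine ⟨fun h => ?_, fun h => ⟨fun h1 => ?_, fun h1 => ⟨fun h2 => ?_, fun h2 => ?_⟩⟩⟩
    · refine fin _ ?_ ?_ ?_
      · simp
      · simp
      simp only [h, ne_eq, not_true, false_and, Set.ofPred_false, Set.union_empty]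
      exact hes.congr (by simp) (by simp)
    · refine fin _ ?_ ?_ ?_
      · simp
      · simp
      simp only [h1, ne_eq, not_true, false_and, and_false, Set.ofPred_false, Set.union_empty]
      exact hes.congr (by simp) (by simp)
    · refine fin _ ?_ ?_ ?_
      · simp
      · simp
      simp only [h2, ne_eq, not_true, false_and, and_false, Set.ofPred_false, Set.union_empty]
      exact hes.congr (by simp) (by simp)
    · refine wp_pushBoth (hes.congr (by simp) (by simp)) (by simp [hp'.zero]) (by simp [hco])
        (by simp) (by simp; omega) fun s₃ f₃ h₃ h₃' => ?_
      have z₃ : s₃.v .zero = 0 := by rw [f₃.v _ (by decide)]; simp [hp'.zero]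
      have a₃ : s₃.v .a = eG[i].1 := by rw [f₃.v _ (by decide)]; simp
      have b₃ : s₃.v .b = eG[i].2 := by rw [f₃.v _ (by decide)]; simp
      have ca₃ : s₃.v .ca = s.a .comp eG[i].1 := by rw [f₃.v _ (by decide)]; simp
      have cb₃ : s₃.v .cb = s.a .comp eG[i].2 := by rw [f₃.v _ (by decide)]; simp
      have p₃ : s₃.v .p = s'.v .p + 2 := by rw [f₃.v _ (by decide)]; simp
      have co₃ : s₃.a .comp = s.a .comp := by rw [f₃.a _ (by decide)]; simp [hco]
      have ba₃ : s₃.a .bad = s.a .bad := by rw [f₃.a _ (by decide)]; simp [hba]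
      refine wp_pushBoth h₃' z₃ (by rw [cb₃, co₃, b₃])
        (by simp) (by omega) fun s₄ f₄ h₄ h₄' => ?_
      refine fin _ (by rw [f₄.v _ (by decide), p₃]) ?_ ?_
      · simp only [St.setV_v, reduceCtorEq, if_false] at h₃
        omega
      · refine (congrArg (EntrySet · s₄) ?_).mp h₄'
        rw [Set.union_assoc]
        congr 1
        ext t
        simp only [St.setV_v, St.setV_a, reduceCtorEq, if_false, if_true, Set.mem_union,
          Set.mem_ofPred_eq, ne_eq, h, h1, h2, not_false_eq_true, true_and, a₃, b₃, cb₃, ba₃, hba]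
  · rintro s' hf' ⟨⟨i, hi, hpi, hE, hes⟩, h₃⟩
    have hp' := hp₂.frame hf' (by decide)
    simp only [Cond.Holds, hpi, hp'.pU] at h₃
    obtain rfl : i = eG.length := by omega
    rw [List.take_length] at hes
    exact ⟨hE, hes⟩

end CoverRAM

/-! ### The auction -/

namespace CoverRAM

open PathCover Function

/-- The entries of an auction: bidders `k < n`, entries `e < E` with the bidder `key e` and the item
`slot e`, and the linked lists of the entries of each bidder. -/
structure Market where
  n : ℕ
  E : ℕ
  key : ℕ → ℕ
  slot : ℕ → ℕ
  head : ℕ → ℕ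
  next : ℕ → ℕ
  key_lt : ∀ e < E, key e < n
  slot_lt : ∀ e < E, slot e < 2 * n
  isLast_head : ∀ k, IsLast key k E (head k)
  isLast_next : ∀ e < E, IsLast key (key e) e (next e)

/-- The state of an auction. -/
@[ext] structure Auction where
  cur : ℕ → ℕ
  lab : ℕ → ℕ
  price : ℕ → ℕ
  own : ℕ → ℕ
  mate : ℕ → ℕ
  K : ℕ
  b : ℕ

/-- The invariant of the auction: the label of a bidder is a lower bound for the prices of its
items, and its own item exceeds this bound by `1`. -/
structure Auction.Inv (M : Market) (N : ℕ) (A : Auction) : Prop where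
  low : ∀ e < M.E, A.lab (M.key e) ≤ A.price (M.slot e)
  passed : ∀ e < M.E, A.cur (M.key e) ≤ e → A.lab (M.key e) < A.price (M.slot e)
  cur_le : ∀ k, A.cur k ≤ M.E
  cur_key : ∀ k, A.cur k ≠ 0 → M.key (A.cur k - 1) = k
  mate_le : ∀ k, A.mate k ≠ 0 → A.mate k ≤ M.E
  mate_key : ∀ k, A.mate k ≠ 0 → M.key (A.mate k - 1) = k
  mate_own : ∀ k, A.mate k ≠ 0 → A.own (M.slot (A.mate k - 1)) = k + 1
  mate_price : ∀ k, A.mate k ≠ 0 → A.price (M.slot (A.mate k - 1)) = A.lab k + 1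
  mate_lab : ∀ k, A.mate k ≠ 0 → A.lab k < N
  own_mate : ∀ x, A.own x ≠ 0 → A.mate (A.own x - 1) ≠ 0
  own_slot : ∀ x, A.own x ≠ 0 → M.slot (A.mate (A.own x - 1) - 1) = x
  price_own : ∀ x, A.price x ≠ 0 → A.own x ≠ 0
  lab_le : ∀ k, A.lab k ≤ N
  done : ∀ k, k ≤ A.b → k ≠ A.K → A.mate k ≠ 0 ∨ N ≤ A.lab k
  mate_K : A.mate A.K = 0
  mate_fresh : ∀ k, A.b < k → A.mate k = 0
  lab_K : A.lab A.K < N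
  lab_fresh : ∀ k, A.b < k → A.lab k = 0
  K_le : A.K ≤ A.b
  b_le : A.b ≤ M.n

/-- The number of units of work done so far. -/
def Auction.work (M : Market) (A : Auction) : ℕ :=
  ∑ e ∈ Finset.range M.E, (A.lab (M.key e) + if A.cur (M.key e) ≤ e then 1 else 0) +
    ∑ k ∈ Finset.range M.n, A.lab k + ∑ x ∈ Finset.range (2 * M.n), A.price x + A.b

variable {M : Market} {N : ℕ} {A : Auction}

/-- A positive price belongs to an owned item, and it exceeds the label of the owner by one; the
label of an assigned bidder is below `N`. -/
theorem Auction.Inv.price_le (h : A.Inv M N) (x : ℕ) : A.price x ≤ N := by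
  by_cases hx : A.price x = 0
  · omega
  · have h₀ := h.price_own x hx
    have h₁ := h.own_mate x h₀
    have h₂ := h.mate_price _ h₁
    have h₃ := h.mate_lab _ h₁
    rw [h.own_slot x h₀] at h₂
    omega

theorem Auction.Inv.work_le (h : A.Inv M N) :
    A.work M ≤ M.E * (N + 1) + M.n * N + 2 * M.n * N + M.n := by
  refine Nat.add_le_add (Nat.add_le_add (Nat.add_le_add ?_ ?_) ?_) h.b_le
  · refine (Finset.sum_le_card_nsmul _ _ (N + 1) fun e _ => ?_).trans (by simp)
    exact Nat.add_le_add (h.lab_le _) (by split_ifs <;> omega)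
  · exact (Finset.sum_le_card_nsmul _ _ N fun k _ => h.lab_le k).trans (by simp)
  · exact (Finset.sum_le_card_nsmul _ _ N fun x _ => h.price_le x).trans (by simp)

/-- The active bidder has inspected all its entries: raise its label. -/
def Auction.raise (M : Market) (N : ℕ) (A : Auction) : Auction :=
  { A with
    lab := update A.lab A.K (A.lab A.K + 1)
    cur := update A.cur A.K (M.head A.K)
    K := if N ≤ A.lab A.K + 1 then A.b + 1 else A.K
    b := if N ≤ A.lab A.K + 1 then A.b + 1 else A.b }

/-- The active bidder takes an item. -/
def Auction.take (M : Market) (A : Auction) : Auction :=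
  { A with
    price := update A.price (M.slot (A.cur A.K - 1)) (A.lab A.K + 1)
    own := update A.own (M.slot (A.cur A.K - 1)) (A.K + 1)
    mate := if A.own (M.slot (A.cur A.K - 1)) = 0 then update A.mate A.K (A.cur A.K) else
      update (update A.mate A.K (A.cur A.K)) (A.own (M.slot (A.cur A.K - 1)) - 1) 0
    K := if A.own (M.slot (A.cur A.K - 1)) = 0 then A.b + 1
      else A.own (M.slot (A.cur A.K - 1)) - 1
    b := if A.own (M.slot (A.cur A.K - 1)) = 0 then A.b + 1 else A.b }

/-- The active bidder proceeds to its next entry. -/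
def Auction.advance (M : Market) (A : Auction) : Auction :=
  { A with cur := update A.cur A.K (M.next (A.cur A.K - 1)) }

/-- A pointer 0 means that every entry of the bidder has been passed, so all its prices strictly
exceed its label and the label may rise by one. Resetting the pointer to the head makes the
condition on passed entries vacuous. In the work, the new unit of label replaces the lost "passed"
mark of each entry, and the sum of the labels grows. -/
theorem Auction.Inv.raise (h : A.Inv M N) (hb : A.b < M.n) (hc : A.cur A.K = 0) :
    (A.raise M N).Inv M N ∧ A.work M < (A.raise M N).work M := by
  have hK := h.K_le
  have hlab := h.lab_K
  have hN : 0 < N := by omega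
  constructor
  · have hpass : ∀ e < M.E, M.key e = A.K → A.lab A.K < A.price (M.slot e) := by
      intro e he hek
      have := h.passed e he (by rw [hek, hc]; omega)
      rwa [hek] at this
    constructor <;> simp only [Auction.raise]
    · intro e he
      rw [update_apply]
      split_ifs with hk
      · exact hpass e he hk
      · exact h.low e he
    · intro e he
      rw [update_apply, update_apply]
      split_ifs with hk
      · intro h₁
        exact absurd hk ((M.isLast_head A.K).ne e h₁ he)
      · exact h.passed e he
    · intro k
      rw [update_apply]
      split_ifs with hk
      · exact (M.isLast_head A.K).le
      · exact h.cur_le k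
    · intro k
      rw [update_apply]
      split_ifs with hk
      · intro h₀
        rw [hk]
        exact (M.isLast_head A.K).key_eq.resolve_left h₀
      · exact h.cur_key k
    · exact h.mate_le
    · exact h.mate_key
    · exact h.mate_own
    · intro k hk
      rw [update_of_ne (by rintro rfl; exact hk h.mate_K)]
      exact h.mate_price k hk
    · intro k hk
      rw [update_of_ne (by rintro rfl; exact hk h.mate_K)]
      exact h.mate_lab k hk
    · exact h.own_mate
    · exact h.own_slot
    · exact h.price_own
    · intro k
      rw [update_apply]
      split_ifs with hk
      · omega
      · exact h.lab_le k
    · intro k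
      rw [update_apply]
      split_ifs with h₁ h₂ h₂
      · exact fun _ _ => .inr h₁
      · exact fun h₃ h₄ => h.done k (by omega) h₂
      · exact fun _ h₃ => absurd h₂ h₃
      · exact fun h₃ h₄ => h.done k h₃ h₂
    · split_ifs
      · exact h.mate_fresh _ (by omega)
      · exact h.mate_K
    · intro k hk
      refine h.mate_fresh k ?_
      split_ifs at hk <;> omega
    · split_ifs with h₁
      · rw [update_of_ne (by omega), h.lab_fresh _ (by omega)]
        exact hN
      · rw [update_self]
        omega
    · intro k hk
      have hk' : A.b < k := by split_ifs at hk <;> omega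
      rw [update_of_ne (by omega), h.lab_fresh _ hk']
    · split_ifs <;> omega
    · split_ifs <;> omega
  · unfold Auction.work
    have h₁ : ∑ e ∈ Finset.range M.E, (A.lab (M.key e) + if A.cur (M.key e) ≤ e then 1 else 0) ≤
        ∑ e ∈ Finset.range M.E, ((A.raise M N).lab (M.key e) +
          if (A.raise M N).cur (M.key e) ≤ e then 1 else 0) := by
      refine Finset.sum_le_sum fun e _ => ?_
      show _ ≤ update A.lab A.K (A.lab A.K + 1) (M.key e) +
          if update A.cur A.K (M.head A.K) (M.key e) ≤ e then 1 else 0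
      by_cases hk : M.key e = A.K
      · rw [hk, update_self, hc, if_pos (Nat.zero_le _)]
        exact Nat.le_add_right _ _
      · rw [update_of_ne hk, update_of_ne hk]
    have h₂ : ∑ k ∈ Finset.range M.n, A.lab k <
        ∑ k ∈ Finset.range M.n, (A.raise M N).lab k := by
      simp only [Auction.raise]
      refine Finset.sum_lt_sum (fun k _ => ?_) ⟨A.K, Finset.mem_range.2 (by omega), ?_⟩
      · rw [update_apply]
        split_ifs with hk
        · rw [hk]; omega
        · rfl
      · rw [update_self]; omega
    have h₃ : A.b ≤ (A.raise M N).b := by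
      simp only [Auction.raise]
      split_ifs <;> omega
    have h₄ : (A.raise M N).price = A.price := rfl
    rw [h₄]
    omega

/-- The bidder has no entry strictly between its next and its current one, so the current entry is
the only one newly passed, and its price is too high. This one mark is the gain in work. -/
theorem Auction.Inv.advance (h : A.Inv M N) (hc : A.cur A.K ≠ 0)
    (hp : A.lab A.K < A.price (M.slot (A.cur A.K - 1))) :
    (A.advance M).Inv M N ∧ A.work M < (A.advance M).work M := by
  have hcE : A.cur A.K - 1 < M.E := by have := h.cur_le A.K; omega
  have hkey := h.cur_key _ hc
  have hlast := M.isLast_next _ hcE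
  rw [hkey] at hlast
  constructor
  · constructor <;> simp only [Auction.advance]
    · exact h.low
    · intro e he
      rw [update_apply]
      split_ifs with hk
      · intro h₁
        rcases lt_trichotomy e (A.cur A.K - 1) with h₂ | rfl | h₂
        · exact absurd hk (hlast.ne e h₁ h₂)
        · rwa [hkey]
        · exact h.passed e he (by rw [hk]; omega)
      · exact h.passed e he
    · intro k
      rw [update_apply]
      split_ifs with hk
      · have := hlast.le
        omega
      · exact h.cur_le k
    · intro k
      rw [update_apply]
      split_ifs with hk
      · intro h₀
        rw [hk]
        exact hlast.key_eq.resolve_left h₀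
      · exact h.cur_key k
    · exact h.mate_le
    · exact h.mate_key
    · exact h.mate_own
    · exact h.mate_price
    · exact h.mate_lab
    · exact h.own_mate
    · exact h.own_slot
    · exact h.price_own
    · exact h.lab_le
    · exact h.done
    · exact h.mate_K
    · exact h.mate_fresh
    · exact h.lab_K
    · exact h.lab_fresh
    · exact h.K_le
    · exact h.b_le
  · unfold Auction.work
    have h₁ : ∑ e ∈ Finset.range M.E, (A.lab (M.key e) + if A.cur (M.key e) ≤ e then 1 else 0) <
        ∑ e ∈ Finset.range M.E, ((A.advance M).lab (M.key e) +
          if (A.advance M).cur (M.key e) ≤ e then 1 else 0) := by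
      show _ < ∑ e ∈ Finset.range M.E, (A.lab (M.key e) +
          if update A.cur A.K (M.next (A.cur A.K - 1)) (M.key e) ≤ e then 1 else 0)
      refine Finset.sum_lt_sum (fun e _ => ?_)
        ⟨A.cur A.K - 1, Finset.mem_range.2 hcE, ?_⟩
      · rw [update_apply]
        have := hlast.le
        split_ifs with h₁ h₂ h₃ h₄ h₅ <;> first | omega | (rw [h₂] at h₁; omega)
      · rw [hkey, update_self, if_pos hlast.le, if_neg (by omega)]
        omega
    have h₂ : (A.advance M).price = A.price := rfl
    have h₃ : (A.advance M).lab = A.lab := rfl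
    have h₄ : (A.advance M).b = A.b := rfl
    rw [h₃] at h₁ ⊢
    rw [h₂, h₄]
    omega

/-- Prices only increase, so all lower bounds survive. The taken item gets the price that the
invariant demands of its new owner, and the sum of the prices strictly grows. An ejected owner
becomes active with its label still below `N`; if there was none, a fresh bidder enters. -/
theorem Auction.Inv.take (h : A.Inv M N) (hb : A.b < M.n) (hc : A.cur A.K ≠ 0)
    (hp : A.price (M.slot (A.cur A.K - 1)) ≤ A.lab A.K) :
    (A.take M).Inv M N ∧ A.work M < (A.take M).work M := by
  have hcE : A.cur A.K - 1 < M.E := by have := h.cur_le A.K; omega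
  have hkey := h.cur_key _ hc
  have hK := h.K_le
  set x := M.slot (A.cur A.K - 1) with hx
  -- Afterwards an assigned bidder is either the active one with its new entry, or an old one whose
  -- item differs from `x`.
  have hmate : ∀ k, (A.take M).mate k ≠ 0 →
      k = A.K ∧ (A.take M).mate k = A.cur A.K ∨
      k ≠ A.K ∧ A.mate k ≠ 0 ∧ (A.take M).mate k = A.mate k ∧ M.slot (A.mate k - 1) ≠ x := by
    intro k
    simp only [Auction.take, ← hx]
    by_cases ho : A.own x = 0
    · rw [if_pos ho, update_apply]
      split_ifs with hk
      · exact fun _ => .inl ⟨hk, rfl⟩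
      · intro h₁
        refine .inr ⟨hk, h₁, rfl, fun h₂ => ?_⟩
        have := h.mate_own k h₁
        rw [h₂] at this
        omega
    · rw [if_neg ho, update_apply]
      split_ifs with h₁
      · exact fun h₀ => absurd rfl h₀
      · rw [update_apply]
        split_ifs with hk
        · exact fun _ => .inl ⟨hk, rfl⟩
        · intro h₂
          refine .inr ⟨hk, h₂, rfl, fun h₃ => h₁ ?_⟩
          have := h.mate_own k h₂
          rw [h₃] at this
          omega
  have hmateK : (A.take M).mate A.K = A.cur A.K := by
    simp only [Auction.take, ← hx]
    split_ifs with ho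
    · exact update_self ..
    · rw [update_of_ne, update_self]
      intro h₁
      exact h.own_mate x ho (h₁ ▸ h.mate_K)
  have hmate' : ∀ k, A.mate k ≠ 0 → M.slot (A.mate k - 1) ≠ x →
      (A.take M).mate k = A.mate k := by
    intro k h₀ h₁
    have hk : k ≠ A.K := fun hk => h₀ (hk ▸ h.mate_K)
    simp only [Auction.take, ← hx]
    split_ifs with ho
    · exact update_of_ne hk ..
    · rw [update_of_ne, update_of_ne hk]
      rintro rfl
      exact h₁ (h.own_slot x ho)
  have hpr : ∀ y, A.price y ≤ (A.take M).price y := by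
    intro y
    simp only [Auction.take, ← hx]
    rw [update_apply]
    split_ifs with hy
    · rw [hy]; omega
    · rfl
  have hfresh : ∀ k, A.b < k → (A.take M).mate k = 0 := by
    intro k hk
    by_contra h₀
    rcases hmate k h₀ with ⟨h₁, -⟩ | ⟨-, h₁, -⟩
    · omega
    · exact h₁ (h.mate_fresh k hk)
  constructor
  · constructor
    · exact fun e he => (h.low e he).trans (hpr _)
    · exact fun e he h₁ => (h.passed e he h₁).trans_le (hpr _)
    · exact h.cur_le
    · exact h.cur_key
    · intro k hk
      rcases hmate k hk with ⟨-, h₁⟩ | ⟨-, h₁, h₂, -⟩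
      · rw [h₁]
        exact h.cur_le _
      · rw [h₂]
        exact h.mate_le k h₁
    · intro k hk
      rcases hmate k hk with ⟨h₀, h₁⟩ | ⟨-, h₁, h₂, -⟩
      · rw [h₁, hkey, h₀]
      · rw [h₂]
        exact h.mate_key k h₁
    · intro k hk
      rcases hmate k hk with ⟨h₀, h₁⟩ | ⟨-, h₁, h₂, h₃⟩
      · rw [h₁, h₀]
        simp only [Auction.take, ← hx, update_self]
      · rw [h₂]
        simp only [Auction.take, ← hx, update_of_ne h₃]
        exact h.mate_own k h₁
    · intro k hk
      rcases hmate k hk with ⟨h₀, h₁⟩ | ⟨-, h₁, h₂, h₃⟩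
      · rw [h₁, h₀]
        simp only [Auction.take, ← hx, update_self]
      · rw [h₂]
        simp only [Auction.take, ← hx, update_of_ne h₃]
        exact h.mate_price k h₁
    · intro k hk
      rcases hmate k hk with ⟨h₀, h₁⟩ | ⟨-, h₁, h₂, h₃⟩
      · rw [h₀]
        exact h.lab_K
      · exact h.mate_lab k h₁
    · intro y hy
      by_cases hyx : y = x
      · have : (A.take M).own y = A.K + 1 := by simp only [Auction.take, ← hx, hyx, update_self]
        rw [this, Nat.add_sub_cancel, hmateK]
        exact hc
      · have : (A.take M).own y = A.own y := by simp only [Auction.take, ← hx, update_of_ne hyx]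
        rw [this] at hy ⊢
        rw [hmate' _ (h.own_mate y hy) (by rwa [h.own_slot y hy])]
        exact h.own_mate y hy
    · intro y hy
      by_cases hyx : y = x
      · have : (A.take M).own y = A.K + 1 := by simp only [Auction.take, ← hx, hyx, update_self]
        rw [this, Nat.add_sub_cancel, hmateK, hyx]
      · have : (A.take M).own y = A.own y := by simp only [Auction.take, ← hx, update_of_ne hyx]
        rw [this] at hy ⊢
        rw [hmate' _ (h.own_mate y hy) (by rwa [h.own_slot y hy])]
        exact h.own_slot y hy
    · intro y
      simp only [Auction.take, ← hx]
      rw [update_apply, update_apply]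
      split_ifs
      · omega
      · exact h.price_own y
    · exact h.lab_le
    · intro k hk hkK
      by_cases h₀ : k = A.K
      · rw [h₀, hmateK]
        exact .inl hc
      · by_cases ho : A.own x = 0
        · simp only [Auction.take, ← hx, if_pos ho] at hk hkK ⊢
          rw [update_of_ne h₀]
          exact h.done k (by omega) h₀
        · simp only [Auction.take, ← hx, if_neg ho] at hk hkK ⊢
          rw [update_of_ne hkK, update_of_ne h₀]
          exact h.done k hk h₀
    · by_cases ho : A.own x = 0
      · refine hfresh _ ?_
        simp only [Auction.take, ← hx, if_pos ho]
        omega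
      · simp only [Auction.take, ← hx, if_neg ho, update_self]
    · intro k hk
      refine hfresh k (lt_of_le_of_lt ?_ hk)
      simp only [Auction.take]
      split_ifs <;> omega
    · simp only [Auction.take, ← hx]
      split_ifs with ho
      · rw [h.lab_fresh _ (by omega)]
        have := h.lab_K
        omega
      · exact h.mate_lab _ (h.own_mate x ho)
    · intro k hk
      refine h.lab_fresh k (lt_of_le_of_lt ?_ hk)
      simp only [Auction.take]
      split_ifs <;> omega
    · simp only [Auction.take, ← hx]
      split_ifs with ho
      · rfl
      -- The ejected owner was assigned, so it cannot be a bidder that has not yet entered.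
      · by_contra h₁
        exact h.own_mate x ho (h.mate_fresh _ (by omega))
    · simp only [Auction.take]
      split_ifs
      · omega
      · omega
  · have h₂ : ∑ y ∈ Finset.range (2 * M.n), A.price y <
        ∑ y ∈ Finset.range (2 * M.n), (A.take M).price y := by
      refine Finset.sum_lt_sum (fun y _ => hpr y) ⟨x, Finset.mem_range.2 (M.slot_lt _ hcE), ?_⟩
      simp only [Auction.take, ← hx, update_self]
      omega
    have h₃ : A.b ≤ (A.take M).b := by
      simp only [Auction.take]
      split_ifs <;> omega
    have h₄ : (A.take M).lab = A.lab := rfl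
    have h₅ : (A.take M).cur = A.cur := rfl
    simp only [Auction.work, h₄, h₅]
    omega

/-- One step of the auction. -/
def Auction.next (M : Market) (N : ℕ) (A : Auction) : Auction :=
  if A.cur A.K = 0 then A.raise M N
  else if A.price (M.slot (A.cur A.K - 1)) ≤ A.lab A.K then A.take M
  else A.advance M

theorem Auction.Inv.next (h : A.Inv M N) (hb : A.b < M.n) :
    (A.next M N).Inv M N ∧ A.work M < (A.next M N).work M := by
  unfold Auction.next
  split_ifs with h₁ h₂
  · exact h.raise hb h₁
  · exact h.take hb h₁ h₂
  · exact h.advance h₁ (by omega)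

theorem Auction.Inv.init (hN : 0 < N) {A : Auction} (hcur : A.cur = M.head) (hlab : A.lab = 0)
    (hprice : A.price = 0) (hown : A.own = 0) (hmate : A.mate = 0) (hK : A.K = 0) (hb : A.b = 0) :
    A.Inv M N := by
  constructor <;> simp only [hcur, hlab, hprice, hown, hmate, hK, hb, Pi.zero_apply, ne_eq,
    not_true, false_imp_iff, implies_true, le_refl, Nat.zero_le, hN]
  · intro e he h₁
    exact absurd rfl ((M.isLast_head (M.key e)).ne e h₁ he)
  · exact fun k => (M.isLast_head k).le
  · exact fun k hk => (M.isLast_head k).key_eq.resolve_left hk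
  · intro k h₁ h₂
    omega

/-- The certificate for optimality at the end of the auction: a set of bidders whose items are all
owned by bidders of this set, and that contains all bidders that have no item. -/
theorem Auction.Inv.certificate (h : A.Inv M (min M.n M.E + 1)) (hb : A.b = M.n)
    (hK : A.K = M.n) :
    ∃ g : ℕ, (∀ k < M.n, A.mate k = 0 → g ≤ A.lab k) ∧
      ∀ e < M.E, g ≤ A.lab (M.key e) →
        A.own (M.slot e) ≠ 0 ∧ g ≤ A.lab (A.own (M.slot e) - 1) := by
  set N := min M.n M.E + 1 with hN
  have hlt : ∀ k, A.mate k ≠ 0 → k < M.n := fun k hk => by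
    rw [← h.mate_key k hk]
    exact M.key_lt _ (by have := h.mate_le k hk; omega)
  set S := (Finset.range M.n).filter (fun k => A.mate k ≠ 0) with hS
  -- Distinct assigned bidders hold distinct entries, so their number is at most both `M.n` and
  -- `M.E`.
  have hcard : S.card < N := by
    have h₁ : S.card ≤ M.n := (Finset.card_filter_le _ _).trans (by simp)
    have h₂ : S.card ≤ M.E := by
      refine (Finset.card_le_card_of_injOn (t := Finset.range M.E) (fun k => A.mate k - 1) ?_
        ?_).trans (by simp)
      · intro k hk
        have hk' := (Finset.mem_filter.1 hk).2
        have := h.mate_le k hk'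
        simp only [Finset.coe_range, Set.mem_Iio]
        omega
      · intro k hk k' hk' heq
        have h₃ := h.mate_key k (Finset.mem_filter.1 hk).2
        have h₄ := h.mate_key k' (Finset.mem_filter.1 hk').2
        simp only at heq
        rw [← h₃, ← h₄, heq]
    omega
  -- Pigeonhole: there are `N` candidates for the level and fewer than `N` assigned bidders, so some
  -- level is not a label of an assigned bidder plus one.
  obtain ⟨g, hg, hgS⟩ : ∃ g ∈ Finset.Icc 1 N, g ∉ S.image (fun k => A.lab k + 1) := by
    by_contra! hcon
    have h₁ := Finset.card_le_card (fun g hg => hcon g hg : Finset.Icc 1 N ⊆ _)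
    have h₂ := Finset.card_image_le (s := S) (f := fun k => A.lab k + 1)
    rw [Nat.card_Icc] at h₁
    omega
  rw [Finset.mem_Icc] at hg
  refine ⟨g, fun k hk h₀ => ?_, fun e he hge => ?_⟩
  · rcases h.done k (by omega) (by omega) with h₁ | h₁
    · exact absurd h₀ h₁
    · omega
  -- The price is at least `g`, hence positive, and the item is owned. The label of the owner is the
  -- price minus one, so at least `g - 1`, and the choice of `g` excludes equality.
  · have h₁ := h.low e he
    have h₂ := h.price_own (M.slot e) (by omega)
    have h₃ := h.own_mate _ h₂
    have h₄ := h.mate_price _ h₃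
    rw [h.own_slot _ h₂] at h₄
    refine ⟨h₂, ?_⟩
    by_contra hcon
    refine hgS (Finset.mem_image.2 ⟨A.own (M.slot e) - 1, ?_, by omega⟩)
    exact Finset.mem_filter.2 ⟨Finset.mem_range.2 (hlt _ h₃), h₃⟩

end CoverRAM

/-! ### The auction program -/

namespace CoverRAM

open PathCover Function

variable {B L n : ℕ} {eG eH : List (Fin n × Fin n)} {U : Set (Fin n)}

/-- The auction described by a state. -/
def St.auction (s : St) : Auction :=
  ⟨s.a .cur, s.a .lab, s.a .price, s.a .own, s.a .mate, s.v .K, s.v .b⟩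

/-- The state `s` stores the market `M`. -/
structure Stores (M : Market) (s : St) : Prop where
  slot : s.a .slot = M.slot
  head : s.a .head = M.head
  next : s.a .next = M.next

theorem wp_auctionStep {M : Market} {s : St} (hz : s.v .zero = 0) (hM : Stores M s) :
    Cmd.auctionStep.wp B L s fun s' => s'.auction = s.auction.next M (s.v .N) := by
  simp only [Cmd.auctionStep, Cmd.nextBidder, Cmd.wp, Op.Ok, Op.eval, Cond.Holds, true_and,
    St.setV_v, St.setA_v, St.setA_a, St.setV_a, if_true, reduceCtorEq, if_false, hz, hM.slot,
    hM.head, hM.next]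
  refine ⟨fun h => ⟨fun h1 => ?_, fun h1 => ?_⟩, fun h => ⟨fun h1 => ⟨fun h2 => ?_, fun h2 => ?_⟩,
    fun h1 => ?_⟩⟩
  · have e : s.auction.next M (s.v .N) = s.auction.raise M (s.v .N) := if_pos h
    rw [e]
    ext <;> simp [St.auction, Auction.raise, h1]
  · have e : s.auction.next M (s.v .N) = s.auction.raise M (s.v .N) := if_pos h
    rw [e]
    ext <;> simp [St.auction, Auction.raise, h1]
  · have e : s.auction.next M (s.v .N) = s.auction.take M := by
      exact (if_neg h).trans (if_pos h1)
    rw [e]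
    ext <;> simp [St.auction, Auction.take, h2]
  · have e : s.auction.next M (s.v .N) = s.auction.take M := by
      exact (if_neg h).trans (if_pos h1)
    rw [e]
    ext <;> simp [St.auction, Auction.take, h2]
  · have e : s.auction.next M (s.v .N) = s.auction.advance M := by
      exact (if_neg h).trans (if_neg h1)
    rw [e]
    ext <;> simp [St.auction, Auction.advance]

/-- Whenever the counter advances, the new bidder becomes active. So at the end the active bidder is
the nonexistent bidder `M.n`, and every real bidder is assigned or has given up. -/
theorem Auction.next_K (M : Market) (N : ℕ) (A : Auction) :
    (A.next M N).b = A.b ∨ (A.next M N).K = (A.next M N).b := by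
  unfold Auction.next Auction.raise Auction.take Auction.advance
  split_ifs <;> simp

theorem ev_auction {s : St} (hp : Params eG U eH s) {M : Market} (hM : Stores M s) (hn : M.n = n)
    (hE : M.E = s.v .E) (hcur : s.a .cur = s.a .head)
    (h₀ : ∀ A ∈ [Arr.lab, .price, .own, .mate], ∀ i, s.a A i = 0) :
    Ev B L .auction s
      (100 * (M.E * (min n M.E + 2) + 3 * n * (min n M.E + 1) + n) + 50) fun s' =>
      s'.auction.Inv M (min M.n M.E + 1) ∧ s'.auction.b = M.n ∧ s'.auction.K = M.n := by
  simp only [List.forall_mem_cons, List.not_mem_nil, false_imp_iff, implies_true, and_true] at h₀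
  obtain ⟨hlab, hprice, hown, hmate⟩ := h₀
  refine (Ev.seq (t₁ := 30) (Q := fun s' => s'.v .N = min n M.E + 1 ∧ s'.v .b = 0 ∧ s'.v .K = 0 ∧
    s'.a = s.a) (Ev.of_wp ?_ (by decide)) (t₂ := (95 + 5) * (M.E * (min n M.E + 2) +
      3 * n * (min n M.E + 1) + n) + 5) fun s₁ hf₁ hs₁ => ?_).mono (by omega) fun _ _ h => h
  · simp only [Cmd.initAuction, Cmd.wp, Op.Ok, Op.eval, Cond.Holds, true_and, St.setV_v,
      St.setV_a, if_true, reduceCtorEq, if_false, hp.hn, ← hE, Nat.zero_le, and_true]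
    exact ⟨fun h => by rw [min_eq_right h], fun h => by rw [min_eq_left (by omega)]⟩
  · obtain ⟨hN, hb, hK, ha⟩ := hs₁
    have hp₁ : Params eG U eH s₁ := hp.frame hf₁ (by decide)
    have hM₁ : Stores M s₁ := by
      constructor <;> rw [ha]
      exacts [hM.slot, hM.head, hM.next]
    -- The variant is the upper bound on the work minus the work already done.
    refine (Ev.loop (fun s' => s'.auction.Inv M (min M.n M.E + 1) ∧
        (s'.auction.b = M.n → s'.auction.K = M.n))
      (fun s' => (M.E * (min n M.E + 2) + 3 * n * (min n M.E + 1) + n) - s'.auction.work M) 95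
      ⟨?_, ?_⟩ ?_).mono (by gcongr; omega) ?_
    · refine Auction.Inv.init (by omega) ?_ ?_ ?_ ?_ ?_ hK hb
      · show s₁.a .cur = _
        rw [ha, hcur, hM.head]
      · exact funext fun i => (congrFun (congrFun ha .lab) i).trans (hlab i)
      · exact funext fun i => (congrFun (congrFun ha .price) i).trans (hprice i)
      · exact funext fun i => (congrFun (congrFun ha .own) i).trans (hown i)
      · exact funext fun i => (congrFun (congrFun ha .mate) i).trans (hmate i)
    · intro h
      rw [← h]
      exact hK.trans hb.symm
    · rintro s' hf' ⟨hI, hK'⟩ hb'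
      have hp' := hp₁.frame hf' (by decide)
      have hM' : Stores M s' := by
        constructor
        · rw [hf'.a _ (by decide), hM₁.slot]
        · rw [hf'.a _ (by decide), hM₁.head]
        · rw [hf'.a _ (by decide), hM₁.next]
      have hN' : s'.v .N = min M.n M.E + 1 := by rw [hf'.v _ (by decide), hN, hn]
      simp only [Cond.Holds, hp'.hn] at hb'
      have hb'' : s'.auction.b < M.n := by rw [hn]; exact hb'
      refine Ev.of_wp (Cmd.wp_mono (wp_auctionStep hp'.zero hM') fun s'' _ hs'' => ?_) (by decide)
      rw [hN'] at hs''
      obtain ⟨h₁, h₂⟩ := hI.next hb''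
      rw [← hs''] at h₁ h₂
      have h₃ := h₁.work_le
      refine ⟨⟨h₁, fun h => ?_⟩, ?_⟩
      · have := s'.auction.next_K M (min M.n M.E + 1)
        rw [← hs''] at this
        omega
      · have e : M.E * (min M.n M.E + 1 + 1) + M.n * (min M.n M.E + 1) +
            2 * M.n * (min M.n M.E + 1) + M.n =
            M.E * (min n M.E + 2) + 3 * n * (min n M.E + 1) + n := by rw [hn]; ring
        omega
    · rintro s' hf' ⟨⟨hI, hK'⟩, hb'⟩
      have hp' := hp₁.frame hf' (by decide)
      simp only [Cond.Holds, hp'.hn] at hb'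
      have : s'.auction.b = M.n := by
        have h₁ := hI.b_le
        have h₂ : s'.auction.b = s'.v .b := rfl
        omega
      exact ⟨hI, this, hK' this⟩

end CoverRAM

/-! ### Dropping superfluous edges -/

namespace CoverRAM

open PathCover Function

variable {B L n : ℕ} {eG eH : List (Fin n × Fin n)} {U : Set (Fin n)}

/-! ### Pruning a set of elements with parents. -/

section Pruning

variable {par : ℕ → ℕ} {T S : Finset ℕ} {k : ℕ}

/-- The elements of `S` whose parents are `q`. -/
def children (par : ℕ → ℕ) (S : Finset ℕ) (q : ℕ) : Finset ℕ := S.filter fun k => par k = q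

theorem mem_children {q : ℕ} : k ∈ children par S q ↔ k ∈ S ∧ par k = q := Finset.mem_filter

/-- Every element of `T` belongs to `S` or is the parent of an element of `S`. -/
def Covers (par : ℕ → ℕ) (T S : Finset ℕ) : Prop := ∀ k ∈ T, k ∈ S ∨ (children par S k).Nonempty

/-- Remove `k` from `S`, and put its parent into `S` if this is necessary to cover `T`. -/
def pruneAt (par : ℕ → ℕ) (T S : Finset ℕ) (k : ℕ) : Finset ℕ :=
  if children par (S.erase k) (par k) = ∅ ∧ par k ∉ S ∧ par k ∈ T then
    insert (par k) (S.erase k) else S.erase k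

/-- The number of elements of `S` whose parents belong to `S`. -/
def links (par : ℕ → ℕ) (S : Finset ℕ) : ℕ := (S.filter fun k => par k ∈ S).card

/-- The element `k` of `S` is superfluous: it may be removed, and this brings progress. -/
def Superfluous (par : ℕ → ℕ) (S : Finset ℕ) (k : ℕ) : Prop :=
  2 ≤ (children par S k).card ∨ (1 ≤ (children par S k).card ∧ par k ∈ S)

/-- The removed element stays covered by a child, which differs from it because `par k ≠ k`. The
only other element that can lose its cover is its parent, and that is precisely when the parent is
put back. -/
theorem covers_pruneAt (h : Covers par T S) (hk : par k ≠ k)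
    (hs : (children par S k).Nonempty) : Covers par T (pruneAt par T S k) := by
  have hsub : S.erase k ⊆ pruneAt par T S k := by
    unfold pruneAt
    split_ifs
    · exact Finset.subset_insert _ _
    · exact subset_rfl
  have lift : ∀ {j l}, l ∈ S.erase k → par l = j → (children par (pruneAt par T S k) j).Nonempty :=
    fun hl hj => ⟨_, mem_children.2 ⟨hsub hl, hj⟩⟩
  intro j hj
  by_cases hjk : j = k
  · subst hjk
    obtain ⟨l, hl⟩ := hs
    rw [mem_children] at hl
    exact .inr (lift (Finset.mem_erase.2 ⟨by rintro rfl; exact hk hl.2, hl.1⟩) hl.2)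
  rcases h j hj with h₁ | ⟨l, hl⟩
  · exact .inl (hsub (Finset.mem_erase.2 ⟨hjk, h₁⟩))
  rw [mem_children] at hl
  by_cases hlk : l = k
  · subst hlk
    by_cases hjS : j ∈ S
    · exact .inl (hsub (Finset.mem_erase.2 ⟨hjk, hjS⟩))
    by_cases hc : children par (S.erase l) (par l) = ∅
    · left
      unfold pruneAt
      rw [hl.2] at hc ⊢
      rw [if_pos ⟨hc, hjS, hj⟩]
      exact Finset.mem_insert_self _ _
    · obtain ⟨i, hi⟩ := Finset.nonempty_iff_ne_empty.2 hc
      rw [mem_children] at hi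
      exact .inr (lift hi.1 (hi.2.trans hl.2))
  · exact .inr (lift (Finset.mem_erase.2 ⟨hlk, hl.1⟩) hl.2)

/-- Removing `k` destroys the links from all its children. If the parent is restored, it was not in
`S`, so superfluity means at least two children. The restored parent then has no children left, so
the only new link can be its own. -/
theorem links_pruneAt_lt (hkS : k ∈ S) (hs : Superfluous par S k) :
    links par (pruneAt par T S k) < links par S := by
  have hsub : children par S k ⊆ S.filter fun l => par l ∈ S := by
    intro l hl
    rw [mem_children] at hl
    exact Finset.mem_filter.2 ⟨hl.1, by rw [hl.2]; exact hkS⟩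
  have hcard := Finset.card_sdiff_add_card_eq_card hsub
  unfold pruneAt links
  split_ifs with hc
  · have h2 : 2 ≤ (children par S k).card := hs.resolve_right fun h => hc.2.1 h.2
    have : ((insert (par k) (S.erase k)).filter fun l => par l ∈ insert (par k) (S.erase k)) ⊆
        insert (par k) ((S.filter fun l => par l ∈ S) \ children par S k) := by
      intro l hl
      simp only [Finset.mem_filter, Finset.mem_insert, Finset.mem_erase] at hl
      rw [Finset.mem_insert]
      rcases hl with ⟨h₁ | h₁, h₂⟩
      · exact .inl h₁
      · rcases h₂ with h₂ | h₂
        · exact absurd (mem_children.2 ⟨Finset.mem_erase.2 h₁, h₂⟩ :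
            l ∈ children par (S.erase k) (par k)) (by rw [hc.1]; simp)
        · exact .inr (Finset.mem_sdiff.2 ⟨Finset.mem_filter.2 ⟨h₁.2, h₂.2⟩,
            fun h => h₂.1 (mem_children.1 h).2⟩)
    have := (Finset.card_le_card this).trans (Finset.card_insert_le _ _)
    omega
  · have h1 : 1 ≤ (children par S k).card := by
      rcases hs with h | h
      · omega
      · exact h.1
    have : ((S.erase k).filter fun l => par l ∈ S.erase k) ⊆
        (S.filter fun l => par l ∈ S) \ children par S k := by
      intro l hl
      simp only [Finset.mem_filter, Finset.mem_erase] at hl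
      exact Finset.mem_sdiff.2 ⟨Finset.mem_filter.2 ⟨hl.1.2, hl.2.2⟩,
        fun h => hl.2.1 (mem_children.1 h).2⟩
    have := Finset.card_le_card this
    omega

end Pruning

/-- The state stores the set `S` of the components whose edges are kept. -/
structure Keeps (S : Finset ℕ) (s : St) : Prop where
  keep : ∀ k, s.a .keep k ≠ 0 ↔ k ∈ S
  cnt : ∀ k, s.a .cnt k = (children (s.a .par) S k).card

/-- The components that have been assigned an edge. -/
def assigned (n : ℕ) (mate : ℕ → ℕ) : Finset ℕ := (Finset.range n).filter fun k => mate k ≠ 0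

theorem mem_assigned {mate : ℕ → ℕ} {k : ℕ} : k ∈ assigned n mate ↔ k < n ∧ mate k ≠ 0 := by
  simp [assigned]

theorem ev_initKeep {s : St} (hp : Params eG U eH s)
    (h₀ : ∀ A ∈ [Arr.keep, .cnt], ∀ i, s.a A i = 0) :
    Ev B L .initKeep s (100 * n + 10) fun s' => Keeps (assigned n (s.a .mate)) s' ∧
      ∀ k ∈ assigned n (s.a .mate), s'.a .par k = s.a .comp (s.a .dst (s.a .mate k - 1)) := by
  simp only [List.forall_mem_cons, List.not_mem_nil, false_imp_iff, implies_true, and_true] at h₀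
  refine (Ev.seq (t₁ := 1) (Q := fun s' => s'.v .j = 0 ∧ s'.a = s.a)
    (t₂ := (100 * n + 5)) (Ev.of_wp (by simp [Cmd.wp, Op.Ok, Op.eval]) (by decide))
    fun s₁ hf₁ hs₁ => ?_).mono (by omega) fun _ _ h => h
  have hp₁ : Params eG U eH s₁ := hp.frame hf₁ (by decide)
  refine (Ev.loop (fun s' => s'.v .j ≤ n ∧ Keeps (assigned (s'.v .j) (s.a .mate)) s' ∧
      ∀ k ∈ assigned (s'.v .j) (s.a .mate),
        s'.a .par k = s.a .comp (s.a .dst (s.a .mate k - 1)))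
    (fun s' => n - s'.v .j) 95 ⟨by omega, ?_⟩ ?_).mono (by simp [hs₁.1]) ?_
  · rw [hs₁.1]
    refine ⟨⟨?_, ?_⟩, ?_⟩ <;> simp [hs₁.2, assigned, children, h₀.1, h₀.2]
  · rintro s' hf' ⟨hj, hk, hpar⟩ hb
    have hp' := hp₁.frame hf' (by decide)
    simp only [Cond.Holds, hp'.hn] at hb
    have e₁ : s'.a .mate = s.a .mate := by rw [hf'.a _ (by decide), hs₁.2]
    have e₂ : s'.a .dst = s.a .dst := by rw [hf'.a _ (by decide), hs₁.2]
    have e₃ : s'.a .comp = s.a .comp := by rw [hf'.a _ (by decide), hs₁.2]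
    refine Ev.of_wp ?_ (by decide)
    have hμ : n - (s'.v .j + 1) < n - s'.v .j := by omega
    simp only [Cmd.keepStep, Cmd.bump, Cmd.wp, Op.Ok, Op.eval, Cond.Holds, true_and, St.setV_v,
      St.setA_v, St.setA_a, St.setV_a, if_true, reduceCtorEq, if_false, hp'.zero, hp'.one, hμ,
      and_true, e₁, e₂, e₃]
    have hS : ∀ k, k ∈ assigned (s'.v .j + 1) (s.a .mate) ↔
        k ∈ assigned (s'.v .j) (s.a .mate) ∨ k = s'.v .j ∧ s.a .mate k ≠ 0 := by
      intro k
      rw [mem_assigned, mem_assigned, Nat.lt_succ_iff_lt_or_eq]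
      tauto
    refine ⟨fun h => ?_, fun h => ?_⟩
    · have hS' : assigned (s'.v .j + 1) (s.a .mate) = assigned (s'.v .j) (s.a .mate) := by
        ext k
        rw [hS]
        exact or_iff_left fun h' => h'.2 (h'.1 ▸ h)
      rw [hS']
      exact ⟨hb, ⟨hk.keep, hk.cnt⟩, hpar⟩
    · have hS' : assigned (s'.v .j + 1) (s.a .mate) =
          insert (s'.v .j) (assigned (s'.v .j) (s.a .mate)) := by
        ext k
        rw [hS, Finset.mem_insert, or_comm]
        exact or_congr_left ⟨And.left, fun h' => ⟨h', h' ▸ h⟩⟩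
      have hnot : s'.v .j ∉ assigned (s'.v .j) (s.a .mate) := by simp [assigned]
      rw [hS']
      refine ⟨hb, ⟨?_, ?_⟩, ?_⟩
      · intro k
        simp only [St.setV_a, St.setA_a, reduceCtorEq, if_false, if_true]
        rw [update_apply, Finset.mem_insert]
        split_ifs with h₁
        · simp [h₁]
        · rw [hk.keep]
          simp [h₁]
      · intro k
        simp only [St.setV_a, St.setA_a, reduceCtorEq, if_false, if_true]
        have hc : children (update (s'.a .par) (s'.v .j)
            (s.a .comp (s.a .dst (s.a .mate (s'.v .j) - 1))))
            (assigned (s'.v .j) (s.a .mate)) k =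
            children (s'.a .par) (assigned (s'.v .j) (s.a .mate)) k := by
          refine Finset.filter_congr fun l hl => ?_
          rw [update_of_ne (by rintro rfl; exact hnot hl)]
        rw [update_apply]
        simp only [children] at hc ⊢
        rw [Finset.filter_insert, update_self]
        split_ifs with h₁ h₂ h₂
        · rw [Finset.card_insert_of_notMem (fun h => hnot (Finset.mem_filter.1 h).1), hc, ← h₁]
          exact congrArg (· + 1) (hk.cnt k)
        · exact absurd h₁.symm h₂
        · exact absurd h₂.symm h₁
        · rw [hc]
          exact hk.cnt k
      · intro k hk'
        rw [update_apply]
        split_ifs with h₁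
        · rw [h₁]
        · exact hpar k ((Finset.mem_insert.1 hk').resolve_left h₁)
  · rintro s' hf' ⟨⟨h₁, h₂⟩, h₃⟩
    have hp' := hp₁.frame hf' (by decide)
    simp only [Cond.Holds, hp'.hn] at h₃
    rwa [show s'.v .j = n by omega] at h₂

theorem wp_drop {s : St} {S T : Finset ℕ} (hz : s.v .zero = 0) (ho : s.v .one = 1)
    (hS : Keeps S s) (hT : ∀ k ∈ S, s.a .par k < n) (hk : s.v .j ∈ S)
    (hpar : s.a .par (s.v .j) ≠ s.v .j) (hmate : ∀ k < n, s.a .mate k ≠ 0 ↔ k ∈ T) :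
    Cmd.drop.wp B L s fun s' => s'.v .j = 0 ∧ Keeps (pruneAt (s.a .par) T S (s.v .j)) s' := by
  set k := s.v .j with hkdef
  set q := s.a .par k with hq
  have hmate' := hmate q (hT k hk)
  -- The truncated decrement is exact, since `k` itself is a kept child of `q`.
  have hcnt : s.a .cnt q - 1 = (children (s.a .par) (S.erase k) q).card := by
    rw [hS.cnt]
    have : children (s.a .par) (S.erase k) q = (children (s.a .par) S q).erase k :=
      Finset.filter_erase ..
    rw [this, Finset.card_erase_of_mem (mem_children.2 ⟨hk, rfl⟩)]
  have hK : Keeps (S.erase k) ((s.setA .keep k 0).setA .cnt q (s.a .cnt q - 1)) := by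
    refine ⟨fun l => ?_, fun l => ?_⟩
    · simp only [St.setA_a, reduceCtorEq, if_false, if_true, Finset.mem_erase]
      rw [update_apply]
      split_ifs with h₁
      · simp [h₁]
      · rw [hS.keep]
        simp [h₁]
    · simp only [St.setA_a, reduceCtorEq, if_false, if_true]
      rw [update_apply]
      split_ifs with h₁
      · rw [hcnt, h₁]
      · rw [hS.cnt]
        congr 1
        ext i
        rw [mem_children, mem_children, Finset.mem_erase]
        constructor
        · rintro ⟨h₂, h₃⟩
          refine ⟨⟨?_, h₂⟩, h₃⟩
          rintro rfl
          exact h₁ h₃.symm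
        · rintro ⟨⟨-, h₂⟩, h₃⟩
          exact ⟨h₂, h₃⟩
  have hKeep : ∀ {S' : Finset ℕ} {s₁ s₂ : St}, Keeps S' s₁ → s₂.a .keep = s₁.a .keep →
      s₂.a .cnt = s₁.a .cnt → s₂.a .par = s₁.a .par → Keeps S' s₂ := by
    intro S' s₁ s₂ h e₁ e₂ e₃
    exact ⟨by rw [e₁]; exact h.keep, by rw [e₂, e₃]; exact h.cnt⟩
  simp only [Cmd.drop, Cmd.bump, Cmd.wp, Op.Ok, Op.eval, Cond.Holds, true_and, St.setV_v,
    St.setA_v, St.setA_a, St.setV_a, if_true, reduceCtorEq, if_false, hz, ho, Nat.zero_le,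
    ← hkdef, ← hq, update_of_ne hpar]
  refine ⟨fun h => ⟨fun h1 => ⟨fun h2 => ?_, fun h2 => ?_⟩, fun h1 => ?_⟩, fun h => ?_⟩
  · rw [pruneAt, if_neg (fun hc => absurd h2 (hmate'.2 hc.2.2))]
    exact hKeep hK (by simp) (by simp) (by simp)
  · have hqS : q ∉ S := fun h => (hS.keep q).2 h h1
    have hc : children (s.a .par) (S.erase k) q = ∅ := by
      rw [← Finset.card_eq_zero, ← hcnt]
      simpa using h
    rw [pruneAt, if_pos ⟨hc, hqS, hmate'.1 h2⟩]
    · refine ⟨fun l => ?_, fun l => ?_⟩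
      · have := hK.keep l
        simp only [St.setA_a, St.setV_a, reduceCtorEq, if_false, if_true] at this ⊢
        rw [update_apply, Finset.mem_insert]
        split_ifs with h₁
        · simp [h₁, ← hq]
        · rw [this]
          simp [h₁, ← hq]
      · have := hK.cnt l
        simp only [St.setA_a, St.setV_a, reduceCtorEq, if_false, if_true] at this ⊢
        rw [← hq, update_apply]
        unfold children at this ⊢
        rw [Finset.filter_insert]
        split_ifs with h₁ h₂ h₂
        · rw [Finset.card_insert_of_notMem (fun h => hqS
            (Finset.mem_of_mem_erase (Finset.mem_filter.1 h).1)), ← this, h₁]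
        · exact absurd h₁.symm h₂
        · exact absurd h₂.symm h₁
        · exact this
  · have hqS : q ∈ S := (hS.keep q).1 h1
    rw [pruneAt, if_neg (fun hc => hc.2.1 hqS)]
    exact hKeep hK (by simp) (by simp) (by simp)
  · rw [pruneAt, if_neg (fun hc => h ?_)]
    · exact hKeep hK (by simp) (by simp) (by simp)
    · rw [hcnt, hc.1]
      rfl

/-- A drop loses a link and restarts the scan, and a pass moves the scan on, so `links * (n + 1) +
(n - j)` decreases lexicographically. Initially there are at most `T.card` links. -/
theorem ev_prune {s : St} (hp : Params eG U eH s) {T : Finset ℕ} (hT : T = assigned n (s.a .mate))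
    (hS : Keeps T s) (hlt : ∀ k ∈ T, s.a .par k < n) (hne : ∀ k ∈ T, s.a .par k ≠ k) :
    Ev B L .prune s (120 * (T.card * (n + 1) + n) + 10) fun s' => ∃ S ⊆ T, Keeps S s' ∧
      Covers (s.a .par) T S ∧ ∀ k ∈ S, ¬ Superfluous (s.a .par) S k := by
  refine (Ev.seq (t₁ := 1) (Q := fun s' => s'.v .j = 0 ∧ s'.a = s.a)
    (t₂ := (115 + 5) * (T.card * (n + 1) + n) + 5)
    (Ev.of_wp (by simp [Cmd.wp, Op.Ok, Op.eval]) (by decide))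
    fun s₁ hf₁ hs₁ => ?_).mono (by omega) fun _ _ h => h
  have hp₁ : Params eG U eH s₁ := hp.frame hf₁ (by decide)
  classical
  -- The variant must be a function of the state, so the set of kept elements is recovered from the
  -- array.
  set kept : St → Finset ℕ := fun s' => T.filter fun k => s'.a .keep k ≠ 0 with hkept
  have kept_eq : ∀ {S s'}, S ⊆ T → Keeps S s' → kept s' = S := by
    intro S s' hST hK
    ext k
    rw [hkept, Finset.mem_filter, hK.keep]
    exact ⟨And.right, fun h => ⟨hST h, h⟩⟩
  refine (Ev.loop (fun s' => s'.v .j ≤ n ∧ ∃ S ⊆ T, Keeps S s' ∧ Covers (s.a .par) T S ∧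
      ∀ k ∈ S, k < s'.v .j → ¬ Superfluous (s.a .par) S k)
    (fun s' => links (s.a .par) (kept s') * (n + 1) + (n - s'.v .j)) 115
      ⟨by omega, T, subset_rfl, ⟨?_, ?_⟩, ?_, ?_⟩ ?_).mono ?_ ?_
  · rw [hs₁.2]; exact hS.keep
  · rw [hs₁.2]; exact hS.cnt
  · exact fun k hk => .inl hk
  · intro k hk h
    omega
  · rintro s' hf' ⟨hj, S, hST, hK, hC, hsup⟩ hb
    have hp' := hp₁.frame hf' (by decide)
    simp only [Cond.Holds, hp'.hn] at hb
    have e₁ : s'.a .mate = s.a .mate := by rw [hf'.a _ (by decide), hs₁.2]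
    have e₂ : s'.a .par = s.a .par := by rw [hf'.a _ (by decide), hs₁.2]
    rw [kept_eq hST hK]
    have pass : ¬ (s'.v .j ∈ S ∧ Superfluous (s.a .par) S (s'.v .j)) → ∀ s'', s''.a = s'.a →
        s''.v .j = s'.v .j + 1 → (s''.v .j ≤ n ∧ ∃ S ⊆ T, Keeps S s'' ∧ Covers (s.a .par) T S ∧
          ∀ k ∈ S, k < s''.v .j → ¬ Superfluous (s.a .par) S k) ∧
        links (s.a .par) (kept s'') * (n + 1) + (n - s''.v .j) <
          links (s.a .par) S * (n + 1) + (n - s'.v .j) := by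
      intro hns s'' ha hj''
      have hK'' : Keeps S s'' := ⟨by rw [ha]; exact hK.keep, by rw [ha]; exact hK.cnt⟩
      refine ⟨⟨by omega, S, hST, hK'', hC, fun k hk hkj => ?_⟩, ?_⟩
      · rcases Nat.lt_succ_iff_lt_or_eq.1 (hj'' ▸ hkj) with h | rfl
        · exact hsup k hk h
        · exact fun h => hns ⟨hk, h⟩
      · rw [kept_eq hST hK'']
        omega
    have dropped : s'.v .j ∈ S → Superfluous (s.a .par) S (s'.v .j) → ∀ s'' : St,
        s''.v .j = 0 ∧ Keeps (pruneAt (s.a .par) T S (s'.v .j)) s'' →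
        (s''.v .j ≤ n ∧ ∃ S ⊆ T, Keeps S s'' ∧ Covers (s.a .par) T S ∧
          ∀ k ∈ S, k < s''.v .j → ¬ Superfluous (s.a .par) S k) ∧
        links (s.a .par) (kept s'') * (n + 1) + (n - s''.v .j) <
          links (s.a .par) S * (n + 1) + (n - s'.v .j) := by
      rintro hjS hs s'' ⟨hj'', hK''⟩
      have hsub : pruneAt (s.a .par) T S (s'.v .j) ⊆ T := by
        unfold pruneAt
        split_ifs with h
        · exact Finset.insert_subset h.2.2 ((Finset.erase_subset _ _).trans hST)
        · exact (Finset.erase_subset _ _).trans hST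
      refine ⟨⟨by omega, _, hsub, hK'', covers_pruneAt hC (hne _ (hST hjS)) ?_, ?_⟩, ?_⟩
      · rw [← Finset.card_pos]
        rcases hs with h | h <;> omega
      · intro k _ h
        omega
      · rw [kept_eq hsub hK'', hj'']
        have := links_pruneAt_lt (T := T) hjS hs
        have h₁ : (links (s.a .par) (pruneAt (s.a .par) T S (s'.v .j)) + 1) * (n + 1) ≤
          links (s.a .par) S * (n + 1) := Nat.mul_le_mul_right _ this
        rw [add_mul, one_mul] at h₁
        omega
    suffices H : ∀ Q : St → Prop, (∀ s'' : St, ((s''.v .j ≤ n ∧ ∃ S ⊆ T, Keeps S s'' ∧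
        Covers (s.a .par) T S ∧ ∀ k ∈ S, k < s''.v .j → ¬ Superfluous (s.a .par) S k) ∧
        links (s.a .par) (kept s'') * (n + 1) + (n - s''.v .j) <
          links (s.a .par) S * (n + 1) + (n - s'.v .j)) → Q s'') → Cmd.pruneStep.wp B L s' Q from
      Ev.of_wp (H _ fun _ h => h) (by decide)
    intro Q hQ
    replace pass := fun hns s'' ha hj => hQ s'' (pass hns s'' ha hj)
    replace dropped := fun hjS hs s'' h => hQ s'' (dropped hjS hs s'' h)
    have drop : s'.v .j ∈ S → Superfluous (s.a .par) S (s'.v .j) → ∀ s'' : St, s''.a = s'.a →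
        (∀ x ∈ [Var.zero, .one, .j], s''.v x = s'.v x) → Cmd.drop.wp B L s'' Q := by
      intro hjS hs s'' ha hv
      simp only [List.forall_mem_cons, List.not_mem_nil, false_imp_iff, implies_true,
        and_true] at hv
      obtain ⟨v₁, v₂, v₃⟩ := hv
      have hK'' : Keeps S s'' := ⟨by rw [ha]; exact hK.keep, by rw [ha]; exact hK.cnt⟩
      have hpar : s''.a .par = s.a .par := by rw [ha, e₂]
      refine Cmd.wp_mono (wp_drop (n := n) (T := T) (by rw [v₁, hp'.zero]) (by rw [v₂, hp'.one])
        hK'' ?_ (by rw [v₃]; exact hjS) ?_ ?_) fun s₃ _ h₃ => dropped hjS hs s₃ ?_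
      · rw [hpar]
        exact fun k hk => hlt k (hST hk)
      · rw [hpar, v₃]
        exact hne _ (hST hjS)
      · intro k hk
        rw [ha, e₁, hT, mem_assigned]
        exact ⟨fun h => ⟨hk, h⟩, And.right⟩
      · rwa [hpar, v₃] at h₃
    have hcnt := hK.cnt (s'.v .j)
    rw [e₂] at hcnt
    simp only [Cmd.pruneStep, Cmd.wp, Op.Ok, Op.eval, Cond.Holds, true_and, St.setV_v, St.setV_a,
      if_true, reduceCtorEq, if_false, hp'.zero, Nat.reduceLeDiff, e₂]
    refine ⟨fun h => pass ?_ _ ?_ ?_, fun h => ⟨fun h1 => ?_, fun h1 => ⟨fun h2 =>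
      pass ?_ _ ?_ ?_, fun h2 => ⟨fun h3 => pass ?_ _ ?_ ?_, fun h3 => ?_⟩⟩⟩⟩
    · exact fun hc => (hK.keep _).2 hc.1 h
    · rfl
    · simp
    · exact drop ((hK.keep _).1 h) (.inl (by omega)) _ rfl (by simp)
    · rintro ⟨-, hc | hc⟩ <;> omega
    · rfl
    · simp
    · rintro ⟨-, hc | hc⟩
      · omega
      · exact (hK.keep _).2 hc.2 h3
    · rfl
    · simp
    · exact drop ((hK.keep _).1 h) (.inr ⟨by omega, (hK.keep _).1 h3⟩) _ rfl (by simp)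
  · refine Nat.add_le_add_right (Nat.mul_le_mul_left _ (Nat.add_le_add (Nat.mul_le_mul_right _ ?_)
      (Nat.sub_le _ _))) _
    exact (Finset.card_filter_le _ _).trans (Finset.card_filter_le _ _)
  · rintro s' hf' ⟨⟨hj, S, hST, hK, hC, hsup⟩, h₃⟩
    have hp' := hp₁.frame hf' (by decide)
    simp only [Cond.Holds, hp'.hn] at h₃
    refine ⟨S, hST, hK, hC, fun k hk => hsup k hk ?_⟩
    have := hST hk
    rw [hT, mem_assigned] at this
    omega

end CoverRAM

/-! ### The output -/

namespace CoverRAM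

open PathCover Function

variable {B L n : ℕ}

/-- The list of the edges `(f k, g k)` with `k < j` and `k ∈ S`. -/
def keptList (f g : ℕ → ℕ) (S : Finset ℕ) (j : ℕ) : List (ℕ × ℕ) :=
  ((List.range j).filter (· ∈ S)).map fun k => (f k, g k)

theorem keptList_succ (f g : ℕ → ℕ) (S : Finset ℕ) (j : ℕ) :
    keptList f g S (j + 1) = keptList f g S j ++ if j ∈ S then [(f j, g j)] else [] := by
  unfold keptList
  rw [List.range_succ, List.filter_append, List.map_append]
  split_ifs with h <;> simp [h]

theorem length_keptList_mono (f g : ℕ → ℕ) (S : Finset ℕ) {i j : ℕ} (h : i ≤ j) :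
    (keptList f g S i).length ≤ (keptList f g S j).length := by
  induction j, h using Nat.le_induction with
  | base => exact le_rfl
  | succ j _ ih => rw [keptList_succ, List.length_append]; omega

/-- The cells from address `1` on contain the pairs in `l`. -/
def Written (inp : ℕ → ℕ) (l : List (ℕ × ℕ)) : Prop :=
  ∀ i x, l[i]? = some x → inp (1 + 2 * i) = x.1 ∧ inp (1 + 2 * i + 1) = x.2

/-- The output overwrites the input, which is no longer needed; `hB` keeps the written addresses
within the input area. The length goes into cell 0 at the end. -/
theorem ev_output {s : St} {S : Finset ℕ} (hz : s.v .zero = 0) (hn : s.v .n = n) (hS : Keeps S s)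
    (hB : 2 * (keptList (fun k => s.a .src (s.a .mate k - 1))
      (fun k => s.a .dst (s.a .mate k - 1)) S n).length < B) :
    Ev B L .output s (100 * n + 20) fun s' =>
      s'.inp 0 = (keptList (fun k => s.a .src (s.a .mate k - 1))
        (fun k => s.a .dst (s.a .mate k - 1)) S n).length ∧
      Written s'.inp (keptList (fun k => s.a .src (s.a .mate k - 1))
        (fun k => s.a .dst (s.a .mate k - 1)) S n) := by
  set l := keptList (fun k => s.a .src (s.a .mate k - 1)) (fun k => s.a .dst (s.a .mate k - 1)) S
    with hl
  refine (Ev.seq (t₁ := 3) (Q := fun s' => s'.v .j = 0 ∧ s'.v .p = 1 ∧ s'.v .l = 0 ∧ s'.a = s.a)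
    (t₂ := (100 * n + 5) + 1) (Ev.of_wp (by simp [Cmd.wp, Op.Ok, Op.eval]) (by decide))
    fun s₁ hf₁ hs₁ => Ev.seq (Q := fun s' => s'.v .l = (l n).length ∧ Written s'.inp (l n)) ?_
      fun s₂ hf₂ hs₂ => ?_).mono (by omega) fun _ _ h => h
  · refine (Ev.loop (fun s' => s'.v .j ≤ n ∧ s'.v .p = 1 + 2 * (l (s'.v .j)).length ∧
      s'.v .l = (l (s'.v .j)).length ∧ Written s'.inp (l (s'.v .j)))
      (fun s' => n - s'.v .j) 95 ⟨by omega, ?_, ?_, ?_⟩ ?_).mono (by simp [hs₁.1]) ?_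
    · rw [hs₁.1, hs₁.2.1]; simp [hl, keptList]
    · rw [hs₁.1, hs₁.2.2.1]; simp [hl, keptList]
    · rw [hs₁.1]
      intro i x h
      simp [hl, keptList] at h
    · rintro s' hf' ⟨hj, hpp, hll, hw⟩ hb
      have hn' : s'.v .n = n := by rw [hf'.v _ (by decide), hf₁.v _ (by decide), hn]
      have hz' : s'.v .zero = 0 := by rw [hf'.v _ (by decide), hf₁.v _ (by decide), hz]
      have e : s'.a = s.a := by
        refine (?_ : s'.a = s₁.a).trans hs₁.2.2.2
        exact funext fun A => hf'.a A (by cases A <;> decide)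
      simp only [Cond.Holds, hn'] at hb
      have hmono := length_keptList_mono (fun k => s.a .src (s.a .mate k - 1))
        (fun k => s.a .dst (s.a .mate k - 1)) S hb
      rw [← hl, Nat.succ_eq_add_one] at hmono
      have hsucc := keptList_succ (fun k => s.a .src (s.a .mate k - 1))
        (fun k => s.a .dst (s.a .mate k - 1)) S (s'.v .j)
      rw [← hl] at hsucc
      have hμ : n - (s'.v .j + 1) < n - s'.v .j := by omega
      refine Ev.of_wp ?_ (by decide)
      simp only [Cmd.outputStep, Cmd.wp, Op.Ok, Op.eval, Cond.Holds, true_and, St.setV_v,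
        St.setI_v, St.setI_a, St.setV_a, St.setV_inp, St.setI_inp, if_true, reduceCtorEq,
        if_false, hz', hμ, and_true, e]
      refine ⟨fun h => ?_, fun h => ?_⟩
      · have hjS : s'.v .j ∉ S := fun hjS => (hS.keep _).2 hjS h
        rw [if_neg hjS, List.append_nil] at hsucc
        rw [hsucc]
        exact ⟨hb, hpp, hll, hw⟩
      · have hjS : s'.v .j ∈ S := (hS.keep _).1 h
        rw [if_pos hjS] at hsucc
        have hlen : (l (s'.v .j + 1)).length = (l (s'.v .j)).length + 1 := by rw [hsucc]; simp
        refine ⟨by omega, by omega, hb, by omega, by omega, ?_⟩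
        rw [hsucc, hpp]
        intro i x hx
        simp only [update_apply]
        by_cases hi : i < (l (s'.v .j)).length
        · rw [List.getElem?_append_left hi] at hx
          rw [if_neg (by omega), if_neg (by omega), if_neg (by omega), if_neg (by omega)]
          exact hw i x hx
        · rw [List.getElem?_append_right (by omega)] at hx
          have hi' : i = (l (s'.v .j)).length := by
            have := (List.getElem?_eq_some_iff.1 hx).1
            simp only [List.length_singleton] at this
            omega
          subst hi'
          simp only [Nat.sub_self, List.getElem?_cons_zero, Option.some.injEq] at hx
          subst hx
          simp
    · rintro s' hf' ⟨⟨hj, hpp, hll, hw⟩, h₃⟩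
      have hn' : s'.v .n = n := by rw [hf'.v _ (by decide), hf₁.v _ (by decide), hn]
      simp only [Cond.Holds, hn'] at h₃
      rw [show n = s'.v .j by omega]
      exact ⟨hll, hw⟩
  · have hz' : s₂.v .zero = 0 := by rw [hf₂.v _ (by decide), hf₁.v _ (by decide), hz]
    refine Ev.of_wp ?_ (by decide)
    simp only [Cmd.wp, Op.Ok, Op.eval, St.setI_inp, hz']
    refine ⟨by omega, by rw [update_self, hs₂.1], fun i x hx => ?_⟩
    rw [update_of_ne (by omega), update_of_ne (by omega)]
    exact hs₂.2 i x hx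

end CoverRAM

/-! ### Maximum weight -/

namespace CoverRAM

open PathCover Function

/-- The data that describe the components of a subgraph: vertices of the subgraph have the same
label if and only if they lie in the same component, and `bad` marks the labels of the bad
components. -/
structure Describes {n : ℕ} {G : SimpleGraph (Fin n)} (H : G.Subgraph) (comp bad : ℕ → ℕ) :
    Prop where
  lt : ∀ v : Fin n, comp v < n
  comp_eq_iff : ∀ u v : H.verts, comp u.1 = comp v.1 ↔
    H.coe.connectedComponentMk u = H.coe.connectedComponentMk v
  bad_iff : ∀ v : H.verts, bad (comp v.1) ≠ 0 ↔ IsBad (H.coe.connectedComponentMk v)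

variable {n : ℕ} {G : SimpleGraph (Fin n)} {H : G.Subgraph} {comp bad : ℕ → ℕ}

theorem mem_vertices {K : Component H} {v : Fin n} :
    v ∈ K.vertices ↔ ∃ h : v ∈ H.verts, H.coe.connectedComponentMk ⟨v, h⟩ = K := by
  constructor
  · rintro ⟨⟨w, hw⟩, h, rfl⟩
    exact ⟨hw, h⟩
  · rintro ⟨h, hK⟩
    exact ⟨⟨v, h⟩, hK, rfl⟩

theorem Describes.adj_iff (h : Describes H comp bad) {u v : Fin n} :
    (crossGraph H).Adj u v ↔ G.Adj u v ∧ u ∈ H.verts ∧ v ∈ H.verts ∧ comp u ≠ comp v ∧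
      (bad (comp u) ≠ 0 ∨ bad (comp v) ≠ 0) := by
  constructor
  · rintro ⟨hG, K₁, K₂, h₁, h₂, hne, hbad⟩
    obtain ⟨hu, rfl⟩ := mem_vertices.1 h₁
    obtain ⟨hv, rfl⟩ := mem_vertices.1 h₂
    refine ⟨hG, hu, hv, fun he => hne ((h.comp_eq_iff ⟨u, hu⟩ ⟨v, hv⟩).1 he), ?_⟩
    exact hbad.imp (h.bad_iff ⟨u, hu⟩).2 (h.bad_iff ⟨v, hv⟩).2
  · rintro ⟨hG, hu, hv, hne, hbad⟩
    refine ⟨hG, _, _, mem_vertices.2 ⟨hu, rfl⟩, mem_vertices.2 ⟨hv, rfl⟩,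
      fun he => hne ((h.comp_eq_iff ⟨u, hu⟩ ⟨v, hv⟩).2 he), ?_⟩
    exact hbad.imp (h.bad_iff ⟨u, hu⟩).1 (h.bad_iff ⟨v, hv⟩).1

open Classical in
/-- The labels of the bad components that are saturated by `F`. -/
noncomputable def satLabels (H : G.Subgraph) (comp bad : ℕ → ℕ) (F : Set (Sym2 (Fin n))) :
    Finset ℕ :=
  (Finset.range n).filter fun c => bad c ≠ 0 ∧ ∃ e ∈ F, ∃ v ∈ e, v ∈ H.verts ∧ comp v = c

theorem mem_satLabels {F : Set (Sym2 (Fin n))} {c : ℕ} : c ∈ satLabels H comp bad F ↔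
    c < n ∧ bad c ≠ 0 ∧ ∃ e ∈ F, ∃ v ∈ e, v ∈ H.verts ∧ comp v = c := by
  simp [satLabels]

/-- The label of a representative identifies a component, so counting components and counting labels
agree. -/
theorem Describes.weight_eq (h : Describes H comp bad) (F : Set (Sym2 (Fin n))) :
    weight H F = (satLabels H comp bad F).card := by
  classical
  have hrep : ∀ K : Component H, ∃ v : H.verts, H.coe.connectedComponentMk v = K :=
    fun K => K.exists_rep
  choose rep hrep using hrep
  have hinj : Injective fun K : Component H => comp (rep K).1 := by
    intro K K' he
    rw [← hrep K, ← hrep K']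
    exact (h.comp_eq_iff _ _).1 he
  rw [weight, ← Set.ncard_image_of_injective _ hinj, ← Set.ncard_coe_finset]
  congr 1
  ext c
  simp only [Set.mem_image, Set.mem_ofPred_eq, Finset.mem_coe, mem_satLabels]
  constructor
  · rintro ⟨K, ⟨hbad, e, he, v, hve, hvK⟩, rfl⟩
    obtain ⟨hv, hK⟩ := mem_vertices.1 hvK
    refine ⟨h.lt _, (h.bad_iff _).2 (by rwa [hrep]), e, he, v, hve, hv, ?_⟩
    exact (h.comp_eq_iff ⟨v, hv⟩ _).2 (by rw [hK, hrep])
  · rintro ⟨-, hbad, e, he, v, hve, hv, rfl⟩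
    refine ⟨H.coe.connectedComponentMk ⟨v, hv⟩, ⟨(h.bad_iff ⟨v, hv⟩).1 hbad, e, he, v, hve,
      mem_vertices.2 ⟨hv, rfl⟩⟩, ?_⟩
    exact (h.comp_eq_iff _ ⟨v, hv⟩).2 (hrep _)

/-- The market contains both slots of every vertex that is joined to a bad component by an edge of
the cross graph. -/
def Market.Complete (M : Market) (H : G.Subgraph) (comp bad : ℕ → ℕ) : Prop :=
  ∀ u v : Fin n, (crossGraph H).Adj u v → bad (comp u) ≠ 0 → ∀ d < 2, ∃ e < M.E,
    M.key e = comp u ∧ M.slot e = 2 * v + d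

/-- No path-cycle cover saturates more bad components than the auction assigns. -/
theorem card_satLabels_le {M : Market} {A : Auction} (hn : M.n = n)
    (hM : M.Complete H comp bad) (hA : A.Inv M (min M.n M.E + 1)) (hb : A.b = M.n)
    (hK : A.K = M.n) {F : Set (Sym2 (Fin n))} (hF : IsPathCycleCover (crossGraph H) F) :
    (satLabels H comp bad F).card ≤ (assigned n A.mate).card := by
  classical
  obtain ⟨g, hg₁, hg₂⟩ := hA.certificate hb hK
  set T := assigned n A.mate with hT
  set S := satLabels H comp bad F with hS
  -- Both sides are split at the level `g`. Below it every bidder is assigned, since an unassigned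
  -- one has label at least `g`. It remains to compare the parts above it.
  rw [← Finset.card_filter_add_card_filter_not (s := S) (fun k => g ≤ A.lab k),
    ← Finset.card_filter_add_card_filter_not (s := T) (fun k => g ≤ A.lab k)]
  refine Nat.add_le_add ?_ (Finset.card_le_card ?_)
  swap
  · intro k hk
    rw [Finset.mem_filter] at hk ⊢
    have hkn := (mem_satLabels.1 hk.1).1
    exact ⟨mem_assigned.2 ⟨hkn, fun h₀ => hk.2 (hg₁ k (by omega) h₀)⟩, hk.2⟩
  -- A saturated component of high label has an edge of `F` to some `w`, and by the certificate both
  -- slots of `w` are owned by bidders of high label.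
  have key : ∀ k ∈ S.filter (fun k => g ≤ A.lab k), ∃ v w : Fin n, s(v, w) ∈ F ∧ comp v = k ∧
      ∀ d < 2, A.own (2 * w + d) ≠ 0 ∧ g ≤ A.lab (A.own (2 * w + d) - 1) := by
    intro k hk
    rw [Finset.mem_filter, mem_satLabels] at hk
    obtain ⟨⟨hkn, hbad, e, he, v, hve, hv, rfl⟩, hgk⟩ := hk
    obtain ⟨w, rfl⟩ := Sym2.mem_iff_exists.1 hve
    refine ⟨v, w, he, rfl, fun d hd => ?_⟩
    obtain ⟨i, hi, hkey, hslot⟩ := hM v w (hF.1 he) hbad d hd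
    rw [← hslot]
    exact hg₂ i hi (by rwa [hkey])
  rcases Finset.eq_empty_or_nonempty (S.filter (fun k => g ≤ A.lab k)) with h₀ | ⟨k₀, hk₀⟩
  · rw [h₀]; simp
  have : Nonempty (Fin n) := ⟨(key k₀ hk₀).choose⟩
  choose! x y hxy hx hy using key
  -- Components charged to the same `w` have distinct edges of `F` at `w`, because the other end
  -- determines the component; there are at most two such edges.
  have h₁ : (S.filter (fun k => g ≤ A.lab k)).card ≤
      2 * ((S.filter (fun k => g ≤ A.lab k)).image y).card := by
    refine Finset.card_le_mul_card_image _ 2 fun w _ => ?_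
    have hinj : Set.InjOn (fun k => s(x k, w))
        ((S.filter (fun k => g ≤ A.lab k)).filter fun k => y k = w : Finset ℕ) := by
      intro k hk k' hk' he
      rw [Finset.mem_coe, Finset.mem_filter] at hk hk'
      rw [← hx k hk.1, ← hx k' hk'.1, Sym2.congr_left.1 he]
    rw [← Finset.card_image_of_injOn hinj]
    have hle := hF.2 w
    have hsub : (((S.filter (fun k => g ≤ A.lab k)).filter fun k => y k = w).image
        (fun k => s(x k, w)) : Set (Sym2 (Fin n))) ⊆ {e ∈ F | w ∈ e} := by
      intro e he
      simp only [Finset.coe_image, Set.mem_image, Finset.mem_coe, Finset.mem_filter] at he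
      obtain ⟨k, ⟨hk, rfl⟩, rfl⟩ := he
      exact ⟨hxy k (Finset.mem_filter.2 hk), Sym2.mem_mk_right _ _⟩
    have := (Set.encard_le_encard hsub).trans hle
    rw [Set.encard_coe_eq_coe_finsetCard] at this
    exact_mod_cast this
  refine h₁.trans ?_
  -- Each charged vertex contributes two slots, and distinct slots have distinct owners, all
  -- assigned and of high label.
  rw [mul_comm, ← Finset.card_range 2, ← Finset.card_product]
  refine Finset.card_le_card_of_injOn (fun p => A.own (2 * p.1 + p.2) - 1) ?_ ?_
  · rintro ⟨w, d⟩ hp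
    simp only [Finset.coe_product, Set.mem_prod, Finset.mem_coe, Finset.mem_range,
      Finset.mem_image] at hp
    obtain ⟨⟨k, hk, rfl⟩, hd⟩ := hp
    obtain ⟨ho, hgo⟩ := hy k hk d hd
    have hm := hA.own_mate _ ho
    refine Finset.mem_coe.2 (Finset.mem_filter.2 ⟨mem_assigned.2 ⟨?_, hm⟩, hgo⟩)
    have h₂ := M.key_lt (A.mate (A.own (2 * y k + d) - 1) - 1)
      (by have := hA.mate_le _ hm; omega)
    rw [hA.mate_key _ hm] at h₂
    show A.own (2 * y k + d) - 1 < n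
    omega
  · rintro ⟨w, d⟩ hp ⟨w', d'⟩ hp' he
    simp only [Finset.coe_product, Set.mem_prod, Finset.mem_coe, Finset.mem_range,
      Finset.mem_image] at hp hp'
    obtain ⟨⟨k, hk, rfl⟩, hd⟩ := hp
    obtain ⟨⟨k', hk', rfl⟩, hd'⟩ := hp'
    have e₁ := hA.own_slot _ (hy k hk d hd).1
    have e₂ := hA.own_slot _ (hy k' hk' d' hd').1
    simp only at he
    rw [he, e₂] at e₁
    ext
    · simp only; omega
    · simp only; omega

/-- The ends of the edges that the auction assigns to the bad components. -/
structure EdgeChoice (H : G.Subgraph) (comp bad par : ℕ → ℕ) (M : Market) (A : Auction)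
    (x y : ℕ → Fin n) : Prop where
  adj : ∀ k ∈ assigned n A.mate, (crossGraph H).Adj (x k) (y k)
  bad : ∀ k ∈ assigned n A.mate, bad k ≠ 0
  comp_x : ∀ k ∈ assigned n A.mate, comp (x k) = k
  comp_y : ∀ k ∈ assigned n A.mate, comp (y k) = par k
  slot : ∀ k ∈ assigned n A.mate, ∃ d < 2, M.slot (A.mate k - 1) = 2 * y k + d

/-! ### From an assignment to a path-cycle cover. -/

section Choice

variable {par : ℕ → ℕ} {M : Market} {A : Auction} {x y : ℕ → Fin n} {N : ℕ} {S : Finset ℕ}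

/-- If two components chose the same edge from opposite ends, each would be the parent of the other.
Then one kept child and a kept parent make `k` superfluous. -/
theorem EdgeChoice.eq_of_edge_eq (hc : EdgeChoice H comp bad par M A x y)
    (hS : S ⊆ assigned n A.mate) (hsup : ∀ k ∈ S, ¬ Superfluous par S k) {k l : ℕ} (hk : k ∈ S)
    (hl : l ∈ S) (he : s(x k, y k) = s(x l, y l)) : k = l := by
  rcases Sym2.eq_iff.1 he with ⟨h₁, -⟩ | ⟨h₁, h₂⟩
  · rw [← hc.comp_x k (hS hk), ← hc.comp_x l (hS hl), h₁]
  · have e₁ : k = par l := by rw [← hc.comp_x k (hS hk), ← hc.comp_y l (hS hl), h₁]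
    have e₂ : par k = l := by rw [← hc.comp_x l (hS hl), ← hc.comp_y k (hS hk), h₂]
    refine absurd (.inr ⟨?_, by rwa [e₂]⟩) (hsup k hk)
    exact Finset.card_pos.2 ⟨l, mem_children.2 ⟨hl, e₁.symm⟩⟩

/-- At a vertex `v` whose component is kept, at most one edge starts and at most one ends, because
two ending edges would give the component two children. If the component is not kept, no edge starts
at `v`, and the two slots of `v` allow at most two edges to end there. -/
theorem EdgeChoice.isPathCycleCover (hc : EdgeChoice H comp bad par M A x y) (hA : A.Inv M N)
    (hS : S ⊆ assigned n A.mate) (hsup : ∀ k ∈ S, ¬ Superfluous par S k) :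
    IsPathCycleCover (crossGraph H) ((fun k => s(x k, y k)) '' S) := by
  classical
  refine ⟨?_, fun v => ?_⟩
  · rintro _ ⟨k, hk, rfl⟩
    exact hc.adj k (hS hk)
  have hsub : {e ∈ (fun k => s(x k, y k)) '' (S : Set ℕ) | v ∈ e} ⊆
      (((S.filter fun k => x k = v) ∪ (S.filter fun k => y k = v)).image fun k => s(x k, y k) :
        Finset _) := by
    rintro _ ⟨⟨k, hk, rfl⟩, hv⟩
    rw [Finset.mem_coe, Finset.mem_image]
    refine ⟨k, ?_, rfl⟩
    rw [Finset.mem_union, Finset.mem_filter, Finset.mem_filter]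
    rcases Sym2.mem_iff.1 hv with h | h
    · exact .inl ⟨hk, h.symm⟩
    · exact .inr ⟨hk, h.symm⟩
  refine (Set.encard_le_encard hsub).trans ?_
  rw [Set.encard_coe_eq_coe_finsetCard]
  suffices h : (S.filter fun k => x k = v).card + (S.filter fun k => y k = v).card ≤ 2 by
    exact_mod_cast Finset.card_image_le.trans ((Finset.card_union_le _ _).trans h)
  have hx : S.filter (fun k => x k = v) ⊆ {comp v} := by
    intro k hk
    rw [Finset.mem_filter] at hk
    rw [Finset.mem_singleton, ← hk.2, hc.comp_x k (hS hk.1)]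
  by_cases hv : comp v ∈ S
  · have h₁ := (Finset.card_le_card hx).trans_eq (Finset.card_singleton _)
    have h₂ : S.filter (fun k => y k = v) ⊆ children par S (comp v) := by
      intro k hk
      rw [Finset.mem_filter] at hk
      exact mem_children.2 ⟨hk.1, by rw [← hc.comp_y k (hS hk.1), hk.2]⟩
    have h₃ := Finset.card_le_card h₂
    have h₄ : ¬ 2 ≤ (children par S (comp v)).card := fun h => hsup _ hv (.inl h)
    omega
  · have h₁ : S.filter (fun k => x k = v) = ∅ := by
      rw [Finset.eq_empty_iff_forall_notMem]
      intro k hk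
      have := Finset.mem_singleton.1 (hx hk)
      exact hv (this ▸ (Finset.mem_filter.1 hk).1)
    rw [h₁, Finset.card_empty, zero_add]
    have h₂ : (S.filter fun k => y k = v).card ≤ ({2 * v.val, 2 * v.val + 1} : Finset ℕ).card := by
      refine Finset.card_le_card_of_injOn (fun k => M.slot (A.mate k - 1)) ?_ ?_
      · intro k hk
        rw [Finset.mem_coe, Finset.mem_filter] at hk
        obtain ⟨d, hd, he⟩ := hc.slot k (hS hk.1)
        simp only [he, hk.2, Finset.coe_insert, Finset.coe_singleton, Set.mem_insert_iff,
          Set.mem_singleton_iff]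
        omega
      · intro k hk l hl he
        rw [Finset.mem_coe, Finset.mem_filter] at hk hl
        have e₁ := hA.mate_own k (mem_assigned.1 (hS hk.1)).2
        have e₂ := hA.mate_own l (mem_assigned.1 (hS hl.1)).2
        simp only at he
        rw [he, e₂] at e₁
        omega
    exact h₂.trans Finset.card_le_two

theorem EdgeChoice.assigned_subset (hc : EdgeChoice H comp bad par M A x y)
    (hD : Describes H comp bad) (hS : S ⊆ assigned n A.mate)
    (hcov : Covers par (assigned n A.mate) S) :
    assigned n A.mate ⊆ satLabels H comp bad ((fun k => s(x k, y k)) '' S) := by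
  intro k hk
  refine mem_satLabels.2 ⟨(mem_assigned.1 hk).1, hc.bad k hk, ?_⟩
  rcases hcov k hk with h | ⟨l, hl⟩
  · have hadj := hD.adj_iff.1 (hc.adj k hk)
    exact ⟨_, ⟨k, h, rfl⟩, x k, Sym2.mem_mk_left _ _, hadj.2.1, hc.comp_x k hk⟩
  · rw [mem_children] at hl
    have hadj := hD.adj_iff.1 (hc.adj l (hS hl.1))
    exact ⟨_, ⟨l, hl.1, rfl⟩, y l, Sym2.mem_mk_right _ _, hadj.2.2.1,
      (hc.comp_y l (hS hl.1)).trans hl.2⟩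

/-- The number of assigned components separates the two weights: it bounds the weight of every cover
from above, and all assigned components are saturated by the kept edges. -/
theorem EdgeChoice.isMaxWeightCover (hc : EdgeChoice H comp bad par M A x y)
    (hD : Describes H comp bad) (hn : M.n = n) (hM : M.Complete H comp bad)
    (hA : A.Inv M (min M.n M.E + 1)) (hb : A.b = M.n) (hK : A.K = M.n)
    (hS : S ⊆ assigned n A.mate) (hcov : Covers par (assigned n A.mate) S)
    (hsup : ∀ k ∈ S, ¬ Superfluous par S k) :
    IsMaxWeightCover H ((fun k => s(x k, y k)) '' S) := by
  refine ⟨hc.isPathCycleCover hA hS hsup, fun F' hF' => ?_⟩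
  rw [hD.weight_eq, hD.weight_eq]
  exact (card_satLabels_le hn hM hA hb hK hF').trans
    (Finset.card_le_card (hc.assigned_subset hD hS hcov))

end Choice

end CoverRAM

/-! ### The meaning of labels, degrees and statistics -/

namespace CoverRAM

open PathCover Function

/-- With five vertices, two of degree 1 and three of degree 2 leave no vertex of another degree, so
the counts suffice for the condition on all vertices. -/
theorem isKPath_five_iff {W : Type*} [Finite W] {J : SimpleGraph W} (hJ : J.Connected) :
    IsKPath 5 J ↔ Nat.card W = 5 ∧ {v : W | (J.neighborSet v).ncard = 1}.ncard = 2 ∧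
      {v : W | (J.neighborSet v).ncard = 2}.ncard = 3 := by
  set d : W → ℕ := fun v => (J.neighborSet v).ncard
  have hdis : Disjoint {v | d v = 1} {v | d v = 2} := by
    rw [Set.disjoint_left]
    intro v h₁ h₂
    simp only [Set.mem_ofPred_eq] at h₁ h₂
    omega
  have hun := Set.ncard_union_eq hdis
  constructor
  · rintro ⟨h, h5⟩
    rcases h with h | ⟨-, h1, h2⟩
    · omega
    · refine ⟨h5, h1, ?_⟩
      have : {v | d v = 1} ∪ {v | d v = 2} = Set.univ := Set.eq_univ_of_forall h2
      rw [this, Set.ncard_univ, h5, h1] at hun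
      show {v | d v = 2}.ncard = 3
      omega
  · rintro ⟨h5, h1, h2⟩
    refine ⟨.inr ⟨hJ, h1, fun v => ?_⟩, h5⟩
    have : {v | d v = 1} ∪ {v | d v = 2} = Set.univ := by
      refine Set.eq_of_subset_of_ncard_le (Set.subset_univ _) ?_
      rw [Set.ncard_univ, h5, hun]
      show 5 ≤ {v | (J.neighborSet v).ncard = 1}.ncard + {v | (J.neighborSet v).ncard = 2}.ncard
      omega
    exact (this ▸ Set.mem_univ v : v ∈ {v | d v = 1} ∪ {v | d v = 2})

/-! ### Adjacency and degrees read off an edge list. -/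

theorem countP_fst_or_snd {α : Type*} [DecidableEq α] (v : α) (l : List (α × α))
    (h : ∀ e ∈ l, e.1 ≠ e.2) :
    l.countP (fun e => e.1 = v ∨ e.2 = v) = l.countP (·.1 = v) + l.countP (·.2 = v) := by
  induction l with
  | nil => rfl
  | cons e l ih =>
    rw [List.forall_mem_cons] at h
    have h₁ := h.1
    rw [List.countP_cons, List.countP_cons, List.countP_cons, ih h.2]
    by_cases h₂ : e.1 = v
    · have h₃ : e.2 ≠ v := fun h₃ => h₁ (h₂.trans h₃.symm)
      simp [h₂, h₃]; omega
    · by_cases h₃ : e.2 = v <;> simp [h₂, h₃]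
      omega

variable {n : ℕ} {G : SimpleGraph (Fin n)} {H : G.Subgraph} {eH : List (Fin n × Fin n)}

theorem adj_iff_of_isEdgeList (hH : IsEdgeList H.edgeSet eH) {u v : Fin n} :
    H.Adj u v ↔ (u, v) ∈ eH ∨ (v, u) ∈ eH := by
  rw [← SimpleGraph.Subgraph.mem_edgeSet, hH.2, List.mem_map]
  constructor
  · rintro ⟨⟨a, b⟩, he, h⟩
    rcases Sym2.eq_iff.1 h with ⟨rfl, rfl⟩ | ⟨rfl, rfl⟩
    · exact .inl he
    · exact .inr he
  · rintro (h | h)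
    · exact ⟨_, h, rfl⟩
    · exact ⟨_, h, Sym2.eq_swap⟩

/-- Sending an incident edge to its other end is a bijection onto the neighbours, since the list has
no repeated edge. No edge is counted at both of its ends, as there are no loops. -/
theorem ncard_neighborSet_of_isEdgeList (hH : IsEdgeList H.edgeSet eH) (v : Fin n) :
    (H.neighborSet v).ncard = eH.countP (·.1 = v) + eH.countP (·.2 = v) := by
  rw [← countP_fst_or_snd v eH fun e he =>
    ((adj_iff_of_isEdgeList hH).2 (.inl he)).ne]
  set l := eH.filter fun e => e.1 = v ∨ e.2 = v with hl
  set g : Fin n × Fin n → Fin n := fun e => if e.1 = v then e.2 else e.1 with hg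
  have hgs : ∀ e ∈ l, s(e.1, e.2) = s(v, g e) := by
    intro e he
    rw [hl, List.mem_filter, decide_eq_true_eq] at he
    simp only [hg]
    split_ifs with h
    · rw [h]
    · rw [he.2.resolve_left h, Sym2.eq_swap]
  have hnd : (l.map g).Nodup := by
    refine List.Nodup.map_on ?_ (hH.1.of_map.filter _)
    intro e he e' he' h
    refine List.inj_on_of_nodup_map hH.1 (List.mem_filter.1 he).1 (List.mem_filter.1 he').1 ?_
    rw [hgs e he, hgs e' he', h]
  have hset : H.neighborSet v = ((l.map g).toFinset : Set (Fin n)) := by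
    ext w
    rw [Finset.mem_coe, List.mem_toFinset, List.mem_map, SimpleGraph.Subgraph.mem_neighborSet,
      ← SimpleGraph.Subgraph.mem_edgeSet, hH.2, List.mem_map]
    constructor
    · rintro ⟨e, he, h⟩
      have hel : e ∈ l := by
        rw [hl, List.mem_filter, decide_eq_true_eq]
        rcases Sym2.eq_iff.1 h with h | h
        · exact ⟨he, .inl h.1⟩
        · exact ⟨he, .inr h.2⟩
      exact ⟨e, hel, Sym2.congr_right.1 ((hgs e hel).symm.trans h)⟩
    · rintro ⟨e, he, rfl⟩
      exact ⟨e, (List.mem_filter.1 he).1, hgs e he⟩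
  rw [hset, Set.ncard_coe_finset, List.toFinset_card_of_nodup hnd, List.length_map,
    List.countP_eq_length_filter]

variable {s : St}

theorem Labelled.comp_eq_iff (h : Labelled eH s) (hH : IsEdgeList H.edgeSet eH) (u v : H.verts) :
    s.a .comp u.1 = s.a .comp v.1 ↔
      H.coe.connectedComponentMk u = H.coe.connectedComponentMk v := by
  rw [SimpleGraph.ConnectedComponent.eq]
  constructor
  · intro he
    -- The generated equivalence lives on all vertices of `G`, and a vertex outside `H` is related
    -- only to itself; hence the alternative `a = b`.
    have key : ∀ a b : Fin n, Relation.EqvGen (fun a b => (a, b) ∈ eH) a b →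
        a = b ∨ ∃ (ha : a ∈ H.verts) (hb : b ∈ H.verts), H.coe.Reachable ⟨a, ha⟩ ⟨b, hb⟩ := by
      intro a b hab
      induction hab with
      | rel a b h =>
        have hadj : H.Adj a b := (adj_iff_of_isEdgeList hH).2 (.inl h)
        exact .inr ⟨hadj.fst_mem, hadj.snd_mem, hadj.coe.reachable⟩
      | refl a => exact .inl rfl
      | symm a b _ ih =>
        rcases ih with rfl | ⟨ha, hb, h⟩
        · exact .inl rfl
        · exact .inr ⟨hb, ha, h.symm⟩
      | trans a b c _ _ ih₁ ih₂ =>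
        rcases ih₁ with rfl | ⟨ha, hb, h₁⟩
        · exact ih₂
        · rcases ih₂ with rfl | ⟨hb, hc, h₂⟩
          · exact .inr ⟨ha, hb, h₁⟩
          · exact .inr ⟨ha, hc, h₁.trans h₂⟩
    rcases key _ _ (h.sound _ _ he) with h₁ | ⟨_, _, h₁⟩
    · rw [Subtype.ext h₁]
    · exact h₁
  · rintro ⟨p⟩
    induction p with
    | nil => rfl
    | cons hadj _ ih =>
      rw [← ih]
      rcases (adj_iff_of_isEdgeList hH).1 hadj with h' | h'
      · exact h.complete _ h'
      · exact (h.complete _ h').symm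

theorem ncard_neighborSet_toSimpleGraph (K : Component H) (w : K) :
    (K.toSimpleGraph.neighborSet w).ncard = (H.neighborSet w.1.1).ncard := by
  have hinj : Injective fun w : K => (w.1.1 : Fin n) :=
    Subtype.val_injective.comp Subtype.val_injective
  rw [← Set.ncard_image_of_injective _ hinj]
  congr 1
  ext x
  constructor
  · rintro ⟨y, hy, rfl⟩
    exact hy
  · intro hx
    have hx' : H.Adj w.1.1 x := hx
    exact ⟨⟨⟨x, hx'.snd_mem⟩, K.mem_supp_of_adj_mem_supp w.2 hx'.coe⟩, hx, rfl⟩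

theorem Stats.labelCount_eq (hl : Labelled eH s) (hH : IsEdgeList H.edgeSet eH) {f : ℕ → ℕ}
    (hf : ∀ v : Fin n, f v ≠ 0 ↔ v ∈ H.verts) (p : ℕ → Prop) [DecidablePred p] (v : H.verts) :
    labelCount f (s.a .comp) (fun v => p (s.a .deg v)) (s.a .comp v.1) n =
      {w : H.coe.connectedComponentMk v | p
        (((H.coe.connectedComponentMk v).toSimpleGraph.neighborSet w).ncard)}.ncard := by
  have hinj : Injective fun w : H.coe.connectedComponentMk v => (w.1.1.val : ℕ) :=
    Fin.val_injective.comp (Subtype.val_injective.comp Subtype.val_injective)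
  rw [labelCount, Nat.count_eq_card_filter_range, ← Set.ncard_coe_finset,
    ← Set.ncard_image_of_injective _ hinj]
  congr 1
  ext x
  simp only [Finset.coe_filter, Finset.mem_range, Set.mem_ofPred_eq, Set.mem_image]
  constructor
  · rintro ⟨hx, h₁, h₂, h₃⟩
    have hxH : (⟨x, hx⟩ : Fin n) ∈ H.verts := (hf ⟨x, hx⟩).1 h₁
    refine ⟨⟨⟨⟨x, hx⟩, hxH⟩, (hl.comp_eq_iff hH ⟨_, hxH⟩ v).1 h₂⟩, ?_, rfl⟩
    rw [ncard_neighborSet_toSimpleGraph, ncard_neighborSet_of_isEdgeList hH, ← hl.deg]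
    exact h₃
  · rintro ⟨w, hw, rfl⟩
    refine ⟨w.1.1.2, (hf _).2 w.1.2, (hl.comp_eq_iff hH w.1 v).2 w.2, ?_⟩
    rw [ncard_neighborSet_toSimpleGraph, ncard_neighborSet_of_isEdgeList hH, ← hl.deg] at hw
    exact hw

theorem Stats.describes {f : ℕ → ℕ} (hst : Stats f n s) (hl : Labelled eH s)
    (hH : IsEdgeList H.edgeSet eH) (hf : ∀ v : Fin n, f v ≠ 0 ↔ v ∈ H.verts) {bad : ℕ → ℕ}
    (hbad : ∀ c < n, bad c = if s.a .sz c = 5 ∧ s.a .c1 c = 2 ∧ s.a .c2 c = 3 then 0 else 1) :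
    Describes H (s.a .comp) bad where
  lt := hl.lt
  comp_eq_iff := hl.comp_eq_iff hH
  bad_iff v := by
    rw [hbad _ (hl.lt v), hst.sz, hst.c1, hst.c2, Stats.labelCount_eq hl hH hf (fun _ => True),
      Stats.labelCount_eq hl hH hf (· = 1), Stats.labelCount_eq hl hH hf (· = 2), IsBad,
      isKPath_five_iff (SimpleGraph.ConnectedComponent.connected_toSimpleGraph _)]
    have : {w : H.coe.connectedComponentMk v | True}.ncard =
        Nat.card (H.coe.connectedComponentMk v) := Set.ncard_univ _
    rw [this]
    split_ifs with h
    · exact ⟨fun h₀ => absurd rfl h₀, fun h' => absurd h h'⟩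
    · exact ⟨fun _ => h, fun _ => one_ne_zero⟩

end CoverRAM

/-! ### Correctness of the program -/

namespace CoverRAM

open PathCover Function

variable {B L n : ℕ} {G : SimpleGraph (Fin n)} {H : G.Subgraph} {eG eH : List (Fin n × Fin n)}

/-- The input area of `s` starts with a list of the edges of a path-cycle cover of maximum
weight. -/
def Solves (H : G.Subgraph) (s : St) : Prop :=
  ∃ (out : List (Fin n × Fin n)) (F : Set (Sym2 (Fin n))), s.inp 0 = out.length ∧
    Written s.inp (out.map fun p => (p.1.val, p.2.val)) ∧ IsEdgeList F out ∧ IsMaxWeightCover H F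

theorem length_le_of_isEdgeList {E F : Set (Sym2 (Fin n))} {l k : List (Fin n × Fin n)}
    (hl : IsEdgeList E l) (hk : IsEdgeList F k) (h : E ⊆ F) : l.length ≤ k.length := by
  have := (List.Nodup.subperm hl.1 fun e he => (hk.2 e).1 (h ((hl.2 e).2 he))).length_le
  simpa using this

/-- The auction assigns to each component an edge of the cross graph that ends in it. -/
structure Assigns (H : G.Subgraph) (M : Market) (s : St) : Prop where
  describes : Describes H (s.a .comp) (s.a .bad)
  hn : M.n = n
  complete : M.Complete H (s.a .comp) (s.a .bad)
  slot : s.a .slot = M.slot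
  inv : s.auction.Inv M (min M.n M.E + 1)
  b : s.auction.b = M.n
  K : s.auction.K = M.n
  edge : ∀ k ∈ assigned n (s.a .mate), ∃ x y : Fin n, s.a .src (s.a .mate k - 1) = x ∧
    s.a .dst (s.a .mate k - 1) = y ∧ (crossGraph H).Adj x y ∧ s.a .comp x = k ∧
    s.a .bad k ≠ 0 ∧ ∃ d < 2, s.a .slot (s.a .mate k - 1) = 2 * y + d

theorem Assigns.card_le {M : Market} {s : St} (h : Assigns H M s) :
    (assigned n (s.a .mate)).card ≤ M.E := by
  rw [← Finset.card_range M.E]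
  refine Finset.card_le_card_of_injOn (fun k => s.a .mate k - 1) ?_ ?_
  · intro k hk
    rw [Finset.mem_coe, mem_assigned] at hk
    have := h.inv.mate_le k hk.2
    simp only [Finset.coe_range, Set.mem_Iio]
    simp only [St.auction] at this
    omega
  · intro k hk l hl he
    rw [Finset.mem_coe, mem_assigned] at hk hl
    rw [← h.inv.mate_key k hk.2, ← h.inv.mate_key l hl.2]
    exact congrArg M.key he

theorem Assigns.ev_rest {M : Market} {s : St} (h : Assigns H M s) (hp : Params eG H.verts eH s)
    (hG : IsEdgeList G.edgeSet eG) (hB : B = 3 + 2 * eG.length + n + 2 * eH.length)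
    (hn : 0 < n) (h₀ : ∀ A ∈ [Arr.keep, .cnt], ∀ i, s.a A i = 0) :
    Ev B L (.initKeep ;; .prune ;; .output) s
      (100 * n + 10 + (120 * (M.E * (n + 1) + n) + 10 + (100 * n + 20))) (Solves H) := by
  classical
  refine Ev.seq (ev_initKeep hp h₀) fun s₁ hf₁ ⟨hS₁, hpar⟩ => ?_
  have : Nonempty (Fin n) := ⟨⟨0, hn⟩⟩
  choose! x y hx hy hadj hcx hbad hslot using h.edge
  have hp₁ := hp.frame hf₁ (by decide)
  have hc : EdgeChoice H (s.a .comp) (s.a .bad) (s₁.a .par) M s.auction x y :=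
    ⟨hadj, hbad, hcx, fun k hk => by rw [hpar k hk, hy k hk], fun k hk => by
      rw [← h.slot]; exact hslot k hk⟩
  have e₁ : s₁.a .mate = s.a .mate := hf₁.a _ (by decide)
  have e₂ : s₁.a .src = s.a .src := hf₁.a _ (by decide)
  have e₃ : s₁.a .dst = s.a .dst := hf₁.a _ (by decide)
  refine Ev.seq ((ev_prune hp₁ (T := assigned n (s.a .mate)) (by rw [e₁]) hS₁ ?_ ?_).mono
    (by have := Nat.mul_le_mul_right (n + 1) h.card_le; omega) fun _ _ h => h)
    fun s₂ hf₂ ⟨S, hST, hS, hcov, hsup⟩ => ?_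
  · intro k hk
    rw [hpar k hk, hy k hk]
    exact h.describes.lt _
  · intro k hk
    rw [hpar k hk, hy k hk]
    have := (h.describes.adj_iff.1 (hadj k hk)).2.2.2.1
    rw [hcx k hk] at this
    exact this.symm
  have hp₂ := hp₁.frame hf₂ (by decide)
  set out := ((List.range n).filter (· ∈ S)).map fun k => (x k, y k) with hout
  have hk : keptList (fun k => s₂.a .src (s₂.a .mate k - 1))
      (fun k => s₂.a .dst (s₂.a .mate k - 1)) S n = out.map fun p => (p.1.val, p.2.val) := by
    rw [hout, keptList, List.map_map]
    refine List.map_congr_left fun k hk => ?_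
    have hkT := hST (of_decide_eq_true (List.mem_filter.1 hk).2)
    rw [hf₂.a _ (by decide), hf₂.a .mate (by decide), hf₂.a .dst (by decide), e₁, e₂, e₃, hx k hkT,
      hy k hkT]
    rfl
  have hlist : IsEdgeList ((fun k => s(x k, y k)) '' S) out := by
    have e : (out.map fun p => s(p.1, p.2)) =
        ((List.range n).filter (· ∈ S)).map fun k => s(x k, y k) := by
      rw [hout, List.map_map]; rfl
    refine ⟨?_, fun z => ?_⟩
    · rw [e]
      refine List.Nodup.map_on ?_ (List.nodup_range.filter _)
      intro k hk l hl hkl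
      rw [List.mem_filter, decide_eq_true_eq] at hk hl
      exact hc.eq_of_edge_eq hST hsup hk.2 hl.2 hkl
    · rw [e, List.mem_map]
      refine exists_congr fun k => and_congr_left fun _ => ?_
      rw [List.mem_filter, decide_eq_true_eq, List.mem_range, Finset.mem_coe]
      exact ⟨fun hk => ⟨(mem_assigned.1 (hST hk)).1, hk⟩, fun hk => hk.2⟩
  have hmax := hc.isMaxWeightCover h.describes h.hn h.complete h.inv h.b h.K hST hcov hsup
  -- Since the chosen edges are distinct edges of `G`, the output fits into the cells of the input.
  have hlen : out.length ≤ eG.length := by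
    refine length_le_of_isEdgeList hlist hG (hmax.1.1.trans ?_)
    exact SimpleGraph.edgeSet_mono fun u v huv => huv.1
  refine (ev_output hp₂.zero hp₂.hn hS (by rw [hk, List.length_map]; omega)).mono le_rfl
    fun s₃ _ hs₃ => ?_
  rw [hk, List.length_map] at hs₃
  exact ⟨out, _, hs₃.1, hs₃.2, hlist, hmax⟩

theorem EntrySet.exists_market {s : St} {T : Set (ℕ × ℕ × ℕ)} (h : EntrySet T s)
    (hlt : ∀ t ∈ T, s.a .comp t.1 < n ∧ t.2.2 < 2 * n) :
    ∃ M : Market, M.n = n ∧ M.E = s.v .E ∧ M.key = s.key ∧ Stores M s :=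
  ⟨⟨n, s.v .E, s.key, s.a .slot, s.a .head, s.a .next, fun e he => (hlt _ (h.sound e he)).1,
    fun e he => (hlt _ (h.sound e he)).2, h.head, h.next⟩, rfl, rfl, rfl, rfl, rfl, rfl⟩

theorem mem_entryTriples (hG : IsEdgeList G.edgeSet eG) {inU comp bad : ℕ → ℕ}
    (hD : Describes H comp bad) (hU : ∀ v : Fin n, inU v ≠ 0 ↔ v ∈ H.verts) {t : ℕ × ℕ × ℕ} :
    t ∈ entryTriples eG inU comp bad ↔ ∃ x y : Fin n, (crossGraph H).Adj x y ∧ bad (comp x) ≠ 0 ∧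
      ∃ d < 2, t = (x.val, y.val, 2 * y.val + d) := by
  have hadj : ∀ x y : Fin n, ((x, y) ∈ eG ∨ (y, x) ∈ eG) ↔ G.Adj x y := by
    intro x y
    rw [← SimpleGraph.mem_edgeSet, hG.2, List.mem_map]
    constructor
    · rintro (h | h)
      · exact ⟨_, h, rfl⟩
      · exact ⟨_, h, Sym2.eq_swap⟩
    · rintro ⟨⟨a, b⟩, he, h⟩
      rcases Sym2.eq_iff.1 h with ⟨rfl, rfl⟩ | ⟨rfl, rfl⟩
      · exact .inl he
      · exact .inr he
  refine exists_congr fun x => exists_congr fun y => ?_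
  rw [hadj, hU, hU, hD.adj_iff]
  tauto

theorem Describes.ev_rest {s : St} (hD : Describes H (s.a .comp) (s.a .bad))
    (hU : ∀ v : Fin n, s.a .inU v ≠ 0 ↔ v ∈ H.verts) (hp : Params eG H.verts eH s)
    (hG : IsEdgeList G.edgeSet eG) (hB : B = 3 + 2 * eG.length + n + 2 * eH.length)
    (hL : 2 * n ≤ L) (hn : 0 < n)
    (h₀ : ∀ A ∈ [Arr.head, .cur, .lab, .price, .own, .mate, .keep, .cnt], ∀ i, s.a A i = 0) :
    Ev B L (.entries ;; .auction ;; .initKeep ;; .prune ;; .output) s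
      (300 * eG.length + 10 + (100 * (4 * eG.length * (n + 2) +
        3 * n * (4 * eG.length + 1) + n) + 50 +
        (100 * n + 10 + (120 * (4 * eG.length * (n + 1) + n) + 10 + (100 * n + 20)))))
      (Solves H) := by
  simp only [List.forall_mem_cons, List.not_mem_nil, false_imp_iff, implies_true, and_true] at h₀
  obtain ⟨hhead, hcur, hlab, hprice, hown, hmate, hkeep, hcnt⟩ := h₀
  refine Ev.seq (ev_entries hp hhead hcur hB hL) fun s₁ hf₁ ⟨hE, hT⟩ => ?_
  have hp₁ := hp.frame hf₁ (by decide)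
  have ecomp : s₁.a .comp = s.a .comp := hf₁.a _ (by decide)
  have ebad : s₁.a .bad = s.a .bad := hf₁.a _ (by decide)
  have hmem := fun {t} => mem_entryTriples hG hD hU (t := t)
  obtain ⟨M, hMn, hME, hMk, hM⟩ := hT.exists_market (n := n) fun t ht => by
    obtain ⟨x, y, -, -, d, hd, rfl⟩ := hmem.1 ht
    exact ⟨by rw [ecomp]; exact hD.lt x, by have := y.2; simp only; omega⟩
  refine Ev.seq ((ev_auction hp₁ hM hMn hME hT.cur ?_).mono ?_ fun _ _ h => h)
    fun s₂ hf₂ ⟨hinv, hb, hK⟩ => ?_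
  · simp only [List.forall_mem_cons, List.not_mem_nil, false_imp_iff, implies_true, and_true]
    rw [hf₁.a .lab (by decide), hf₁.a .price (by decide), hf₁.a .own (by decide),
      hf₁.a .mate (by decide)]
    exact ⟨hlab, hprice, hown, hmate⟩
  -- The minimum is bounded by `n` in the first product and by `M.E ≤ 4 * m` in the second, so both
  -- are `O(nm)`; bounding it by `n` in the second would leave a term `n ^ 2`.
  · have h₁ : M.E * (min n M.E + 2) ≤ 4 * eG.length * (n + 2) :=
      Nat.mul_le_mul (by omega) (by omega)
    have h₂ : 3 * n * (min n M.E + 1) ≤ 3 * n * (4 * eG.length + 1) :=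
      Nat.mul_le_mul_left _ (by omega)
    omega
  have hp₂ := hp₁.frame hf₂ (by decide)
  have e₁ : s₂.a .comp = s.a .comp := by rw [hf₂.a _ (by decide), ecomp]
  have e₂ : s₂.a .bad = s.a .bad := by rw [hf₂.a _ (by decide), ebad]
  have e₃ : s₂.a .src = s₁.a .src := hf₂.a _ (by decide)
  have e₄ : s₂.a .dst = s₁.a .dst := hf₂.a _ (by decide)
  have e₅ : s₂.a .slot = s₁.a .slot := hf₂.a _ (by decide)
  have hA : Assigns H M s₂ := by
    refine ⟨by rw [e₁, e₂]; exact hD, hMn, ?_, by rw [e₅, hM.slot], hinv, hb, hK, ?_⟩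
    · intro u v huv hbu d hd
      rw [e₁, e₂] at hbu
      obtain ⟨e, he, ht⟩ := hT.complete _ (hmem.2 ⟨u, v, huv, hbu, d, hd, rfl⟩)
      simp only [Prod.mk.injEq] at ht
      refine ⟨e, by omega, ?_, by rw [← hM.slot, ht.2.2]⟩
      rw [hMk, St.key, ht.1, ecomp, e₁]
    · intro k hk
      rw [mem_assigned] at hk
      have hle := hinv.mate_le k hk.2
      have hkey := hinv.mate_key k hk.2
      simp only [St.auction] at hle hkey
      obtain ⟨x, y, hxy, hbx, d, hd, ht⟩ := hmem.1 (hT.sound (s₂.a .mate k - 1) (by omega))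
      simp only [Prod.mk.injEq] at ht
      have hcx : s.a .comp x = k := by rw [← hkey, hMk, St.key, ht.1, ecomp]
      refine ⟨x, y, by rw [e₃, ht.1], by rw [e₄, ht.2.1], hxy, by rw [e₁, hcx], ?_, d, hd, by
        rw [e₅, ht.2.2]⟩
      rw [e₂, ← hcx]
      exact hbx
  refine (hA.ev_rest hp₂ hG hB hn ?_).mono ?_ fun _ _ h => h
  · simp only [List.forall_mem_cons, List.not_mem_nil, false_imp_iff, implies_true, and_true]
    rw [hf₂.a .keep (by decide), hf₂.a .cnt (by decide), hf₁.a .keep (by decide),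
      hf₁.a .cnt (by decide)]
    exact ⟨hkeep, hcnt⟩
  · have : M.E * (n + 1) ≤ 4 * eG.length * (n + 1) := Nat.mul_le_mul_right _ (by omega)
    omega

theorem Labelled.congr {s s' : St} (h : Labelled eH s) (hc : s'.a .comp = s.a .comp)
    (hd : s'.a .deg = s.a .deg) : Labelled eH s' :=
  ⟨by rw [hc]; exact h.lt, by rw [hc]; exact h.sound, by rw [hc]; exact h.complete,
    by rw [hd]; exact h.deg⟩

theorem ev_main {s : St} (hp : Params eG H.verts eH s) (hG : IsEdgeList G.edgeSet eG)
    (hH : IsEdgeList H.edgeSet eH) (hB : B = 3 + 2 * eG.length + n + 2 * eH.length)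
    (hL : 2 * n ≤ L) (h₀ : ∀ A i, s.a A i = 0) :
    Ev B L .main s (6000 * (n * eG.length) + 10) (Solves H) := by
  -- The branch is treated by hand, since weakest preconditions are available only for loop-free
  -- programs.
  have hwp : ∀ t, ((Cond.eq .m .zero).Holds s → Ev B L (.wr .zero .zero) s t (Solves H)) →
      (¬ (Cond.eq .m .zero).Holds s → Ev B L (.components ;; .statistics ;; .badness ;; .entries ;;
        .auction ;; .initKeep ;; .prune ;; .output) s t (Solves H)) →
      Ev B L .main s (t + 5) (Solves H) := by
    intro t h₁ h₂
    by_cases h : (Cond.eq .m .zero).Holds s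
    · obtain ⟨k, hk, s', hr, hs⟩ := h₁ h
      exact ⟨_, by simp only [Cond.cost, Cond.code, List.length_cons, List.length_nil]; omega, s',
        .ite_true h hr, hs⟩
    · obtain ⟨k, hk, s', hr, hs⟩ := h₂ h
      exact ⟨_, by simp only [Cond.cost, Cond.code, List.length_cons, List.length_nil]; omega, s',
        .ite_false h hr, hs⟩
  refine hwp (6000 * (n * eG.length) + 5) (fun hm => ?_) (fun hm => ?_)
  · simp only [Cond.Holds, hp.hm, hp.zero] at hm
    refine Ev.of_wp ?_ (by simp [Cmd.bound, Op.cost, Op.code])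
    refine ⟨by simp only [Op.Ok, hp.zero]; omega, [], ∅, ?_, ?_, ?_, ?_⟩
    · simp [Op.eval, hp.zero]
    · intro i x h; simp at h
    · exact ⟨by simp, by simp⟩
    · refine ⟨⟨Set.empty_subset _, by simp⟩, fun F' hF' => ?_⟩
      have : F' = ∅ := by
        refine Set.eq_empty_of_forall_notMem fun e he => ?_
        have h₁ : e ∈ G.edgeSet :=
          SimpleGraph.edgeSet_mono (fun u v huv => huv.1 : crossGraph H ≤ G) (hF'.1 he)
        rw [hG.2, List.length_eq_zero_iff.1 hm] at h₁
        simp at h₁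
      rw [this]
  simp only [Cond.Holds, hp.hm, hp.zero] at hm
  have hHG : eH.length ≤ eG.length := length_le_of_isEdgeList hH hG H.edgeSet_subset
  have hU : ∀ s' : St, Params eG H.verts eH s' → ∀ v : Fin n,
      s'.inp (3 + 2 * eG.length + v) ≠ 0 ↔ v ∈ H.verts := by
    intro s' hp' v
    rw [hp'.mem]
    split_ifs with h <;> simp [h]
  have hn : 0 < n := by
    obtain ⟨e, -⟩ := List.exists_mem_of_length_pos (Nat.pos_of_ne_zero hm)
    exact e.1.pos
  refine ((Ev.seq (ev_components hp (h₀ .deg) hB) fun s₁ hf₁ hl => Ev.seq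
    (ev_statistics (hp.frame hf₁ (by decide)) ?_ ?_ ?_ hB) fun s₂ hf₂ hst => Ev.seq
    (ev_badness ((hp.frame hf₁ (by decide)).frame hf₂ (by decide))) fun s₃ hf₃ hbad =>
    Describes.ev_rest ?_ ?_ (((hp.frame hf₁ (by decide)).frame hf₂ (by decide)).frame hf₃
      (by decide)) hG hB hL hn ?_).mono ?_ fun _ _ h => h)
  · intro i; rw [hf₁.a _ (by decide), h₀]
  · intro i; rw [hf₁.a _ (by decide), h₀]
  · intro i; rw [hf₁.a _ (by decide), h₀]
  · rw [hf₃.a .comp (by decide)]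
    exact hst.describes (hl.congr (hf₂.a _ (by decide)) (hf₂.a _ (by decide))) hH
      (hU _ (hp.frame hf₁ (by decide))) hbad
  · intro v
    rw [hf₃.a .inU (by decide), hst.inU v v.2]
    exact hU _ (hp.frame hf₁ (by decide)) v
  · simp only [List.forall_mem_cons, List.not_mem_nil, false_imp_iff, implies_true, and_true]
    have h₁ : ∀ A, Cmd.components.writesArr A = false → Cmd.statistics.writesArr A = false →
        Cmd.badness.writesArr A = false → ∀ i, s₃.a A i = 0 := fun A h₁ h₂ h₃ i => by
      rw [hf₃.a A h₃, hf₂.a A h₂, hf₁.a A h₁, h₀]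
    refine ⟨h₁ _ ?_ ?_ ?_, h₁ _ ?_ ?_ ?_, h₁ _ ?_ ?_ ?_, h₁ _ ?_ ?_ ?_, h₁ _ ?_ ?_ ?_,
      h₁ _ ?_ ?_ ?_, h₁ _ ?_ ?_ ?_, h₁ _ ?_ ?_ ?_⟩ <;> decide
  · set m := eG.length
    -- With `n` and `m` positive, all linear terms are absorbed by the product.
    have h₁ : n ≤ n * m := Nat.le_mul_of_pos_right n (by omega)
    have h₂ : m ≤ n * m := Nat.le_mul_of_pos_left m (by omega)
    have h₃ : n * eH.length ≤ n * m := Nat.mul_le_mul_left n hHG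
    ring_nf at h₁ h₂ h₃ ⊢
    omega

end CoverRAM

/-! ### Input and output -/

namespace CoverRAM

open PathCover Function

section Words

variable {n : ℕ}

theorem length_edgeWords (l : List (Fin n × Fin n)) : (edgeWords l).length = 2 * l.length := by
  induction l with
  | nil => rfl
  | cons e l ih =>
    have : edgeWords (e :: l) = e.1.val :: e.2.val :: edgeWords l := rfl
    rw [this, List.length_cons, List.length_cons, List.length_cons, ih]
    ring

theorem getElem?_edgeWords (l : List (Fin n × Fin n)) (i : ℕ) :
    (edgeWords l)[2 * i]? = l[i]?.map (·.1.val) ∧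
      (edgeWords l)[2 * i + 1]? = l[i]?.map (·.2.val) := by
  induction l generalizing i with
  | nil => simp [edgeWords]
  | cons e l ih =>
    have : edgeWords (e :: l) = e.1.val :: e.2.val :: edgeWords l := rfl
    rw [this]
    cases i with
    | zero => simp
    | succ i =>
      rw [show 2 * (i + 1) = 2 * i + 1 + 1 by ring]
      simpa using ih i

theorem lt_of_mem_edgeWords {l : List (Fin n × Fin n)} {x : ℕ} (h : x ∈ edgeWords l) : x < n := by
  simp only [edgeWords, List.mem_flatMap, List.mem_cons, List.not_mem_nil, or_false] at h
  obtain ⟨e, -, rfl | rfl⟩ := h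
  · exact e.1.2
  · exact e.2.2

variable {eG eH : List (Fin n × Fin n)} {U : Set (Fin n)}

theorem length_inputWords :
    (inputWords eG U eH).length = 3 + 2 * eG.length + n + 2 * eH.length := by
  simp [inputWords, length_edgeWords]
  ring

theorem le_of_mem_inputWords {x : ℕ} (h : x ∈ inputWords eG U eH) :
    x ≤ n + eG.length + eH.length + 1 := by
  simp only [inputWords, List.mem_append, List.mem_cons, List.not_mem_nil, or_false,
    List.mem_ofFn] at h
  rcases h with ((h | h) | ⟨v, rfl⟩) | h
  · omega
  · have := lt_of_mem_edgeWords h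
    omega
  · split_ifs <;> omega
  · have := lt_of_mem_edgeWords h
    omega

theorem getElem?_inputWords_fst (i : ℕ) (h : i < 2 * eG.length) :
    (inputWords eG U eH)[3 + i]? = (edgeWords eG)[i]? := by
  rw [inputWords, List.getElem?_append_left, List.getElem?_append_left, List.getElem?_append_right]
  all_goals simp [length_edgeWords]
  all_goals omega

open Classical in
theorem getElem?_inputWords_mem (v : Fin n) :
    (inputWords eG U eH)[3 + 2 * eG.length + v]? = some (if v ∈ U then 1 else 0) := by
  rw [inputWords, List.getElem?_append_left, List.getElem?_append_right]
  · have e : 3 + 2 * eG.length + v.val -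
        ([n, eG.length, eH.length] ++ edgeWords eG).length = v := by
      simp [length_edgeWords]
      omega
    rw [e]
    simp
  all_goals simp [length_edgeWords]
  all_goals omega

theorem getElem?_inputWords_snd (i : ℕ) :
    (inputWords eG U eH)[3 + 2 * eG.length + n + i]? = (edgeWords eH)[i]? := by
  rw [inputWords, List.getElem?_append_right]
  · congr 1
    simp [length_edgeWords]
    omega
  · simp [length_edgeWords]
    omega

theorem Written.outputs {out : List (Fin n × Fin n)} {inp : ℕ → ℕ} {σ : Config}
    (h : Written inp (out.map fun p => (p.1.val, p.2.val))) (h₀ : inp 0 = out.length)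
    (hσ : ∀ i ≤ 2 * out.length, σ.mem i = inp i) : Outputs σ out := by
  intro i hi
  rw [List.length_cons, length_edgeWords] at hi
  rw [hσ i (by omega)]
  refine Option.some_injective _ ?_
  rw [← List.getElem?_eq_getElem]
  rcases i with _ | i
  · simp [h₀]
  · rw [List.getElem?_cons_succ]
    obtain ⟨j, hj | hj⟩ := Nat.even_or_odd' i
    all_goals
      have hj' : j < out.length := by omega
      have hw := h j (out[j].1.val, out[j].2.val) (by simp [hj'])
      obtain ⟨e₁, e₂⟩ := getElem?_edgeWords out j
      rw [hj]
    · rw [e₁, List.getElem?_eq_getElem hj', Option.map_some]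
      exact congrArg some ((congrArg inp (by omega)).trans hw.1)
    · rw [e₂, List.getElem?_eq_getElem hj', Option.map_some]
      exact congrArg some ((congrArg inp (by omega)).trans hw.2)

end Words

/-! ### The machine program -/

/-- Load the parameters of the input into registers. -/
def prelude : List Instr :=
  [.load 8 4, .const 4 1, .load 9 4, .const 4 2, .load 12 4, .const 10 3, .add 10 10 9,
    .add 10 10 9, .add 11 10 8, .add 12 12 12, .add 12 12 11, .add 3 12 0, .const 1 1, .const 2 20,
    .const 7 1]

def program : Program := prelude ++ Cmd.main.compile 15

/-- The values of the registers after the prelude. -/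
def startReg (n m h : ℕ) : ℕ → ℕ
  | 1 => 1
  | 2 => 20
  | 3 => 3 + 2 * m + n + 2 * h
  | 4 => 2
  | 7 => 1
  | 8 => n
  | 9 => m
  | 10 => 3 + 2 * m
  | 11 => 3 + 2 * m + n
  | 12 => 3 + 2 * m + n + 2 * h
  | _ => 0

theorem Steps.write {P : Program} {w X : ℕ} {σ : Config} {i : Instr} (hi : P[σ.pc]? = some i)
    (hX : X < 2 ^ w) (hr : ∀ r, σ.reg r ≤ X) (hm : ∀ j, σ.mem j ≤ X) {r k : ℕ}
    (he : i.apply σ = σ.write r k) (hk : k ≤ X) :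
    Steps P w 1 σ (σ.write r k) ∧ (∀ r', (σ.write r k).reg r' ≤ X) ∧
      ∀ j, (σ.write r k).mem j ≤ X := by
  have hr' : ∀ r', (σ.write r k).reg r' ≤ X := fun r' => by
    rw [write_reg]
    split_ifs
    · exact hk
    · exact hr r'
  refine ⟨?_, hr', hm⟩
  rw [← he]
  refine Steps.single hi ⟨fun r => (hr r).trans_lt hX, fun j => (hm j).trans_lt hX⟩ ?_
  rw [he]
  exact ⟨fun r => (hr' r).trans_lt hX, fun j => (hm j).trans_lt hX⟩

theorem steps_prelude {input : List ℕ} {n m h w X : ℕ} (hX : X < 2 ^ w)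
    (hin : ∀ j, input.getD j 0 ≤ X) (hn : input.getD 0 0 = n) (hm : input.getD 1 0 = m)
    (hh : input.getD 2 0 = h) (hL : 3 + 2 * m + n + 2 * h ≤ X) (h20 : 20 ≤ X) :
    Steps program w 15 (initial input) ⟨15, startReg n m h, fun i => input.getD i 0⟩ := by
  have b₀ : ∀ r, (initial input).reg r ≤ X := fun r => Nat.zero_le _
  -- Register 4 is still 0 here, so the first load reads cell 0.
  obtain ⟨s₁, r₁, m₁⟩ := Steps.write (P := program) (i := .load 8 4) rfl hX b₀ hin (r := 8) (k := n)
    (by simp [Instr.apply, initial, ← hn]) (by omega)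
  obtain ⟨s₂, r₂, m₂⟩ := Steps.write (P := program) (i := .const 4 1) rfl hX r₁ m₁ rfl (by omega)
  obtain ⟨s₃, r₃, m₃⟩ := Steps.write (P := program) (i := .load 9 4) rfl hX r₂ m₂ (r := 9) (k := m)
    (by simp [Instr.apply, Config.write, initial, ← hm]) (by omega)
  obtain ⟨s₄, r₄, m₄⟩ := Steps.write (P := program) (i := .const 4 2) rfl hX r₃ m₃ rfl (by omega)
  obtain ⟨s₅, r₅, m₅⟩ := Steps.write (P := program) (i := .load 12 4) rfl hX r₄ m₄ (r := 12)
    (k := h) (by simp [Instr.apply, Config.write, initial, ← hh]) (by omega)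
  obtain ⟨s₆, r₆, m₆⟩ := Steps.write (P := program) (i := .const 10 3) rfl hX r₅ m₅ rfl (by omega)
  obtain ⟨s₇, r₇, m₇⟩ := Steps.write (P := program) (i := .add 10 10 9) rfl hX r₆ m₆ (r := 10)
    (k := 3 + m) (by simp [Instr.apply, Config.write]) (by omega)
  obtain ⟨s₈, r₈, m₈⟩ := Steps.write (P := program) (i := .add 10 10 9) rfl hX r₇ m₇ (r := 10)
    (k := 3 + 2 * m) (by simp [Instr.apply, Config.write]; congr 1; ring) (by omega)
  obtain ⟨s₉, r₉, m₉⟩ := Steps.write (P := program) (i := .add 11 10 8) rfl hX r₈ m₈ (r := 11)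
    (k := 3 + 2 * m + n) (by simp [Instr.apply, Config.write]) (by omega)
  obtain ⟨s₁₀, r₁₀, m₁₀⟩ := Steps.write (P := program) (i := .add 12 12 12) rfl hX r₉ m₉ (r := 12)
    (k := 2 * h) (by simp [Instr.apply, Config.write]; congr 1; ring) (by omega)
  obtain ⟨s₁₁, r₁₁, m₁₁⟩ := Steps.write (P := program) (i := .add 12 12 11) rfl hX r₁₀ m₁₀ (r := 12)
    (k := 3 + 2 * m + n + 2 * h) (by simp [Instr.apply, Config.write]; congr 1; ring) (by omega)
  obtain ⟨s₁₂, r₁₂, m₁₂⟩ := Steps.write (P := program) (i := .add 3 12 0) rfl hX r₁₁ m₁₁ (r := 3)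
    (k := 3 + 2 * m + n + 2 * h) (by simp [Instr.apply, Config.write, initial]) (by omega)
  obtain ⟨s₁₃, r₁₃, m₁₃⟩ := Steps.write (P := program) (i := .const 1 1) rfl hX r₁₂ m₁₂ rfl
    (by omega)
  obtain ⟨s₁₄, r₁₄, m₁₄⟩ := Steps.write (P := program) (i := .const 2 20) rfl hX r₁₃ m₁₃ rfl
    (by omega)
  obtain ⟨s₁₅, r₁₅, m₁₅⟩ := Steps.write (P := program) (i := .const 7 1) rfl hX r₁₄ m₁₄ rfl
    (by omega)
  have hs := s₁.trans <| s₂.trans <| s₃.trans <| s₄.trans <| s₅.trans <| s₆.trans <| s₇.trans <|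
    s₈.trans <| s₉.trans <| s₁₀.trans <| s₁₁.trans <| s₁₂.trans <| s₁₃.trans <| s₁₄.trans s₁₅
  convert hs using 1
  simp only [Config.write, initial, Config.mk.injEq, true_and, and_true]
  funext r
  simp only [Function.update_apply]
  rcases lt_or_ge r 13 with hr | hr
  · interval_cases r <;> simp [startReg]
  · obtain ⟨r, rfl⟩ := Nat.exists_eq_add_of_le' hr
    simp [startReg]

end CoverRAM

/-! ### Resources -/

namespace CoverRAM

open PathCover Function

variable {n : ℕ}

theorem length_of_isEdgeList {E : Set (Sym2 (Fin n))} {l : List (Fin n × Fin n)}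
    (h : IsEdgeList E l) : l.length = E.ncard := by
  classical
  have : E = ((l.map fun p => s(p.1, p.2)).toFinset : Set (Sym2 (Fin n))) := by
    ext e
    rw [Finset.mem_coe, List.mem_toFinset, h.2]
  rw [this, Set.ncard_coe_finset, List.toFinset_card_of_nodup h.1, List.length_map]

theorem length_le_sq {E : Set (Sym2 (Fin n))} {l : List (Fin n × Fin n)}
    (h : IsEdgeList E l) : l.length ≤ n * n := by
  simpa using h.1.of_map.length_le_card

/-- The program solves the problem with the stated resources. -/
theorem runsTo_program {w : ℕ} {G : SimpleGraph (Fin n)} {H : G.Subgraph}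
    {eG eH : List (Fin n × Fin n)} (hG : IsEdgeList G.edgeSet eG) (hH : IsEdgeList H.edgeSet eH)
    (hw : 21 * (4 * eG.length + 3 * n + 6000 * (n * eG.length) + 34) + 20 < 2 ^ w) :
    ∃ (t : ℕ) (σ : Config) (out : List (Fin n × Fin n)) (F : Set (Sym2 (Fin n))),
      RunsTo program w (inputWords eG H.verts eH) t σ ∧ t ≤ 6000 * (n * eG.length) + 25 ∧
        Outputs σ out ∧ IsEdgeList F out ∧ IsMaxWeightCover H F := by
  set m := eG.length with hm
  set h := eH.length with hh
  have hhm : h ≤ m := length_le_of_isEdgeList hH hG H.edgeSet_subset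
  set B := 3 + 2 * m + n + 2 * h with hB
  set X := 3 + 4 * m + 3 * n + 20 with hX
  have hXw : X < 2 ^ w := by omega
  set input := inputWords eG H.verts eH with hinput
  have hin : ∀ j, input.getD j 0 ≤ X := by
    intro j
    rcases lt_or_ge j input.length with hj | hj
    · rw [List.getD_eq_getElem _ _ hj]
      have := le_of_mem_inputWords (List.getElem_mem hj)
      omega
    · rw [List.getD_eq_default _ _ hj]
      omega
  have hlen : input.length = B := length_inputWords
  have hpre := steps_prelude (input := input) (n := n) (m := m) (h := h) hXw hin rfl rfl rfl
    (by omega) (by omega)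
  set σ₀ : Config := ⟨15, startReg n m h, fun i => input.getD i 0⟩ with hσ₀
  -- Array cells lie behind the input, so they hold the default value 0.
  set s₀ : St := ⟨fun x => startReg n m h x.reg,
    fun A i => input.getD (B + 20 * i + A.ctorIdx) 0, fun i => input.getD i 0⟩ with hs₀
  have hrel : Rel B w X s₀ σ₀ := by
    refine ⟨rfl, rfl, rfl, rfl, fun _ => rfl, fun _ _ => rfl, fun _ _ => rfl, fun r _ _ => ?_, hin,
      fun r hr => ?_⟩
    · simp only [hσ₀]
      unfold startReg
      split <;> omega
    · simp only [hσ₀]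
      unfold startReg
      split <;> omega
  have hp : Params eG H.verts eH s₀ := by
    have hd : ∀ {i x}, input[i]? = some x → s₀.inp i = x := fun h => by
      simp [hs₀, List.getD_eq_getElem?_getD, h]
    refine ⟨rfl, rfl, rfl, rfl, rfl, rfl, rfl, fun i hi => hd ?_, fun i hi => hd ?_, fun v => hd ?_,
      fun i hi => hd ?_, fun i hi => hd ?_⟩
    · rw [getElem?_inputWords_fst _ (by omega), (getElem?_edgeWords _ _).1]
      simp [hi]
    · rw [add_assoc, getElem?_inputWords_fst _ (by omega), (getElem?_edgeWords _ _).2]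
      simp [hi]
    · exact getElem?_inputWords_mem v
    · rw [getElem?_inputWords_snd, (getElem?_edgeWords _ _).1]
      simp [hi]
    · rw [add_assoc, getElem?_inputWords_snd, (getElem?_edgeWords _ _).2]
      simp [hi]
  obtain ⟨t, ht, s, hrun, out, F, h₀, hwr, hF, hmax⟩ := ev_main (B := B) (L := 2 * n) hp hG hH hB
    le_rfl fun A i => List.getD_eq_default _ _ (by omega)
  replace ht : t ≤ 6000 * (n * m) + 10 := ht
  obtain ⟨τ, hst, hpc, hrel'⟩ := hrun.simulate (P := program) (w := w) (X := X) (σ := σ₀)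
    (codeAt_self prelude (Cmd.main.compile 15)) hrel (by omega) (by omega) (by omega)
  have hall := hpre.trans hst
  refine ⟨15 + t, τ, out, F, ⟨hall.2, hall.1, .inl ?_⟩, by omega, ?_, hF, hmax⟩
  · rw [hpc, List.getElem?_eq_none_iff, program, List.length_append, Cmd.length_compile]
    rfl
  · have hout : out.length ≤ m := length_le_of_isEdgeList hF hG
      (hmax.1.1.trans (SimpleGraph.edgeSet_mono fun u v huv => huv.1))
    exact hwr.outputs h₀ fun i hi => hrel'.inp i (by omega)

/-- With `N = 2 ^ (log₂ n + 1) > n` and `m ≤ n * n`, every term is at most a multiple of `N ^ 3`.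
The coefficients add up to less than `2 ^ 17 ≤ N ^ 17`, so `N ^ 20` suffices. -/
theorem word_length_le {m : ℕ} (hm : m ≤ n * n) :
    21 * (4 * m + 3 * n + 6000 * (n * m) + 34) + 20 < 2 ^ (20 * (Nat.log 2 n + 1)) := by
  set N := 2 ^ (Nat.log 2 n + 1) with hN
  have hn : n < N := Nat.lt_pow_succ_log_self one_lt_two n
  have h2 : 2 ≤ N := by
    rw [hN, pow_succ]
    have := Nat.one_le_two_pow (n := Nat.log 2 n)
    omega
  have e : 2 ^ (20 * (Nat.log 2 n + 1)) = N ^ 17 * N ^ 3 := by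
    rw [mul_comm, pow_mul, ← hN, ← pow_add]
  have h17 : 2 ^ 17 ≤ N ^ 17 := Nat.pow_le_pow_left h2 17
  have h3 : 2 ^ 17 * N ^ 3 ≤ N ^ 17 * N ^ 3 := Nat.mul_le_mul_right _ h17
  have hnm : n * m ≤ N ^ 3 := calc
    n * m ≤ N * (N * N) := Nat.mul_le_mul hn.le (hm.trans (Nat.mul_le_mul hn.le hn.le))
    _ = N ^ 3 := by ring
  have hmN : m ≤ N ^ 3 := calc
    m ≤ 1 * (N * N) := by rw [one_mul]; exact hm.trans (Nat.mul_le_mul hn.le hn.le)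
    _ ≤ N * (N * N) := Nat.mul_le_mul_right _ (by omega)
    _ = N ^ 3 := by ring
  have hnN : n ≤ N ^ 3 := hn.le.trans (Nat.le_self_pow (by norm_num) N)
  have h8 : 8 ≤ N ^ 3 := Nat.pow_le_pow_left h2 3
  rw [e]
  omega

/-- For `n ≥ 2` the logarithm is at least `log 2 > 0.6`, and `10000 * 0.6 = 6000`. For `n ≤ 1` the
logarithm gives no help, but then there are no edges. -/
theorem time_le {m t : ℕ} (hm : m ≤ n * n) (h₁ : n = 1 → m = 0) (ht : t ≤ 6000 * (n * m) + 25) :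
    (t : ℝ) ≤ 10000 * ((n : ℝ) * (m : ℝ) * Real.log (n : ℝ) + 1) := by
  have ht' : (t : ℝ) ≤ 6000 * ((n : ℝ) * m) + 25 := by exact_mod_cast ht
  have hnm : (0 : ℝ) ≤ (n : ℝ) * m := by positivity
  suffices h : 0.6 * ((n : ℝ) * m) ≤ (n : ℝ) * m * Real.log n by linarith
  rcases Nat.lt_or_ge n 2 with hn | hn
  · have : m = 0 := by
      interval_cases n
      · omega
      · exact h₁ rfl
    simp [this]
  · have h₂ : Real.log 2 ≤ Real.log n := Real.log_le_log (by norm_num) (by exact_mod_cast hn)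
    have := Real.log_two_gt_d9
    rw [mul_comm]
    exact mul_le_mul_of_nonneg_left (by linarith) hnm

end CoverRAM

/-- There is one word RAM program that, given any finite graph `G` (with `n` vertices and `m` edges)
and any subgraph `H` of `G`, outputs a maximum-weight path-cycle cover of the graph `G₁` belonging
to `G` and `H` in `O(n m log n)` steps on words of `O(log n)` bits. -/
theorem lemma4 :
    ∃ (P : PathCover.Program) (c : ℕ) (C : ℝ),
      ∀ (n m : ℕ) (G : SimpleGraph (Fin n)) (H : G.Subgraph) (eG eH : List (Fin n × Fin n)),
        PathCover.IsEdgeList G.edgeSet eG → PathCover.IsEdgeList H.edgeSet eH →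
        m = G.edgeSet.ncard →
        ∃ (t : ℕ) (s : PathCover.Config) (out : List (Fin n × Fin n)) (F : Set (Sym2 (Fin n))),
          PathCover.RunsTo P (c * (Nat.log 2 n + 1)) (PathCover.inputWords eG H.verts eH) t s ∧
          (t : ℝ) ≤ C * ((n : ℝ) * (m : ℝ) * Real.log (n : ℝ) + 1) ∧
          PathCover.Outputs s out ∧
          PathCover.IsEdgeList F out ∧
          PathCover.IsMaxWeightCover H F := by
  refine ⟨CoverRAM.program, 20, 10000, fun n m G H eG eH hG hH hm => ?_⟩
  obtain rfl : m = eG.length := hm.trans (CoverRAM.length_of_isEdgeList hG).symm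
  obtain ⟨t, s, out, F, h₁, h₂, h₃, h₄, h₅⟩ :=
    CoverRAM.runsTo_program hG hH (CoverRAM.word_length_le (CoverRAM.length_le_sq hG))
  refine ⟨t, s, out, F, h₁, CoverRAM.time_le (CoverRAM.length_le_sq hG) (fun hn => ?_) h₂, h₃, h₄,
    h₅⟩
  subst hn
  have : G.edgeSet = ∅ := by
    rw [Subsingleton.elim G ⊥, SimpleGraph.edgeSet_bot]
  rw [hm, this, Set.ncard_empty]
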